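/- **Definitions.** A *biquandle* is a set $X$ with two operations $(x,y)\mapsto x^{y}$ (also $x\,\underline{\triangleright}\,y$) and $(x,y)\mapsto x_{y}$ (also $x\,\overline{\triangleright}\,y$) such that $x^x=x_x$; the maps $x\mapsto x_y$, $x\mapsto x^y$ (for each $y$) and $(x,y)\mapsto(y_x,x^y)$ are bijective; and $(x^y)^{(z^y)}=(x^z)^{(y_z)}$, $(x^y)_{(z^y)}=(x_z)^{(y_z)}$, $(x_y)_{(z_y)}=(x_z)_{(y^z)}$ for all $x,y,z$. Let $R$ be a commutative ring with unit. A *biquandle $X$-virtual bracket* $\beta$ over $R$ consists of maps $A,B,V,C,D,U:X\times X\to R$, an element $\delta\in R$ and a unit $\omega\in R^{\times}$ such that for all $x,y\in X$ $$\omega=\delta A_{x,x}+B_{x,x}+V_{x,x},\qquad \omega^{-1}=\delta C_{x,x}+D_{x,x}+U_{x,x},$$ $$1=A_{x,y}C_{x,y}+V_{x,y}U_{x,y}=B_{x,y}D_{x,y}+V_{x,y}U_{x,y},\qquad 0=A_{x,y}U_{x,y}+V_{x,y}C_{x,y}=B_{x,y}U_{x,y}+V_{x,y}D_{x,y},$$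 $$0=\delta B_{x,y}D_{x,y}+A_{x,y}D_{x,y}+B_{x,y}C_{x,y}=\delta A_{x,y}C_{x,y}+A_{x,y}D_{x,y}+B_{x,y}C_{x,y},$$ and such that for all $x,y,z\in X$, with the abbreviations $FGH=F_{x,y}\,G_{x^y,z_y}\,H_{y,z}$ on the left-hand sides and $FGH=F_{y_x,z_x}\,G_{x,z}\,H_{x^z,y^z}$ on the right-hand sides, $$\begin{aligned} AAA+VAV&=AAA+VAV,\\ AAB+BAA+\delta BAB+BAV+BBB+BVB+VAB&=ABA,\\ ABA&=AAB+BAA+\delta BAB+BAV+BBB+BVB+VAB,\\ AVA&=AAV+VAA,\qquad AAV+VAA=AVA,\\ BBA+BVV&=ABB+VVB,\qquad ABB+VVB=BBA+BVV,\\ BBV+BVA&=ABV,\qquad ABV=BBV+BVA,\\ VBA&=AVB+VBB,\qquad AVB+VBB=VBA,\\ VVA&=AVV,\quad AVV=VVA,\quad VBV=VBV,\quad VVV=VVV. \end{aligned}$$ A *virtual knotoid diagram* is a generic immersed oriented open curve in $S^2$, from its tail to its head, each of whose double points is a classical crossing (with over/under information) or a virtual crossing; diagrams are taken up to isotopy of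 $S^2$. A *virtual knotoid* is an equivalence class of diagrams under the extended Reidemeister moves (classical moves I–III, virtual moves I–III, and the mixed move in which a strand with two virtual crossings passes a classical crossing), all performed away from the endpoints. The crossings divide $K$ into *semi-arcs*. Draw each classical crossing with both strands pointing downwards, and let $x,y$ be the colors of its two left-hand semi-arcs, $x$ on the under-strand and $y$ on the over-strand (at a positive crossing: $x$ on the incoming under- and $y$ on the outgoing over-semi-arc; at a negative crossing: $x$ on the outgoing under- and $y$ on the incoming over-semi-arc). An *$X$-coloring* $f$ of $K$ assigns elements of $X$ to the semi-arcs so that at each classical crossing the other semi-arc of the under-strand has color $x^y$ and the other semi-arc of the over-strand has color $y_x$, and so that colors do not change along a strand at a virtual crossing. $K_f$ denotes $K$ with the coloring $f$. A *state* $S$ of $K$ is obtained by smoothing every classical crossing vertically (joining each incoming end to the outgoing end of the other strand), horizontally (joining the two incoming ends and the two outgoing ends), or virtually (replacing it by a virtual crossing). A crossing with colors $x,y$ as above contributes $A_{x,y},B_{x,y},V_{x,y}$ respectively if it is positive, and $C_{x,y},D_{x,y},U_{x,y}$ if it is negative; $\beta(S)$ is the product of these contributions times $\delta^{m}\omega^{-wr(K)}$,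 where $m$ is the number of components of $S$, the open one included, and $wr(K)$ is the number of positive minus the number of negative classical crossings. Put $\beta(K_f)=\sum_S\beta(S)$. **Theorem.** Let $X$ be a biquandle, $R$ a commutative ring with unit and $\beta$ an $X$-virtual bracket over $R$. 1. Let $K'$ be obtained from $K$ by one of the extended Reidemeister moves (in either direction) or by an isotopy of $S^2$. Then for each $X$-coloring $f$ of $K$ there is exactly one $X$-coloring $f'$ of $K'$ that agrees with $f$ outside the disk in which the move takes place, and $\beta(K_f)=\beta(K'_{f'})$. 2. Let $X=\{x_1,\dots,x_n\}$ be finite. For all $i,j$ the multiset $$\Phi^{\beta,M}_{X_{ij}}(K)=\{\beta(K_f)\mid f \text{ an } X\text{-coloring of } K \text{ with tail semi-arc colored } x_i \text{ and head semi-arc colored } x_j\}$$ depends only on the virtual knotoid represented by $K$. So does the $X$-virtual bracket matrix $\mathcal M^{\beta}_X(K)$, whose $(i,j)$ entry is the formal sum $\sum_f u^{\beta(K_f)}$ over the same colorings $f$, with $u$ a formal variable with exponents in $R$. -/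

import Mathlib

/-! ### Biquandles and biquandle virtual brackets -/

/-- A biquandle. `underOp x y` is `x ▷ y` with the bar below the triangle (also written `x ^ y`),
`overOp x y` is `x ▷ y` with the bar above the triangle (also written `x _ y`). -/
class Biquandle (X : Type*) where
  underOp : X → X → X
  overOp : X → X → X
  under_self : ∀ x, underOp x x = overOp x x
  over_bijective : ∀ y, Function.Bijective fun x => overOp x y
  under_bijective : ∀ y, Function.Bijective fun x => underOp x y
  side_bijective : Function.Bijective fun p : X × X => (overOp p.2 p.1, underOp p.1 p.2)
  exchange_uu : ∀ x y z, underOp (underOp x y) (underOp z y) = underOp (underOp x z) (overOp y z)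
  exchange_uo : ∀ x y z, overOp (underOp x y) (underOp z y) = underOp (overOp x z) (overOp y z)
  exchange_oo : ∀ x y z, overOp (overOp x y) (overOp z y) = overOp (overOp x z) (underOp y z)

infixl:75 " ▷ᵤ " => Biquandle.underOp
infixl:75 " ▷ₒ " => Biquandle.overOp

/-- A biquandle `X`-virtual bracket over `R`: six coefficient maps, an element `δ` and a unit `ω`.
The axioms `r3_01`, ..., `r3_15` compare the coefficients of the fifteen ways of joining the six
ends of the two sides of a Reidemeister III move. -/
structure VirtualBracket (X R : Type*) [Biquandle X] [CommRing R] where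
  (A B V C D U : X → X → R)
  δ : R
  ω : Rˣ
  r1_pos : ∀ x, (ω : R) = δ * A x x + B x x + V x x
  r1_neg : ∀ x, ((ω⁻¹ : Rˣ) : R) = δ * C x x + D x x + U x x
  r2_AC : ∀ x y, 1 = A x y * C x y + V x y * U x y
  r2_BD : ∀ x y, 1 = B x y * D x y + V x y * U x y
  r2_AU : ∀ x y, 0 = A x y * U x y + V x y * C x y
  r2_BU : ∀ x y, 0 = B x y * U x y + V x y * D x y
  r2_δBD : ∀ x y, 0 = δ * B x y * D x y + A x y * D x y + B x y * C x y
  r2_δAC : ∀ x y, 0 = δ * A x y * C x y + A x y * D x y + B x y * C x y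
  r3_01 : ∀ x y z,
    A x y * A (x ▷ᵤ y) (z ▷ₒ y) * A y z + V x y * A (x ▷ᵤ y) (z ▷ₒ y) * V y z =
      A (y ▷ₒ x) (z ▷ₒ x) * A x z * A (x ▷ᵤ z) (y ▷ᵤ z)
        + V (y ▷ₒ x) (z ▷ₒ x) * A x z * V (x ▷ᵤ z) (y ▷ᵤ z)
  r3_02 : ∀ x y z,
    A x y * A (x ▷ᵤ y) (z ▷ₒ y) * B y z + B x y * A (x ▷ᵤ y) (z ▷ₒ y) * A y z
        + δ * B x y * A (x ▷ᵤ y) (z ▷ₒ y) * B y z + B x y * A (x ▷ᵤ y) (z ▷ₒ y) * V y z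
        + B x y * B (x ▷ᵤ y) (z ▷ₒ y) * B y z + B x y * V (x ▷ᵤ y) (z ▷ₒ y) * B y z
        + V x y * A (x ▷ᵤ y) (z ▷ₒ y) * B y z =
      A (y ▷ₒ x) (z ▷ₒ x) * B x z * A (x ▷ᵤ z) (y ▷ᵤ z)
  r3_03 : ∀ x y z,
    A x y * B (x ▷ᵤ y) (z ▷ₒ y) * A y z =
      A (y ▷ₒ x) (z ▷ₒ x) * A x z * B (x ▷ᵤ z) (y ▷ᵤ z)
        + B (y ▷ₒ x) (z ▷ₒ x) * A x z * A (x ▷ᵤ z) (y ▷ᵤ z)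
        + δ * B (y ▷ₒ x) (z ▷ₒ x) * A x z * B (x ▷ᵤ z) (y ▷ᵤ z)
        + B (y ▷ₒ x) (z ▷ₒ x) * A x z * V (x ▷ᵤ z) (y ▷ᵤ z)
        + B (y ▷ₒ x) (z ▷ₒ x) * B x z * B (x ▷ᵤ z) (y ▷ᵤ z)
        + B (y ▷ₒ x) (z ▷ₒ x) * V x z * B (x ▷ᵤ z) (y ▷ᵤ z)
        + V (y ▷ₒ x) (z ▷ₒ x) * A x z * B (x ▷ᵤ z) (y ▷ᵤ z)
  r3_04 : ∀ x y z,
    A x y * V (x ▷ᵤ y) (z ▷ₒ y) * A y z =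
      A (y ▷ₒ x) (z ▷ₒ x) * A x z * V (x ▷ᵤ z) (y ▷ᵤ z)
        + V (y ▷ₒ x) (z ▷ₒ x) * A x z * A (x ▷ᵤ z) (y ▷ᵤ z)
  r3_05 : ∀ x y z,
    A x y * A (x ▷ᵤ y) (z ▷ₒ y) * V y z + V x y * A (x ▷ᵤ y) (z ▷ₒ y) * A y z =
      A (y ▷ₒ x) (z ▷ₒ x) * V x z * A (x ▷ᵤ z) (y ▷ᵤ z)
  r3_06 : ∀ x y z,
    B x y * B (x ▷ᵤ y) (z ▷ₒ y) * A y z + B x y * V (x ▷ᵤ y) (z ▷ₒ y) * V y z =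
      A (y ▷ₒ x) (z ▷ₒ x) * B x z * B (x ▷ᵤ z) (y ▷ᵤ z)
        + V (y ▷ₒ x) (z ▷ₒ x) * V x z * B (x ▷ᵤ z) (y ▷ᵤ z)
  r3_07 : ∀ x y z,
    A x y * B (x ▷ᵤ y) (z ▷ₒ y) * B y z + V x y * V (x ▷ᵤ y) (z ▷ₒ y) * B y z =
      B (y ▷ₒ x) (z ▷ₒ x) * B x z * A (x ▷ᵤ z) (y ▷ᵤ z)
        + B (y ▷ₒ x) (z ▷ₒ x) * V x z * V (x ▷ᵤ z) (y ▷ᵤ z)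
  r3_08 : ∀ x y z,
    B x y * B (x ▷ᵤ y) (z ▷ₒ y) * V y z + B x y * V (x ▷ᵤ y) (z ▷ₒ y) * A y z =
      A (y ▷ₒ x) (z ▷ₒ x) * B x z * V (x ▷ᵤ z) (y ▷ᵤ z)
  r3_09 : ∀ x y z,
    A x y * B (x ▷ᵤ y) (z ▷ₒ y) * V y z =
      B (y ▷ₒ x) (z ▷ₒ x) * B x z * V (x ▷ᵤ z) (y ▷ᵤ z)
        + B (y ▷ₒ x) (z ▷ₒ x) * V x z * A (x ▷ᵤ z) (y ▷ᵤ z)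
  r3_10 : ∀ x y z,
    V x y * B (x ▷ᵤ y) (z ▷ₒ y) * A y z =
      A (y ▷ₒ x) (z ▷ₒ x) * V x z * B (x ▷ᵤ z) (y ▷ᵤ z)
        + V (y ▷ₒ x) (z ▷ₒ x) * B x z * B (x ▷ᵤ z) (y ▷ᵤ z)
  r3_11 : ∀ x y z,
    A x y * V (x ▷ᵤ y) (z ▷ₒ y) * B y z + V x y * B (x ▷ᵤ y) (z ▷ₒ y) * B y z =
      V (y ▷ₒ x) (z ▷ₒ x) * B x z * A (x ▷ᵤ z) (y ▷ᵤ z)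
  r3_12 : ∀ x y z,
    V x y * V (x ▷ᵤ y) (z ▷ₒ y) * A y z =
      A (y ▷ₒ x) (z ▷ₒ x) * V x z * V (x ▷ᵤ z) (y ▷ᵤ z)
  r3_13 : ∀ x y z,
    A x y * V (x ▷ᵤ y) (z ▷ₒ y) * V y z =
      V (y ▷ₒ x) (z ▷ₒ x) * V x z * A (x ▷ᵤ z) (y ▷ᵤ z)
  r3_14 : ∀ x y z,
    V x y * B (x ▷ᵤ y) (z ▷ₒ y) * V y z =
      V (y ▷ₒ x) (z ▷ₒ x) * B x z * V (x ▷ᵤ z) (y ▷ᵤ z)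
  r3_15 : ∀ x y z,
    V x y * V (x ▷ᵤ y) (z ▷ₒ y) * V y z =
      V (y ▷ₒ x) (z ▷ₒ x) * V x z * V (x ▷ᵤ z) (y ▷ᵤ z)

/-! ### Virtual knotoid diagrams

A diagram on the oriented sphere, up to isotopy of the sphere, is recorded by the sequence of its
passages through crossings, read from the tail to the head. -/

/-- Of the strand at the crossing: over-strand, under-strand, or virtual crossing. -/
inductive Level
  | upper
  | lower
  | virt
  deriving DecidableEq

/-- One passage of the curve through a crossing. -/
structure Pass where
  /-- the name of the crossing -/
  label : ℕ
  level : Level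
  /-- `true` if the other strand of the crossing runs from right to left as seen from this strand,
  `false` if it runs from left to right -/
  toLeft : Bool

def Pass.relabel (e : Equiv.Perm ℕ) (p : Pass) : Pass := { p with label := e p.label }

/-- The two passages through one crossing: over and under, or both virtual; if one strand sees the
other one going to the left, then the other one sees the first one going to the right. -/
def Pass.Fits (p q : Pass) : Prop :=
  q.toLeft = !p.toLeft ∧
    ((p.level = Level.upper ∧ q.level = Level.lower) ∨
      (p.level = Level.lower ∧ q.level = Level.upper) ∨
      (p.level = Level.virt ∧ q.level = Level.virt))

/-- Every crossing is passed exactly twice, in a compatible way. -/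
def IsCode (w : List Pass) : Prop :=
  ∀ i : Fin w.length, (∃! j : Fin w.length, j ≠ i ∧ w[j].label = w[i].label) ∧
    ∀ j : Fin w.length, j ≠ i → w[j].label = w[i].label → w[i].Fits w[j]

/-- The semi-arcs of a code are numbered from the tail semi-arc `0` to the head semi-arc
`w.length`; the `i`-th passage comes in along semi-arc `i` and leaves along semi-arc `i + 1`. -/
abbrev SemiArc (w : List Pass) := Fin (w.length + 1)

abbrev inArc {w : List Pass} (i : Fin w.length) : SemiArc w := i.castSucc

abbrev outArc {w : List Pass} (i : Fin w.length) : SemiArc w := i.succ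

/-- Two different passages through the same crossing. -/
def Mates {w : List Pass} (i j : Fin w.length) : Prop := j ≠ i ∧ w[j].label = w[i].label

/-- A semi-arc with a direction of travel (`true`: along the orientation of the curve, `false`:
against it). `FaceStep w` sends such a semi-arc to the next one on the boundary of the
complementary region that lies on the left of the traveller: at a crossing one turns left, at an
endpoint one turns back. -/
inductive FaceStep (w : List Pass) : SemiArc w × Bool → SemiArc w × Bool → Prop
  | tail : FaceStep w (0, false) (0, true)
  | head : FaceStep w (Fin.last _, true) (Fin.last _, false)
  | forward_left (i j : Fin w.length) : Mates i j → w[i].toLeft = true →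
      FaceStep w (inArc i, true) (outArc j, true)
  | forward_right (i j : Fin w.length) : Mates i j → w[i].toLeft = false →
      FaceStep w (inArc i, true) (inArc j, false)
  | backward_left (i j : Fin w.length) : Mates i j → w[i].toLeft = true →
      FaceStep w (outArc i, false) (inArc j, false)
  | backward_right (i j : Fin w.length) : Mates i j → w[i].toLeft = false →
      FaceStep w (outArc i, false) (outArc j, true)

/-- The number of boundary cycles of complementary regions. -/
noncomputable def faceCount (w : List Pass) : ℕ := Nat.card (Quot (FaceStep w))

/-- The code is that of a curve on the sphere: with `n` crossings, two endpoints and `2n + 1`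
semi-arcs, Euler's formula `(n + 2) - (2n + 1) + faces = 2` reads `faces = n + 1`, and
`w.length = 2n`. -/
def IsSpherical (w : List Pass) : Prop := 2 * faceCount w = w.length + 2

/-- A virtual knotoid diagram on the sphere, up to isotopy. -/
structure VirtualKnotoidDiagram where
  code : List Pass
  isCode : IsCode code
  isSpherical : IsSpherical code

/-! ### Extended Reidemeister moves -/

/-- Levels of the two strands in a move with two strands: the first one is over the second one, or
under it, or the crossings are virtual. -/
inductive StrandLevels : Level → Level → Prop
  | over_under : StrandLevels Level.upper Level.lower
  | under_over : StrandLevels Level.lower Level.upper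
  | virt_virt : StrandLevels Level.virt Level.virt

/-- Three strands, the `i`-th one with consecutive passages `p i`, `q i`, such that any two of them
cross, and the three middle semi-arcs bound a triangular region. The second clause says that each
strand has the region on a fixed side (on the left if `s = true`): there the crossing strand
leaves towards the left exactly if its middle semi-arc comes after the crossing. -/
def IsTriangle (p q : Fin 3 → Pass) : Prop :=
  (∀ i j, i ≠ j → ∃ t s : Pass, (t = p i ∨ t = q i) ∧ (s = p j ∨ s = q j) ∧ t.label = s.label) ∧
  ∀ i, ∃ s : Bool, ∀ j, j ≠ i → ∀ t : Pass, (t = p i ∨ t = q i) →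
    (t.label = (p j).label → t.toLeft = s) ∧ (t.label = (q j).label → t.toLeft = !s)

/-- The levels in a third Reidemeister move: one strand is over and one strand is under the other
two (classical move), or all crossings of one strand are virtual (virtual and mixed moves). The
forbidden moves, with just one virtual crossing, are excluded. -/
def TriangleLevels (p q : Fin 3 → Pass) : Prop :=
  ((∃ i, (p i).level = Level.upper ∧ (q i).level = Level.upper) ∧
    ∃ j, (p j).level = Level.lower ∧ (q j).level = Level.lower) ∨
  ∃ i, (p i).level = Level.virt ∧ (q i).level = Level.virt

/-- `Move w w' ρ`: the code `w'` arises from `w` by an extended Reidemeister move (classical,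
virtual or mixed) or by renaming crossings, and `ρ i j` says that semi-arcs `i` of `w` and `j`
of `w'` have a common part outside the disk where the move takes place. -/
inductive Move : List Pass → List Pass → (ℕ → ℕ → Prop) → Prop
  | rename (w : List Pass) (e : Equiv.Perm ℕ) :
      Move w (w.map (Pass.relabel e)) (fun i j => j = i)
  | r1 (l₀ l₁ : List Pass) (p q : Pass) :
      p.label = q.label → StrandLevels p.level q.level →
      Move (l₀ ++ l₁) (l₀ ++ [p, q] ++ l₁)
        (fun i j => (i ≤ l₀.length ∧ j = i) ∨ (l₀.length ≤ i ∧ j = i + 2))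
  | r2 (l₀ l₁ l₂ : List Pass) (p q p' q' : Pass) :
      ((p'.label = p.label ∧ q'.label = q.label) ∨ (p'.label = q.label ∧ q'.label = p.label)) →
      q.level = p.level → q'.level = p'.level → StrandLevels p.level p'.level →
      q.toLeft = !p.toLeft →
      Move (l₀ ++ l₁ ++ l₂) (l₀ ++ [p, q] ++ l₁ ++ [p', q'] ++ l₂)
        (fun i j => (i ≤ l₀.length ∧ j = i) ∨
          (l₀.length ≤ i ∧ i ≤ l₀.length + l₁.length ∧ j = i + 2) ∨
          (l₀.length + l₁.length ≤ i ∧ j = i + 4))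
  | r3 (l₀ l₁ l₂ l₃ : List Pass) (p q : Fin 3 → Pass) :
      IsTriangle p q → TriangleLevels p q →
      Move (l₀ ++ [p 0, q 0] ++ l₁ ++ [p 1, q 1] ++ l₂ ++ [p 2, q 2] ++ l₃)
        (l₀ ++ [q 0, p 0] ++ l₁ ++ [q 1, p 1] ++ l₂ ++ [q 2, p 2] ++ l₃)
        (fun i j => j = i ∧ i ≠ l₀.length + 1 ∧ i ≠ l₀.length + l₁.length + 3 ∧
          i ≠ l₀.length + l₁.length + l₂.length + 5)
  | symm (w w' : List Pass) (ρ : ℕ → ℕ → Prop) : Move w w' ρ → Move w' w (fun i j => ρ j i)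

/-- Two diagrams represent the same virtual knotoid. -/
def SameVirtualKnotoid : VirtualKnotoidDiagram → VirtualKnotoidDiagram → Prop :=
  Relation.EqvGen fun K K' => ∃ ρ, Move K.code K'.code ρ

/-! ### Colorings -/

/-- The classical crossings, each given by its over-passage and its under-passage. -/
def classicalCrossings (w : List Pass) : Finset (Fin w.length × Fin w.length) :=
  Finset.univ.filter fun c =>
    w[c.1].level = Level.upper ∧ w[c.2].level = Level.lower ∧ w[c.1].label = w[c.2].label

abbrev Crossing (w : List Pass) := {c // c ∈ classicalCrossings w}

namespace Crossing

variable {w : List Pass}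

abbrev overPass (c : Crossing w) : Fin w.length := c.1.1

abbrev underPass (c : Crossing w) : Fin w.length := c.1.2

/-- A crossing is positive if the under-strand runs from right to left as seen from the
over-strand. -/
def isPositive (c : Crossing w) : Bool := w[c.overPass].toLeft

/-- Draw the crossing with both strands going downwards. Then `x` and `y` are the colors of the two
semi-arcs on the left of the picture, `x` on the under-strand and `y` on the over-strand: at a
positive crossing `x` is the incoming under-semi-arc and `y` the outgoing over-semi-arc; at a
negative crossing `x` is the outgoing under-semi-arc and `y` the incoming over-semi-arc. -/
def x {X : Type*} (c : Crossing w) (f : SemiArc w → X) : X :=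
  if c.isPositive then f (inArc c.underPass) else f (outArc c.underPass)

def y {X : Type*} (c : Crossing w) (f : SemiArc w → X) : X :=
  if c.isPositive then f (outArc c.overPass) else f (inArc c.overPass)

/-- The color of the semi-arc on the right of the picture that continues `x`. -/
def xNext {X : Type*} (c : Crossing w) (f : SemiArc w → X) : X :=
  if c.isPositive then f (outArc c.underPass) else f (inArc c.underPass)

/-- The color of the semi-arc on the right of the picture that continues `y`. -/
def yNext {X : Type*} (c : Crossing w) (f : SemiArc w → X) : X :=
  if c.isPositive then f (inArc c.overPass) else f (outArc c.overPass)

end Crossing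

def IsColoring {X : Type*} [Biquandle X] (w : List Pass) (f : SemiArc w → X) : Prop :=
  (∀ c : Crossing w, c.xNext f = c.x f ▷ᵤ c.y f ∧ c.yNext f = c.y f ▷ₒ c.x f) ∧
  ∀ i : Fin w.length, w[i].level = Level.virt → f (outArc i) = f (inArc i)

/-- The `X`-colorings of a virtual knotoid diagram. -/
abbrev Coloring (K : VirtualKnotoidDiagram) (X : Type*) [Biquandle X] :=
  {f : SemiArc K.code → X // IsColoring K.code f}

namespace Coloring

variable {X : Type*} [Biquandle X] {K : VirtualKnotoidDiagram}

def tailColor (f : Coloring K X) : X := f.1 0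

def headColor (f : Coloring K X) : X := f.1 (Fin.last _)

/-- The colorings agree outside the disk where the move takes place. -/
def Agree {K' : VirtualKnotoidDiagram} (ρ : ℕ → ℕ → Prop) (f : Coloring K X)
    (f' : Coloring K' X) : Prop :=
  ∀ (i : SemiArc K.code) (j : SemiArc K'.code), ρ i j → f.1 i = f'.1 j

end Coloring

/-! ### The state sum -/

inductive Smoothing
  | vertical
  | horizontal
  | virt

instance : Fintype Smoothing where
  elems := ⟨[Smoothing.vertical, Smoothing.horizontal, Smoothing.virt], by simp⟩
  complete s := by cases s <;> simp

/-- A state: a choice of a smoothing at each classical crossing. -/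
abbrev KnotoidState (w : List Pass) := Crossing w → Smoothing

/-- Semi-arcs that are joined to each other in a state. With both strands of a crossing drawn
vertically, the vertical smoothing joins each incoming end to the outgoing end of the other strand,
and the horizontal smoothing joins the two incoming ends and the two outgoing ends. Both strands
go straight through virtual crossings. -/
inductive KnotoidState.Join {w : List Pass} (S : KnotoidState w) : SemiArc w → SemiArc w → Prop
  | through (i : Fin w.length) : w[i].level = Level.virt → Join S (inArc i) (outArc i)
  | vertical_left (c : Crossing w) : S c = Smoothing.vertical →
      Join S (inArc c.overPass) (outArc c.underPass)
  | vertical_right (c : Crossing w) : S c = Smoothing.vertical →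
      Join S (inArc c.underPass) (outArc c.overPass)
  | horizontal_in (c : Crossing w) : S c = Smoothing.horizontal →
      Join S (inArc c.overPass) (inArc c.underPass)
  | horizontal_out (c : Crossing w) : S c = Smoothing.horizontal →
      Join S (outArc c.overPass) (outArc c.underPass)
  | virt_over (c : Crossing w) : S c = Smoothing.virt →
      Join S (inArc c.overPass) (outArc c.overPass)
  | virt_under (c : Crossing w) : S c = Smoothing.virt →
      Join S (inArc c.underPass) (outArc c.underPass)

/-- The number of components of a state (closed curves and the open curve). -/
noncomputable def KnotoidState.componentCount {w : List Pass} (S : KnotoidState w) : ℕ :=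
  Nat.card (Quot S.Join)

def writhe (w : List Pass) : ℤ := ∑ c : Crossing w, if c.isPositive then 1 else -1

namespace VirtualBracket

variable {X R : Type*} [Biquandle X] [CommRing R]

/-- The coefficient map for a crossing of the given sign (`true`: positive) and a smoothing. -/
def coeff (β : VirtualBracket X R) : Bool → Smoothing → X → X → R
  | true, Smoothing.vertical => β.A
  | true, Smoothing.horizontal => β.B
  | true, Smoothing.virt => β.V
  | false, Smoothing.vertical => β.C
  | false, Smoothing.horizontal => β.D
  | false, Smoothing.virt => β.U

/-- The contribution of a state. -/
noncomputable def stateValue (β : VirtualBracket X R) {w : List Pass} (f : SemiArc w → X)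
    (S : KnotoidState w) : R :=
  (∏ c : Crossing w, β.coeff c.isPositive (S c) (c.x f) (c.y f)) *
    β.δ ^ S.componentCount * ((β.ω ^ (-writhe w) : Rˣ) : R)

/-- The `X`-virtual bracket of an `X`-colored virtual knotoid diagram. -/
noncomputable def value (β : VirtualBracket X R) {K : VirtualKnotoidDiagram}
    (f : Coloring K X) : R :=
  ∑ S : KnotoidState K.code, β.stateValue f.1 S

open Classical in
/-- The colorings with tail color `a` and head color `b`. -/
noncomputable def coloringsFromTo [Fintype X] (K : VirtualKnotoidDiagram) (a b : X) :
    Finset (Coloring K X) :=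
  Finset.univ.filter fun f => f.tailColor = a ∧ f.headColor = b

/-- The multiset of the bracket values of the colorings with tail color `a` and head color `b`. -/
noncomputable def valueMultiset [Fintype X] (β : VirtualBracket X R) (K : VirtualKnotoidDiagram)
    (a b : X) : Multiset R :=
  (coloringsFromTo K a b).val.map fun f => β.value f

/-- The `X`-virtual bracket matrix. Its entries are formal sums of powers `u ^ r` of a formal
variable with exponents `r` in `R`, that is, elements of the monoid algebra of `(R, +)`;
`u ^ r` is `AddMonoidAlgebra.single r 1`. -/
noncomputable def bracketMatrix [Fintype X] (β : VirtualBracket X R)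
    (K : VirtualKnotoidDiagram) : Matrix X X (AddMonoidAlgebra ℤ R) :=
  Matrix.of fun a b =>
    ∑ f ∈ coloringsFromTo K a b, AddMonoidAlgebra.single (β.value f) (1 : ℤ)

end VirtualBracket

/-! The bracket is turned into a local object. A state is a way of joining semi-arcs, that is, an
equivalence relation on their numbers. Such relations form a commutative monoid under join, `Joins`,
and `StateRing` is its monoid algebra over `R`. A classical crossing becomes a combination of three
pairings of its four ends (`joint`), a virtual passage becomes an edge, and a colored diagram
becomes the product of these elements. The map `integral δ m` deletes the point `m`, with a factor
`δ` if `m` was alone in its class. Deleting all semi-arcs turns the product into the state sum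
(`integrals_diagram`); the writhe factor is spread over the crossings by `weight`.

Deletions commute, and a factor that does not involve `m` passes through the deletion of `m`
(`Free`). Hence it suffices to compare the two sides of a move inside its disk, after deletion of
the inner semi-arcs (`stateSum_eq_of_integrals`). A kink gives a plain edge by the axioms `r1`
(`integral_kink`), a bigon gives two edges by the axioms `r2` (`integral_bigon`). In a mixed move,
deletion of the inner points next to virtual passages leaves a crossing that does not remember the
order of the passages (`IsDetour.integral_eq`).

For the classical third move the fifteen axioms `r3` compare the coefficients of the fifteen perfect
matchings of six ends. This settles three positive crossings (`slides_positive`). All other signs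
follow by trading one crossing for its cancelling partner (`Slides.toggle`): partners are glued to
both sides of a known move, and on each side one of them cancels in a bigon. The biquandle axioms
enter through the fact that one end of each strand at a crossing determines the other two colors
(`Regular`), so outer colors determine inner ones.

On the level of codes a move changes only pairs of consecutive passages (`fill`), which have no
classical crossing with the other passages (`Saturated.apart`). For the first and second move, the
shorter code is first brought to the length of the longer one by dummy virtual passages
(`expands_insert`). Colorings then correspond bijectively with equal state sums and equal end colors
(`transfers_of_move`), which gives both parts of the theorem. -/

/-! ### The ring of joins

Linear combinations of ways of joining points, where points are natural numbers. The product of two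
ways of joining is made by performing both of them. -/

/-- A way of joining points, recorded as an equivalence relation. -/
def Joins := Setoid ℕ

namespace Joins

instance : CommMonoid Joins where
  mul a b := (a ⊔ b : Setoid ℕ)
  one := (⊥ : Setoid ℕ)
  mul_assoc a b c := sup_assoc (α := Setoid ℕ) a b c
  one_mul a := bot_sup_eq (α := Setoid ℕ) a
  mul_one a := sup_bot_eq (α := Setoid ℕ) a
  mul_comm a b := sup_comm (α := Setoid ℕ) a b

/-- Two points are joined. -/
def Rel (E : Joins) (x y : ℕ) : Prop := Setoid.r (self := E) x y

/-- One way of joining is contained in the other one. -/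
def Within (E G : Joins) : Prop := ∀ x y, E.Rel x y → G.Rel x y

variable {E F G : Joins} {m n p q x y : ℕ}

theorem Rel.refl (E : Joins) (x : ℕ) : E.Rel x x := Setoid.refl' E x

theorem Rel.symm (h : E.Rel x y) : E.Rel y x := Setoid.symm' E h

theorem Rel.trans {z : ℕ} (h : E.Rel x y) (h' : E.Rel y z) : E.Rel x z := Setoid.trans' E h h'

theorem ext (h : ∀ x y, E.Rel x y ↔ F.Rel x y) : E = F := Setoid.ext h

theorem Within.antisymm (h : Within E F) (h' : Within F E) : E = F :=
  ext fun x y => ⟨h x y, h' x y⟩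

theorem mul_within : Within (E * F) G ↔ Within E G ∧ Within F G :=
  sup_le_iff (α := Setoid ℕ) (a := E) (b := F) (c := G)

theorem within_refl : Within E E := fun _ _ h => h

theorem within_mul_left : Within E (E * F) := (mul_within.1 within_refl).1

theorem within_mul_right : Within F (E * F) := (mul_within.1 within_refl).2

theorem one_within : Within 1 E := bot_le (α := Setoid ℕ) (a := E)

theorem one_rel : Rel 1 x y ↔ x = y := Iff.rfl

theorem prod_within {ι : Type*} (s : Finset ι) (E : ι → Joins) :
    Within (∏ i ∈ s, E i) G ↔ ∀ i ∈ s, Within (E i) G := by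
  classical
  induction s using Finset.induction_on with
  | empty => simp [one_within]
  | insert a s ha ih => simp [Finset.prod_insert ha, mul_within, ih]

/-- Only the points `p` and `q` are joined. -/
def pair (p q : ℕ) : Joins := Relation.EqvGen.setoid fun a b => a = p ∧ b = q

theorem pair_within : Within (pair p q) G ↔ G.Rel p q := by
  constructor
  · exact fun h => h _ _ (Relation.EqvGen.rel _ _ ⟨rfl, rfl⟩)
  · intro h x y hxy
    induction hxy with
    | rel x y h' => obtain ⟨rfl, rfl⟩ := h'; exact h
    | refl x => exact Rel.refl _ x
    | symm x y _ ih => exact ih.symm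
    | trans x y z _ _ ih ih' => exact ih.trans ih'

theorem pair_rel : (pair p q).Rel p q := pair_within.1 within_refl

theorem pair_self (p : ℕ) : pair p p = 1 :=
  Within.antisymm (pair_within.2 (Rel.refl _ _)) one_within

theorem pair_comm (p q : ℕ) : pair p q = pair q p :=
  Within.antisymm (pair_within.2 pair_rel.symm) (pair_within.2 pair_rel.symm)

/-- The substitution rule behind all later computations: once `m` is joined to `p`, any other join
at `m` may be attached to `p` instead. -/
theorem pair_mul_pair (m p q : ℕ) : pair m p * pair m q = pair m p * pair p q := by
  have h1 : ∀ {a b c d : ℕ}, (pair a b * pair c d).Rel a b := within_mul_left _ _ pair_rel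
  have h2 : ∀ {a b c d : ℕ}, (pair a b * pair c d).Rel c d := within_mul_right _ _ pair_rel
  apply Within.antisymm <;> rw [mul_within, pair_within, pair_within]
  · exact ⟨h1, h1.trans h2⟩
  · exact ⟨h1, h1.symm.trans h2⟩

/-- The point `m` is not joined to another point. -/
def Isolated (m : ℕ) (E : Joins) : Prop := ∀ y, E.Rel m y → y = m

/-- The point `m` is cut off. -/
def cut (m : ℕ) (E : Joins) : Joins where
  r x y := x = y ∨ (x ≠ m ∧ y ≠ m ∧ E.Rel x y)
  iseqv := by
    refine ⟨fun x => Or.inl rfl, ?_, ?_⟩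
    · rintro x y (rfl | ⟨h1, h2, h3⟩)
      · exact Or.inl rfl
      · exact Or.inr ⟨h2, h1, h3.symm⟩
    · rintro x y z (rfl | ⟨h1, h2, h3⟩) (rfl | ⟨h4, h5, h6⟩)
      · exact Or.inl rfl
      · exact Or.inr ⟨h4, h5, h6⟩
      · exact Or.inr ⟨h1, h2, h3⟩
      · exact Or.inr ⟨h1, h5, h3.trans h6⟩

theorem cut_rel : (cut m E).Rel x y ↔ x = y ∨ (x ≠ m ∧ y ≠ m ∧ E.Rel x y) := Iff.rfl

theorem cut_within : Within (cut m E) E := by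
  rintro x y (rfl | ⟨-, -, h⟩)
  exacts [Rel.refl _ _, h]

theorem cut_comm (m n : ℕ) (E : Joins) : cut m (cut n E) = cut n (cut m E) :=
  ext fun x y => by simp only [cut_rel]; tauto

theorem cut_one (m : ℕ) : cut m 1 = 1 := ext fun x y => by simp only [cut_rel, one_rel]; tauto

theorem isolated_one (m : ℕ) : Isolated m 1 := fun _ h => (one_rel.1 h).symm

/-- All points but `m` are joined. -/
def others (m : ℕ) : Joins := cut m (⊤ : Setoid ℕ)

/-- Isolation as containment in a largest relation; the universal property of the product then
handles products at once. -/
theorem isolated_iff_within : Isolated m E ↔ Within E (others m) := by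
  constructor
  · intro h x y hxy
    by_cases hx : x = m
    · subst hx; exact Or.inl (h y hxy).symm
    by_cases hy : y = m
    · subst hy; exact Or.inl (h x hxy.symm)
    exact Or.inr ⟨hx, hy, trivial⟩
  · intro h y hy
    rcases h m y hy with h | h
    exacts [h.symm, (h.1 rfl).elim]

theorem isolated_pair (hp : p ≠ m) (hq : q ≠ m) : Isolated m (pair p q) :=
  isolated_iff_within.2 (pair_within.2 (Or.inr ⟨hp, hq, trivial⟩))

theorem isolated_mul : Isolated m (E * F) ↔ Isolated m E ∧ Isolated m F := by
  simp only [isolated_iff_within, mul_within]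

/-- The only doubtful case is that of a chain through `m`. If `E` joins `m` to some `r ≠ m`, the
retraction `s` sending `m` to `r` replaces each visit to `m` by one to `r`: the pullback along `s`
of the right-hand side contains `pair p q` and `E`, hence their product. -/
theorem cut_pair_mul (hp : p ≠ m) (hq : q ≠ m) (E : Joins) :
    cut m (pair p q * E) = pair p q * cut m E := by
  apply Within.antisymm
  · by_cases hE : Isolated m E
    · have : cut m E = E := ext fun x y => by
        refine ⟨fun h => cut_within _ _ h, fun h => ?_⟩
        by_cases hx : x = m
        · subst hx; exact Or.inl (hE y h).symm
        by_cases hy : y = m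
        · subst hy; exact Or.inl (hE x h.symm)
        exact Or.inr ⟨hx, hy, h⟩
      rw [this]
      exact cut_within
    · obtain ⟨r, hr, hrm⟩ : ∃ r, E.Rel m r ∧ r ≠ m := by
        simpa [Isolated] using hE
      let H := pair p q * cut m E
      let s : ℕ → ℕ := fun x => if x = m then r else x
      let G : Joins := Setoid.comap s H
      have hs : ∀ {x}, x ≠ m → s x = x := fun h => if_neg h
      have hG : Within (pair p q * E) G := by
        rw [mul_within, pair_within]
        constructor
        · change H.Rel (s p) (s q)
          rw [hs hp, hs hq]
          exact within_mul_left _ _ pair_rel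
        · intro x y hxy
          have key : ∀ x, E.Rel x (s x) ∧ s x ≠ m := fun x => by
            by_cases hx : x = m
            · simp only [s, if_pos hx]
              rw [hx]; exact ⟨hr, hrm⟩
            · rw [hs hx]; exact ⟨Rel.refl _ _, hx⟩
          exact within_mul_right _ _ (Or.inr ⟨(key x).2, (key y).2,
            ((key x).1.symm.trans hxy).trans (key y).1⟩)
      rintro x y (rfl | ⟨hx, hy, h⟩)
      · exact Rel.refl _ _
      · have : H.Rel (s x) (s y) := hG x y h
        rwa [hs hx, hs hy] at this
  · rw [mul_within, pair_within]
    refine ⟨Or.inr ⟨hp, hq, within_mul_left _ _ pair_rel⟩, ?_⟩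
    rintro x y (rfl | ⟨hx, hy, h⟩)
    · exact Rel.refl _ _
    · exact Or.inr ⟨hx, hy, within_mul_right _ _ h⟩

theorem cut_pair (m p : ℕ) : cut m (pair m p) = 1 := by
  refine ext fun x y => ?_
  rw [cut_rel, one_rel]
  refine ⟨?_, Or.inl⟩
  rintro (h | ⟨hx, hy, h⟩)
  · exact h
  -- The retraction of `m` to `p` is constant on the classes of `pair m p` and injective away from
  -- `m`.
  · have : Within (pair m p) (Setoid.ker fun x => if x = m then p else x) :=
      pair_within.2 (show (if m = m then p else m) = (if p = m then p else p) by simp)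
    have : (if x = m then p else x) = (if y = m then p else y) := this x y h
    rwa [if_neg hx, if_neg hy] at this

theorem not_isolated_pair (h : p ≠ m) : ¬ Isolated m (pair m p) := fun hi => h (hi p pair_rel)

end Joins

/-- Formal linear combinations of ways of joining points. -/
abbrev StateRing (R : Type*) [CommRing R] := MonoidAlgebra R Joins

/-! ### The monoid algebra of joins and the removal of points. -/

namespace StateRing

variable {R : Type*} [CommRing R]

/-- The element that joins two points. -/
noncomputable def edge (p q : ℕ) : StateRing R := MonoidAlgebra.single (Joins.pair p q) 1

theorem edge_self (p : ℕ) : edge p p = (1 : StateRing R) := by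
  rw [edge, Joins.pair_self, MonoidAlgebra.one_def]

theorem edge_comm (p q : ℕ) : edge p q = (edge q p : StateRing R) := by
  rw [edge, Joins.pair_comm, edge]

theorem edge_mul_edge (m p q : ℕ) :
    edge m p * edge m q = (edge m p * edge p q : StateRing R) := by
  rw [edge, edge, edge, MonoidAlgebra.single_mul_single, MonoidAlgebra.single_mul_single]
  exact congrArg (fun E => MonoidAlgebra.single E _) (Joins.pair_mul_pair m p q)

open Classical in
/-- Removal of the point `m`; a component that consists of this point only counts as a factor
`δ`. -/
noncomputable def integral (δ : R) (m : ℕ) : StateRing R →ₗ[R] StateRing R :=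
  (Finsupp.lsum R fun E : Joins => (LinearMap.toSpanSingleton R (StateRing R)
    (MonoidAlgebra.single (E.cut m) (if E.Isolated m then δ else 1)))) ∘ₗ
      (MonoidAlgebra.coeffLinearEquiv R : StateRing R ≃ₗ[R] (Joins →₀ R)).toLinearMap

variable {δ : R} {m n p q : ℕ}

open Classical in
theorem integral_single (E : Joins) (r : R) :
    integral δ m (MonoidAlgebra.single E r) =
      MonoidAlgebra.single (E.cut m) (r * if E.Isolated m then δ else 1) := by
  simp [integral, MonoidAlgebra.coeffLinearEquiv]

/-- Only the factors `δ` need care. If `m` and `n` are joined, the point removed first is not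
isolated, and the other one is isolated afterwards exactly if the class was `{m, n}`, in either
order. If they are not joined, removing one does not affect the isolation of the other. -/
theorem integral_comm (m n : ℕ) (x : StateRing R) :
    integral δ m (integral δ n x) = integral δ n (integral δ m x) := by
  classical
  by_cases hmn : m = n
  · rw [hmn]
  induction x using MonoidAlgebra.induction_linear with
  | zero => simp
  | add f g hf hg => simp [hf, hg]
  | single E r =>
    have key : ∀ {m n : ℕ}, m ≠ n → ((E.cut n).Isolated m ↔
        ∀ y, E.Rel m y → y = m ∨ y = n) := fun {m n} h => by
      simp only [Joins.Isolated, Joins.cut_rel]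
      refine forall_congr' fun y => ?_
      constructor
      · intro h1 h2
        by_cases hy : y = n
        · exact Or.inr hy
        · exact Or.inl (h1 (Or.inr ⟨h, hy, h2⟩))
      · rintro h1 (h2 | ⟨-, h2, h3⟩)
        · exact h2.symm
        · exact (h1 h3).resolve_right h2
    simp only [integral_single, Joins.cut_comm m n, mul_assoc]
    congr 2
    by_cases hE : E.Rel m n
    · have h1 : ¬ E.Isolated m := fun h => hmn (h n hE).symm
      have h2 : ¬ E.Isolated n := fun h => hmn (h m hE.symm)
      have h3 : (E.cut n).Isolated m ↔ (E.cut m).Isolated n := by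
        rw [key hmn, key (Ne.symm hmn)]
        exact ⟨fun h y hy => (h y (hE.trans hy)).symm,
          fun h y hy => (h y (hE.symm.trans hy)).symm⟩
      simp only [if_neg h1, if_neg h2, h3, one_mul]
    · have h3 : ∀ {m n : ℕ}, m ≠ n → ¬ E.Rel m n →
          ((E.cut n).Isolated m ↔ E.Isolated m) := fun {m n} h hE => by
        rw [key h]
        exact forall_congr' fun y => imp_congr_right fun hy =>
          or_iff_left fun h' => hE (h' ▸ hy)
      rw [if_congr (h3 hmn hE) rfl rfl, if_congr (h3 (Ne.symm hmn) fun h => hE h.symm) rfl rfl,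
        mul_comm]

theorem integral_one : integral δ m 1 = MonoidAlgebra.single 1 δ := by
  rw [MonoidAlgebra.one_def, integral_single, Joins.cut_one, if_pos (Joins.isolated_one m), one_mul]

theorem integral_edge (h : p ≠ m) : integral δ m (edge m p) = 1 := by
  rw [edge, integral_single, Joins.cut_pair, if_neg (Joins.not_isolated_pair h), one_mul,
    MonoidAlgebra.one_def]

/-- The element does not involve the point `m`: it is a scalar for the removal of `m`. -/
def Free (δ : R) (m : ℕ) (g : StateRing R) : Prop :=
  ∀ x, integral δ m (g * x) = g * integral δ m x

/-- An edge away from `m` neither changes whether `m` is isolated nor interferes with cutting it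
off, by `isolated_mul` and `cut_pair_mul`. -/
theorem Free.edge (hp : p ≠ m) (hq : q ≠ m) : Free δ m (edge p q) := by
  classical
  intro x
  induction x using MonoidAlgebra.induction_linear with
  | zero => simp
  | add f g hf hg => simp [hf, hg, mul_add]
  | single E r =>
    have h : (Joins.pair p q * E).Isolated m ↔ E.Isolated m := by
      rw [Joins.isolated_mul, and_iff_right (Joins.isolated_pair hp hq)]
    simp only [StateRing.edge, MonoidAlgebra.single_mul_single, integral_single,
      Joins.cut_pair_mul hp hq, one_mul]
    rw [if_congr h rfl rfl]

theorem Free.mul {g h : StateRing R} (hg : Free δ m g) (hh : Free δ m h) : Free δ m (g * h) :=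
  fun x => by rw [mul_assoc, hg, hh, mul_assoc]

theorem Free.add {g h : StateRing R} (hg : Free δ m g) (hh : Free δ m h) : Free δ m (g + h) :=
  fun x => by rw [add_mul, map_add, hg, hh, add_mul]

theorem Free.scalar (r : R) : Free δ m (algebraMap R (StateRing R) r) := fun x => by
  rw [← Algebra.smul_def, ← Algebra.smul_def, map_smul]

theorem Free.one : Free δ m 1 := fun x => by rw [one_mul, one_mul]

theorem Free.list_prod {l : List (StateRing R)} (h : ∀ g ∈ l, Free δ m g) : Free δ m l.prod := by
  induction l with
  | nil => exact Free.one
  | cons a l ih =>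
    rw [List.prod_cons]
    exact (h a (by simp)).mul (ih fun g hg => h g (by simp [hg]))

theorem Free.integral_eq {g : StateRing R} (h : Free δ m g) :
    StateRing.integral δ m g = algebraMap R _ δ * g := by
  have := h 1
  rw [mul_one, integral_one] at this
  rw [this, mul_comm]; rfl

/-- A point hanging on a single edge disappears without a trace. Together with the substitution
rules this is how inner points are eliminated. -/
theorem Free.integral_edge_mul {g : StateRing R} (h : Free δ m g) (hp : p ≠ m) :
    StateRing.integral δ m (StateRing.edge m p * g) = g := by
  rw [mul_comm, h, integral_edge hp, mul_one]

/-- Repeated removal of points. -/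
noncomputable def integrals (δ : R) (l : List ℕ) (x : StateRing R) : StateRing R :=
  l.foldr (fun m y => integral δ m y) x

@[simp] theorem integrals_nil (x : StateRing R) : integrals δ [] x = x := rfl

@[simp] theorem integrals_cons (m : ℕ) (l : List ℕ) (x : StateRing R) :
    integrals δ (m :: l) x = integral δ m (integrals δ l x) := rfl

theorem integrals_append (l l' : List ℕ) (x : StateRing R) :
    integrals δ (l ++ l') x = integrals δ l (integrals δ l' x) := List.foldr_append

theorem integrals_perm {l l' : List ℕ} (h : l.Perm l') (x : StateRing R) :
    integrals δ l x = integrals δ l' x := by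
  induction h generalizing x with
  | nil => rfl
  | cons m _ ih => rw [integrals_cons, ih, integrals_cons]
  | swap m n l => simp only [integrals_cons, integral_comm m n]
  | trans _ _ ih ih' => rw [ih, ih']

theorem integrals_mul {l : List ℕ} {g : StateRing R} (h : ∀ m ∈ l, Free δ m g) (x : StateRing R) :
    integrals δ l (g * x) = g * integrals δ l x := by
  induction l with
  | nil => rfl
  | cons m l ih =>
    rw [integrals_cons, ih fun k hk => h k (by simp [hk]), h m (by simp), integrals_cons]

end StateRing

/-! ### Two strands at a crossing -/

namespace StateRing

variable {R : Type*} [CommRing R] {δ : R} {m n p q a b c d : ℕ}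

/-- A formal combination of the three ways of joining the ends of two strands, the first one from
`a` to `b` and the second one from `c` to `d`. -/
noncomputable def joint (kA kB kV : R) (a b c d : ℕ) : StateRing R :=
  algebraMap R _ kA * (edge a d * edge b c) + algebraMap R _ kB * (edge a c * edge b d)
    + algebraMap R _ kV * (edge a b * edge c d)

section joint

variable (kA kB kV : R)

theorem Free.joint (ha : a ≠ m) (hb : b ≠ m) (hc : c ≠ m) (hd : d ≠ m) :
    Free δ m (joint kA kB kV a b c d) :=
  (((Free.scalar _).mul ((Free.edge ha hd).mul (Free.edge hb hc))).add
    ((Free.scalar _).mul ((Free.edge ha hc).mul (Free.edge hb hd)))).add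
    ((Free.scalar _).mul ((Free.edge ha hb).mul (Free.edge hc hd)))

variable (a b c d)

/-- This and the next four identities hold because reversing, swapping or re-pairing the strands
only permutes the three pairings of the same four ends. They reduce computations at any end to one
position. -/
theorem joint_flip : joint kA kB kV a b c d = joint kA kB kV b a d c := by
  simp only [joint, edge_comm b a, edge_comm d c]; ring

theorem joint_swap : joint kA kB kV a b c d = joint kA kB kV c d a b := by
  simp only [joint, edge_comm d a, edge_comm c b, edge_comm c a, edge_comm d b]; ring

theorem joint_rev_left : joint kA kB kV a b c d = joint kB kA kV b a c d := by
  simp only [joint, edge_comm b a]; ring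

theorem joint_rev_right : joint kA kB kV a b c d = joint kB kA kV a b d c := by
  simp only [joint, edge_comm d c]; ring

theorem joint_exchange : joint kA kB kV a b c d = joint kA kV kB a c b d := by
  simp only [joint, edge_comm c b]; ring

theorem edge_mul_joint₁ (m p : ℕ) :
    edge m p * joint kA kB kV m b c d = edge m p * joint kA kB kV p b c d := by
  simp only [joint]
  linear_combination algebraMap R _ kA * edge b c * edge_mul_edge (R := R) m p d
    + algebraMap R _ kB * edge b d * edge_mul_edge (R := R) m p c
    + algebraMap R _ kV * edge c d * edge_mul_edge (R := R) m p b

theorem edge_mul_joint₂ (m p : ℕ) :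
    edge m p * joint kA kB kV a m c d = edge m p * joint kA kB kV a p c d := by
  rw [joint_flip, edge_mul_joint₁, joint_flip]

theorem edge_mul_joint₃ (m p : ℕ) :
    edge m p * joint kA kB kV a b m d = edge m p * joint kA kB kV a b p d := by
  rw [joint_swap, edge_mul_joint₁, joint_swap]

theorem edge_mul_joint₄ (m p : ℕ) :
    edge m p * joint kA kB kV a b c m = edge m p * joint kA kB kV a b c p := by
  rw [joint_swap, edge_mul_joint₂, joint_swap]

end joint

theorem integral_scalar_mul (r : R) (x : StateRing R) :
    integral δ m (algebraMap R _ r * x) = algebraMap R _ r * integral δ m x := Free.scalar r x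

/-- The closure of a crossing at two ends. -/
theorem integral_joint_loop (kA kB kV : R) (hb : b ≠ m) (hc : c ≠ m) :
    integral δ m (joint kA kB kV m b c m) = algebraMap R _ (δ * kA + kB + kV) * edge b c := by
  have h1 : integral δ m (edge b c) = algebraMap R _ δ * edge b c :=
    (Free.edge hb hc).integral_eq
  have h2 : integral δ m (edge m c * edge m b) = edge b c := by
    rw [edge_mul_edge, (Free.edge hc hb).integral_edge_mul hc, edge_comm]
  simp only [joint, map_add, integral_scalar_mul, edge_self, one_mul, h1, edge_comm b m,
    edge_comm c m, h2, mul_comm (edge m b), map_mul]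
  ring

/-- Only the first crossing is expanded. Each of its terms has one edge from `t` to `q`, `p` or `s`,
and this end takes the place of `t` in the second crossing. -/
theorem integral_joint_mul_joint (kA kB kV lA lB lV : R) {s t u v w : ℕ} (hp : p ≠ t) (hq : q ≠ t)
    (hs : s ≠ t) (hu : u ≠ t) (hv : v ≠ t) (hw : w ≠ t) :
    integral δ t (joint kA kB kV p q t s * joint lA lB lV u v w t) =
      algebraMap R _ kA * (edge p s * joint lA lB lV u v w q)
        + algebraMap R _ kB * (edge q s * joint lA lB lV u v w p)
        + algebraMap R _ kV * (edge p q * joint lA lB lV u v w s) := by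
  have key : ∀ {x y z : ℕ}, x ≠ t → y ≠ t → z ≠ t →
      integral δ t (edge y z * (edge t x * joint lA lB lV u v w t)) =
        edge y z * joint lA lB lV u v w x := fun {x y z} hx hy hz => by
    rw [Free.edge hy hz, edge_mul_joint₄, (Free.joint _ _ _ hu hv hw hx).integral_edge_mul hx]
  rw [← key hq hp hs, ← key hp hq hs, ← key hs hp hq]
  simp only [← integral_scalar_mul, ← map_add]
  congr 1
  simp only [joint, edge_comm q t, edge_comm p t]
  ring

/-- Two crossings with two common ends. -/
theorem integral_joint_bigon (kA kB kV lA lB lV : R) {c' d' : ℕ} (hmn : m ≠ n) (hcm : c ≠ m)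
    (hdm : d ≠ m) (hcm' : c' ≠ m) (hdm' : d' ≠ m) (hcn : c ≠ n) (hdn : d ≠ n) (hcn' : c' ≠ n)
    (hdn' : d' ≠ n) :
    integral δ m (integral δ n (joint kA kB kV m n c d * joint lA lB lV m n c' d')) =
      algebraMap R _ (kA * lA + kB * lB) * (edge c c' * edge d d')
        + algebraMap R _ (kA * lB + kB * lA) * (edge c d' * edge d c')
        + algebraMap R _ (kA * lV + kB * lV + kV * lA + kV * lB + δ * kV * lV)
          * (edge c d * edge c' d') := by
  -- Terms of the first crossing in which `m` and `n` lead to outer ends: the second crossing is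
  -- transplanted to these ends.
  have key : ∀ {x y : ℕ}, x ≠ m → y ≠ m → x ≠ n → y ≠ n →
      integral δ m (integral δ n (edge m x * edge n y * joint lA lB lV m n c' d')) =
        joint lA lB lV x y c' d' := fun {x y} hx hy hx' hy' => by
    have h : edge m x * edge n y * joint lA lB lV m n c' d'
        = edge n y * (edge m x * joint lA lB lV x y c' d') := by
      rw [mul_assoc, edge_mul_joint₂, mul_left_comm, edge_mul_joint₁]
    rw [h, ((Free.edge hmn hx').mul (Free.joint _ _ _ hx' hy' hcn' hdn')).integral_edge_mul hy',
      (Free.joint _ _ _ hx hy hcm' hdm').integral_edge_mul hx]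
  -- The term that joins `m` to `n` closes up two ends of the second crossing; the pairing of these
  -- two ends with each other produces the closed curve and its `δ`.
  have key' : integral δ m (integral δ n (edge m n * joint lA lB lV m n c' d')) =
      algebraMap R _ (lA + lB + δ * lV) * edge c' d' := by
    rw [edge_comm, edge_mul_joint₂,
      (Free.joint _ _ _ hmn hmn hcn' hdn').integral_edge_mul hmn, joint_exchange, joint_rev_right,
      integral_joint_loop _ _ _ hcm' hdm']
    ring_nf
  have h : joint kA kB kV m n c d * joint lA lB lV m n c' d' =
      algebraMap R _ kA * (edge m d * edge n c * joint lA lB lV m n c' d')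
        + algebraMap R _ kB * (edge m c * edge n d * joint lA lB lV m n c' d')
        + algebraMap R _ kV * (edge c d * (edge m n * joint lA lB lV m n c' d')) := by
    rw [joint]; ring
  rw [h]
  simp only [map_add, integral_scalar_mul, key hcm hdm hcn hdn, key hdm hcm hdn hcn,
    Free.edge hcn hdn _, Free.edge hcm hdm _, key']
  simp only [joint, edge_comm d c, map_mul]
  ring

end StateRing

/-! ### Three strands -/

namespace StateRing

variable {R : Type*} [CommRing R] {δ : R}

/-- The joint of three strands that cross in a triangle, the first strand running from `b₀` to `b₂`,
the second one from `m₀` to `m₂` and the third one from `t₀` to `t₂`. -/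
noncomputable def triangle (δ k₁A k₁B k₁V k₂A k₂B k₂V k₃A k₃B k₃V : R) (b₀ b₂ m₀ m₂ t₀ t₂ : ℕ) :
    StateRing R :=
  let K := algebraMap R (StateRing R)
  let J := joint k₃A k₃B k₃V
  K k₁A * (K k₂A * (edge b₀ t₂ * J m₀ b₂ t₀ m₂) + K k₂B * (edge m₂ t₂ * J m₀ b₂ t₀ b₀)
      + K k₂V * (edge b₀ m₂ * J m₀ b₂ t₀ t₂))
    + K k₁V * (K k₂A * (edge m₀ t₂ * J b₀ b₂ t₀ m₂) + K k₂B * (edge m₂ t₂ * J b₀ b₂ t₀ m₀)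
      + K k₂V * (edge m₀ m₂ * J b₀ b₂ t₀ t₂))
    + K k₁B * (edge b₀ m₀ * (K k₂A * J t₂ b₂ t₀ m₂
      + K k₂B * (edge m₂ t₂ * (K (δ * k₃A + k₃B + k₃V) * edge b₂ t₀)) + K k₂V * J m₂ b₂ t₀ t₂))

/-- The crossing between `b₁` and `m₁` is expanded. Terms leading `b₁` and `m₁` to outer ends leave
two crossings that share only `t₁`. The term joining `b₁` to `m₁` leaves a bigon, in which one
smoothing closes up the last crossing, whence the coefficient `δ * k₃A + k₃B + k₃V`. -/
theorem integral_joint_triangle (k₁A k₁B k₁V k₂A k₂B k₂V k₃A k₃B k₃V : R)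
    {b₀ b₁ b₂ m₀ m₁ m₂ t₀ t₁ t₂ : ℕ} (hbm : b₁ ≠ m₁) (hbt : b₁ ≠ t₁) (hmt : m₁ ≠ t₁)
    (hb : b₀ ≠ b₁ ∧ b₂ ≠ b₁ ∧ m₀ ≠ b₁ ∧ m₂ ≠ b₁ ∧ t₀ ≠ b₁ ∧ t₂ ≠ b₁)
    (hm : b₀ ≠ m₁ ∧ b₂ ≠ m₁ ∧ m₀ ≠ m₁ ∧ m₂ ≠ m₁ ∧ t₀ ≠ m₁ ∧ t₂ ≠ m₁)
    (ht : b₀ ≠ t₁ ∧ b₂ ≠ t₁ ∧ m₀ ≠ t₁ ∧ m₂ ≠ t₁ ∧ t₀ ≠ t₁ ∧ t₂ ≠ t₁) :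
    integral δ b₁ (integral δ m₁ (integral δ t₁
      (joint k₁A k₁B k₁V b₀ b₁ m₀ m₁ * (joint k₂A k₂B k₂V m₁ m₂ t₁ t₂ *
        joint k₃A k₃B k₃V b₁ b₂ t₀ t₁)))) =
      triangle δ k₁A k₁B k₁V k₂A k₂B k₂V k₃A k₃B k₃V b₀ b₂ m₀ m₂ t₀ t₂ := by
  obtain ⟨hb1, hb2, hb3, hb4, hb5, hb6⟩ := hb
  obtain ⟨hm1, hm2, hm3, hm4, hm5, hm6⟩ := hm
  obtain ⟨ht1, ht2, ht3, ht4, ht5, ht6⟩ := ht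
  have F : ∀ {b m : ℕ}, b ≠ t₁ → m ≠ t₁ →
      integral δ t₁ (joint k₂A k₂B k₂V m m₂ t₁ t₂ * joint k₃A k₃B k₃V b b₂ t₀ t₁) = _ :=
    fun {b m} hb hm => integral_joint_mul_joint (δ := δ) (p := m) (q := m₂) (s := t₂) (t := t₁)
      (u := b) (v := b₂) (w := t₀) k₂A k₂B k₂V k₃A k₃B k₃V hm ht4 ht6 hb ht2 ht5
  have key : ∀ {x y : ℕ}, x ≠ b₁ → y ≠ m₁ → x ≠ m₁ → y ≠ b₁ → x ≠ t₁ → y ≠ t₁ →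
      integral δ b₁ (integral δ m₁ (integral δ t₁ (edge b₁ x * edge m₁ y *
        (joint k₂A k₂B k₂V m₁ m₂ t₁ t₂ * joint k₃A k₃B k₃V b₁ b₂ t₀ t₁)))) =
      integral δ t₁ (joint k₂A k₂B k₂V y m₂ t₁ t₂ * joint k₃A k₃B k₃V x b₂ t₀ t₁) :=
    fun {x y} h1 h2 h3 h4 h5 h6 => by
      have h : edge b₁ x * edge m₁ y *
          (joint k₂A k₂B k₂V m₁ m₂ t₁ t₂ * joint k₃A k₃B k₃V b₁ b₂ t₀ t₁) =
          edge b₁ x * (edge m₁ y *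
          (joint k₂A k₂B k₂V y m₂ t₁ t₂ * joint k₃A k₃B k₃V x b₂ t₀ t₁)) := by
        linear_combination (edge b₁ x * joint k₃A k₃B k₃V b₁ b₂ t₀ t₁) *
          edge_mul_joint₁ m₂ t₁ t₂ k₂A k₂B k₂V m₁ y + (edge m₁ y *
          joint k₂A k₂B k₂V y m₂ t₁ t₂) * edge_mul_joint₁ b₂ t₀ t₁ k₃A k₃B k₃V b₁ x
      rw [h, Free.edge hbt h5, Free.edge hmt h6, Free.edge hbm h3, F h5 h6]
      have hfree : ∀ {v : ℕ}, v ≠ b₁ → v ≠ m₁ → ∀ {w s r : ℕ}, w ≠ b₁ → w ≠ m₁ → s ≠ b₁ →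
          s ≠ m₁ → r ≠ b₁ → r ≠ m₁ → ∀ k : R, ∀ c ∈ [b₁, m₁],
          Free δ c (algebraMap R _ k * (edge w s * joint k₃A k₃B k₃V x b₂ t₀ v)) := by
        intro v hv hv' w s r hw hw' hs hs' hr hr' k c hc
        simp only [List.mem_cons, List.not_mem_nil, or_false] at hc
        rcases hc with rfl | rfl
        · exact (Free.scalar _).mul ((Free.edge hw hs).mul (Free.joint _ _ _ h1 hb2 hb5 hv))
        · exact (Free.scalar _).mul ((Free.edge hw' hs').mul (Free.joint _ _ _ h3 hm2 hm5 hv'))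
      have hF : ∀ c ∈ [b₁, m₁], Free δ c _ := fun c hc =>
        ((hfree hb4 hm4 h4 h2 hb6 hm6 hb6 hm6 k₂A c hc).add
          (hfree h4 h2 hb4 hm4 hb6 hm6 hb6 hm6 k₂B c hc)).add
          (hfree hb6 hm6 h4 h2 hb4 hm4 hb6 hm6 k₂V c hc)
      rw [(hF m₁ (by simp)).integral_edge_mul h2, (hF b₁ (by simp)).integral_edge_mul h1]
  have key' : integral δ b₁ (integral δ m₁ (integral δ t₁ (edge m₁ b₁ *
        (joint k₂A k₂B k₂V m₁ m₂ t₁ t₂ * joint k₃A k₃B k₃V b₁ b₂ t₀ t₁)))) =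
      algebraMap R _ k₂A * joint k₃A k₃B k₃V t₂ b₂ t₀ m₂
      + algebraMap R _ k₂B * (edge m₂ t₂ * (algebraMap R _ (δ * k₃A + k₃B + k₃V) * edge b₂ t₀))
      + algebraMap R _ k₂V * joint k₃A k₃B k₃V m₂ b₂ t₀ t₂ := by
    rw [← mul_assoc, edge_mul_joint₁, mul_assoc, Free.edge hmt hbt, F hbt hbt]
    have hfree : ∀ {v w s : ℕ}, v ≠ m₁ → w ≠ m₁ → s ≠ m₁ → ∀ k : R,
        Free δ m₁ (algebraMap R _ k * (edge w s * joint k₃A k₃B k₃V b₁ b₂ t₀ v)) :=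
      fun hv hw hs k =>
        (Free.scalar _).mul ((Free.edge hw hs).mul (Free.joint _ _ _ hbm hm2 hm5 hv))
    rw [(((hfree hm4 hbm hm6 k₂A).add (hfree hbm hm4 hm6 k₂B)).add
      (hfree hm6 hbm hm4 k₂V)).integral_edge_mul hbm, edge_mul_joint₁, edge_mul_joint₁]
    simp only [map_add, integral_scalar_mul]
    rw [(Free.joint _ _ _ hb6 hb2 hb5 hb4).integral_edge_mul hb6,
      (Free.joint _ _ _ hb4 hb2 hb5 hb6).integral_edge_mul hb4, Free.edge hb4 hb6,
      integral_joint_loop _ _ _ hb2 hb5]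
    simp only [map_add]
  have h : joint k₁A k₁B k₁V b₀ b₁ m₀ m₁ * (joint k₂A k₂B k₂V m₁ m₂ t₁ t₂ *
        joint k₃A k₃B k₃V b₁ b₂ t₀ t₁) =
      algebraMap R _ k₁A * (edge b₁ m₀ * edge m₁ b₀ * (joint k₂A k₂B k₂V m₁ m₂ t₁ t₂ *
        joint k₃A k₃B k₃V b₁ b₂ t₀ t₁))
      + algebraMap R _ k₁V * (edge b₁ b₀ * edge m₁ m₀ * (joint k₂A k₂B k₂V m₁ m₂ t₁ t₂ *
        joint k₃A k₃B k₃V b₁ b₂ t₀ t₁))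
      + algebraMap R _ k₁B * (edge b₀ m₀ * (edge m₁ b₁ * (joint k₂A k₂B k₂V m₁ m₂ t₁ t₂ *
        joint k₃A k₃B k₃V b₁ b₂ t₀ t₁))) := by
    conv_lhs => rw [joint]
    rw [edge_comm b₀ m₁, edge_comm b₀ b₁, edge_comm m₀ m₁, edge_comm b₁ m₁]
    ring
  rw [h]
  simp only [map_add, integral_scalar_mul, Free.edge ht1 ht3 _, Free.edge hm1 hm3 _,
    Free.edge hb1 hb3 _]
  rw [key', key hb3 hm1 hm3 hb1 ht3 ht1, key hb1 hm3 hm1 hb3 ht1 ht3, F ht3 ht1, F ht1 ht3]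
  rfl

/-- Two triangles with opposite orders of the crossings agree if the fifteen coefficients do. -/
theorem triangle_eq_triangle {k₁A k₁B k₁V k₂A k₂B k₂V k₃A k₃B k₃V l₁A l₁B l₁V l₂A l₂B l₂V l₃A l₃B l₃V : R} (b₀ b₂ m₀ m₂ t₀ t₂ : ℕ)
    (h01 : k₁A * k₂A * k₃A + k₁V * k₂V * k₃A = l₁A * l₂A * l₃A + l₁V * l₂V * l₃A)
    (h02 : k₁A * k₂B * k₃A + k₁V * k₂B * k₃A + k₁B * k₂A * k₃A + k₁B * k₂V * k₃A + δ * k₁B *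
      k₂B * k₃A + k₁B * k₂B * k₃B + k₁B * k₂B * k₃V = l₁A * l₂A * l₃B)
    (h03 : k₁A * k₂A * k₃B = l₁A * l₂B * l₃A + l₁V * l₂B * l₃A + l₁B * l₂A * l₃A + l₁B * l₂V *
      l₃A + δ * l₁B * l₂B * l₃A + l₁B * l₂B * l₃B + l₁B * l₂B * l₃V)
    (h04 : k₁A * k₂A * k₃V = l₁A * l₂V * l₃A + l₁V * l₂A * l₃A)
    (h05 : k₁A * k₂V * k₃A + k₁V * k₂A * k₃A = l₁A * l₂A * l₃V)
    (h06 : k₁B * k₂A * k₃B + k₁B * k₂V * k₃V = l₁B * l₂A * l₃B + l₁B * l₂V * l₃V)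
    (h07 : k₁A * k₂B * k₃B + k₁V * k₂B * k₃V = l₁A * l₂B * l₃B + l₁V * l₂B * l₃V)
    (h08 : k₁B * k₂A * k₃V + k₁B * k₂V * k₃B = l₁V * l₂A * l₃B)
    (h09 : k₁A * k₂V * k₃B = l₁A * l₂B * l₃V + l₁V * l₂B * l₃B)
    (h10 : k₁V * k₂A * k₃B = l₁B * l₂A * l₃V + l₁B * l₂V * l₃B)
    (h11 : k₁A * k₂B * k₃V + k₁V * k₂B * k₃B = l₁A * l₂V * l₃B)
    (h12 : k₁V * k₂A * k₃V = l₁V * l₂A * l₃V)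
    (h13 : k₁A * k₂V * k₃V = l₁A * l₂V * l₃V)
    (h14 : k₁V * k₂V * k₃B = l₁V * l₂V * l₃B)
    (h15 : k₁V * k₂V * k₃V = l₁V * l₂V * l₃V) :
    triangle δ k₁A k₁B k₁V k₂A k₂B k₂V k₃A k₃B k₃V b₀ b₂ m₀ m₂ t₀ t₂ =
      triangle δ l₁A l₁B l₁V l₂A l₂B l₂V l₃A l₃B l₃V b₂ b₀ m₂ m₀ t₂ t₀ := by
  -- The identities are moved to the state ring, where each one can be multiplied by the perfect
  -- matching of the six ends whose coefficient it describes.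
  replace h01 := congrArg (algebraMap R (StateRing R)) h01
  replace h02 := congrArg (algebraMap R (StateRing R)) h02
  replace h03 := congrArg (algebraMap R (StateRing R)) h03
  replace h04 := congrArg (algebraMap R (StateRing R)) h04
  replace h05 := congrArg (algebraMap R (StateRing R)) h05
  replace h06 := congrArg (algebraMap R (StateRing R)) h06
  replace h07 := congrArg (algebraMap R (StateRing R)) h07
  replace h08 := congrArg (algebraMap R (StateRing R)) h08
  replace h09 := congrArg (algebraMap R (StateRing R)) h09
  replace h10 := congrArg (algebraMap R (StateRing R)) h10
  replace h11 := congrArg (algebraMap R (StateRing R)) h11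
  replace h12 := congrArg (algebraMap R (StateRing R)) h12
  replace h13 := congrArg (algebraMap R (StateRing R)) h13
  replace h14 := congrArg (algebraMap R (StateRing R)) h14
  replace h15 := congrArg (algebraMap R (StateRing R)) h15
  simp only [map_add, map_mul] at h01 h02 h03 h04 h05 h06 h07 h08 h09 h10 h11 h12 h13 h14 h15
  simp only [triangle, joint, map_add, map_mul]
  -- Every edge between two of the six ends gets a fixed order of its ends, so that the rest is a
  -- polynomial identity in the edges.
  simp only [edge_comm b₂ b₀, edge_comm m₀ b₀, edge_comm m₂ b₀, edge_comm t₀ b₀,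
    edge_comm m₀ b₂, edge_comm m₂ b₂, edge_comm t₂ b₂, edge_comm m₂ m₀,
    edge_comm t₀ m₀, edge_comm t₂ m₀, edge_comm t₀ m₂, edge_comm t₂ m₂, edge_comm t₂ t₀]
  linear_combination
    (edge b₀ t₂ * edge b₂ t₀ * edge m₀ m₂) * h01
    + (edge b₀ m₀ * edge b₂ t₀ * edge m₂ t₂) * h02
    + (edge b₀ t₂ * edge b₂ m₂ * edge m₀ t₀) * h03
    + (edge b₀ t₂ * edge b₂ m₀ * edge m₂ t₀) * h04
    + (edge b₀ m₂ * edge b₂ t₀ * edge m₀ t₂) * h05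
    + (edge b₀ m₀ * edge b₂ m₂ * edge t₀ t₂) * h06
    + (edge b₀ b₂ * edge m₀ t₀ * edge m₂ t₂) * h07
    + (edge b₀ m₀ * edge b₂ t₂ * edge m₂ t₀) * h08
    + (edge b₀ m₂ * edge b₂ t₂ * edge m₀ t₀) * h09
    + (edge b₀ t₀ * edge b₂ m₂ * edge m₀ t₂) * h10
    + (edge b₀ t₀ * edge b₂ m₀ * edge m₂ t₂) * h11
    + (edge b₀ b₂ * edge m₀ t₂ * edge m₂ t₀) * h12
    + (edge b₀ m₂ * edge b₂ m₀ * edge t₀ t₂) * h13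
    + (edge b₀ t₀ * edge b₂ t₂ * edge m₀ m₂) * h14
    + (edge b₀ b₂ * edge m₀ m₂ * edge t₀ t₂) * h15

end StateRing

/-! ### Colored crossings -/

/-- The behavior of a crossing of two colored strands: the admissible colors of the four ends, and
the weights of the three ways of joining them. The ends are listed in the order start and end of the
first strand, start and end of the second strand. -/
structure CrossingType (X R : Type*) where
  ok : X → X → X → X → Prop
  /-- the weight of joining the start of each strand to the end of the other one -/
  vert : X → X → X → X → R
  /-- the weight of joining the two starts and the two ends -/
  horiz : X → X → X → X → R
  straight : X → X → X → X → R

namespace CrossingType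

open StateRing

variable {X R : Type*}

/-- Reversal of the first strand. -/
def revFst (U : CrossingType X R) : CrossingType X R where
  ok a b c d := U.ok b a c d
  vert a b c d := U.horiz b a c d
  horiz a b c d := U.vert b a c d
  straight a b c d := U.straight b a c d

/-- Reversal of the second strand. -/
def revSnd (U : CrossingType X R) : CrossingType X R where
  ok a b c d := U.ok a b d c
  vert a b c d := U.horiz a b d c
  horiz a b c d := U.vert a b d c
  straight a b c d := U.straight a b d c

/-- Exchange of the two strands. -/
def swap (U : CrossingType X R) : CrossingType X R where
  ok a b c d := U.ok c d a b
  vert a b c d := U.vert c d a b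
  horiz a b c d := U.horiz c d a b
  straight a b c d := U.straight c d a b

/-- The colors of one end of each strand determine the colors of the other ends. -/
structure Regular (U : CrossingType X R) : Prop where
  start_start : ∀ a c, ∃! p : X × X, U.ok a p.1 c p.2
  start_end : ∀ a d, ∃! p : X × X, U.ok a p.1 p.2 d
  end_start : ∀ b c, ∃! p : X × X, U.ok p.1 b c p.2
  end_end : ∀ b d, ∃! p : X × X, U.ok p.1 b p.2 d

theorem Regular.revFst {U : CrossingType X R} (h : U.Regular) : U.revFst.Regular :=
  ⟨h.end_start, h.end_end, h.start_start, h.start_end⟩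

theorem Regular.revSnd {U : CrossingType X R} (h : U.Regular) : U.revSnd.Regular :=
  ⟨h.start_end, h.start_start, h.end_end, h.end_start⟩

theorem Regular.swap {U : CrossingType X R} (h : U.Regular) : U.swap.Regular := by
  have key : ∀ {Q : X → X → Prop}, (∃! p : X × X, Q p.1 p.2) → ∃! p : X × X, Q p.2 p.1 := by
    rintro Q ⟨p, hp, hu⟩
    exact ⟨p.swap, hp, fun q hq => Prod.swap_injective (hu q.swap hq)⟩
  exact ⟨fun a c => key (Q := fun p q => U.ok c p a q) (h.start_start c a),
    fun a d => key (Q := fun p q => U.ok p d a q) (h.end_start d a),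
    fun b c => key (Q := fun p q => U.ok c p q b) (h.start_end c b),
    fun b d => key (Q := fun p q => U.ok p d q b) (h.end_end d b)⟩

variable [CommRing R]

/-- The contribution of a crossing with given ends. -/
noncomputable def vertex (U : CrossingType X R) (a b c d : ℕ × X) : StateRing R :=
  joint (U.vert a.2 b.2 c.2 d.2) (U.horiz a.2 b.2 c.2 d.2) (U.straight a.2 b.2 c.2 d.2)
    a.1 b.1 c.1 d.1

variable (U V W : CrossingType X R)

theorem vertex_revFst (a b c d : ℕ × X) : U.revFst.vertex a b c d = U.vertex b a c d :=
  (joint_rev_left ..).symm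

theorem vertex_revSnd (a b c d : ℕ × X) : U.revSnd.vertex a b c d = U.vertex a b d c :=
  (joint_rev_right ..).symm

theorem vertex_swap (a b c d : ℕ × X) : U.swap.vertex a b c d = U.vertex c d a b :=
  (joint_swap ..).symm

variable {δ : R} {U V W} {m : ℕ}

theorem free_vertex {a b c d : ℕ × X} (ha : a.1 ≠ m) (hb : b.1 ≠ m) (hc : c.1 ≠ m)
    (hd : d.1 ≠ m) : Free δ m (U.vertex a b c d) := Free.joint _ _ _ ha hb hc hd

theorem edge_mul_vertex₁ (m : ℕ) (p b c d : ℕ × X) :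
    edge m p.1 * U.vertex (m, p.2) b c d = edge m p.1 * U.vertex p b c d := edge_mul_joint₁ ..

theorem edge_mul_vertex₂ (m : ℕ) (p a c d : ℕ × X) :
    edge m p.1 * U.vertex a (m, p.2) c d = edge m p.1 * U.vertex a p c d := edge_mul_joint₂ ..

theorem edge_mul_vertex₃ (m : ℕ) (p a b d : ℕ × X) :
    edge m p.1 * U.vertex a b (m, p.2) d = edge m p.1 * U.vertex a b p d := edge_mul_joint₃ ..

theorem edge_mul_vertex₄ (m : ℕ) (p a b c : ℕ × X) :
    edge m p.1 * U.vertex a b c (m, p.2) = edge m p.1 * U.vertex a b c p := edge_mul_joint₄ ..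

/-- Two crossings that share an end of each strand cancel each other. -/
structure Cancels (δ : R) (U V : CrossingType X R) : Prop where
  ok_iff : ∀ a b c d, U.ok a b c d ↔ V.ok a b c d
  vert_add : ∀ a b c d, U.ok a b c d → U.vert a b c d * V.vert a b c d
    + U.straight a b c d * V.straight a b c d = 1
  vert_straight : ∀ a b c d, U.ok a b c d → U.vert a b c d * V.straight a b c d
    + U.straight a b c d * V.vert a b c d = 0
  vert_loop : ∀ a b c d, U.ok a b c d → U.vert a b c d * V.horiz a b c d
    + U.straight a b c d * V.horiz a b c d + U.horiz a b c d * V.vert a b c d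
    + U.horiz a b c d * V.straight a b c d + δ * U.horiz a b c d * V.horiz a b c d = 0
  horiz_add : ∀ a b c d, U.ok a b c d → U.horiz a b c d * V.horiz a b c d
    + U.straight a b c d * V.straight a b c d = 1
  horiz_straight : ∀ a b c d, U.ok a b c d → U.horiz a b c d * V.straight a b c d
    + U.straight a b c d * V.horiz a b c d = 0
  horiz_loop : ∀ a b c d, U.ok a b c d → U.horiz a b c d * V.vert a b c d
    + U.straight a b c d * V.vert a b c d + U.vert a b c d * V.horiz a b c d
    + U.vert a b c d * V.straight a b c d + δ * U.vert a b c d * V.vert a b c d = 0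

namespace Cancels

/-- Reversal of one strand exchanges the vertical and the horizontal smoothing, hence the two halves
of the list of conditions. This symmetry is why both halves are required: one cancelling pair yields
bigons with all directions of the strands. -/
theorem revFst (h : Cancels δ U V) : Cancels δ U.revFst V.revFst where
  ok_iff a b c d := h.ok_iff b a c d
  vert_add a b c d := h.horiz_add b a c d
  vert_straight a b c d := h.horiz_straight b a c d
  vert_loop a b c d := h.horiz_loop b a c d
  horiz_add a b c d := h.vert_add b a c d
  horiz_straight a b c d := h.vert_straight b a c d
  horiz_loop a b c d := h.vert_loop b a c d

theorem revSnd (h : Cancels δ U V) : Cancels δ U.revSnd V.revSnd where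
  ok_iff a b c d := h.ok_iff a b d c
  vert_add a b c d := h.horiz_add a b d c
  vert_straight a b c d := h.horiz_straight a b d c
  vert_loop a b c d := h.horiz_loop a b d c
  horiz_add a b c d := h.vert_add a b d c
  horiz_straight a b c d := h.vert_straight a b d c
  horiz_loop a b c d := h.vert_loop a b d c

theorem swap (h : Cancels δ U V) : Cancels δ U.swap V.swap where
  ok_iff a b c d := h.ok_iff c d a b
  vert_add a b c d := h.vert_add c d a b
  vert_straight a b c d := h.vert_straight c d a b
  vert_loop a b c d := h.vert_loop c d a b
  horiz_add a b c d := h.horiz_add c d a b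
  horiz_straight a b c d := h.horiz_straight c d a b
  horiz_loop a b c d := h.horiz_loop c d a b

/-- Cancellation of two crossings that share the starts of both strands. -/
theorem integral_start_start (h : Cancels δ U V) {m n : ℕ} {x y : X} {b b' d d' : ℕ × X}
    (hmn : m ≠ n) (hm : b.1 ≠ m ∧ b'.1 ≠ m ∧ d.1 ≠ m ∧ d'.1 ≠ m)
    (hn : b.1 ≠ n ∧ b'.1 ≠ n ∧ d.1 ≠ n ∧ d'.1 ≠ n) (hb : b'.2 = b.2) (hd : d'.2 = d.2)
    (hok : U.ok x b.2 y d.2) :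
    integral δ m (integral δ n (U.vertex (m, x) b (n, y) d * V.vertex (m, x) b' (n, y) d')) =
      edge b.1 b'.1 * edge d.1 d'.1 := by
  obtain ⟨h1, h2, h3, h4⟩ := hm
  obtain ⟨h5, h6, h7, h8⟩ := hn
  have e1 := h.vert_add _ _ _ _ hok
  have e2 := h.vert_straight _ _ _ _ hok
  have e3 := h.vert_loop _ _ _ _ hok
  -- The two shared starts are made the two ends of one strand, as in `integral_joint_bigon`; the
  -- horizontal and the straight weight change places.
  simp only [vertex, hb, hd, joint_exchange _ b.1, joint_exchange _ b'.1]
  rw [integral_joint_bigon _ _ _ _ _ _ hmn h1 h3 h2 h4 h5 h7 h6 h8, e1, e2]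
  have e4 : U.vert x b.2 y d.2 * V.horiz x b.2 y d.2 + U.straight x b.2 y d.2 * V.horiz x b.2 y d.2
      + U.horiz x b.2 y d.2 * V.vert x b.2 y d.2 + U.horiz x b.2 y d.2 * V.straight x b.2 y d.2
      + δ * U.horiz x b.2 y d.2 * V.horiz x b.2 y d.2 = 0 := e3
  rw [e4, map_one, map_zero, one_mul, zero_mul, zero_mul, add_zero, add_zero]

end Cancels

/-- The two positions of three strands that cross in a triangle, related by a third Reidemeister
move. The first strand crosses the second and the third one, the second strand crosses the third
and the first one, the third strand crosses the first and the second one, in this order or in the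
opposite order. -/
def SlideEq (δ : R) (U V W : CrossingType X R) (i j k : ℕ) (a a' b b' c c' : ℕ × X)
    (x y z x' y' z' : X) : Prop :=
  integrals δ [i, j, k]
      (U.vertex a (i, x) (j, y) b' * V.vertex b (j, y) (k, z) c' * W.vertex c (k, z) (i, x) a') =
    integrals δ [i, j, k] (U.vertex (i, x') a' b (j, y') * V.vertex (j, y') b' c (k, z') *
      W.vertex (k, z') c' a (i, x'))

/-- Invariance under the third Reidemeister move for three types of crossings. -/
def Slides (δ : R) (U V W : CrossingType X R) : Prop :=
  ∀ (i j k : ℕ) (a a' b b' c c' : ℕ × X), i ≠ j → i ≠ k → j ≠ k →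
    (∀ p ∈ [a, a', b, b', c, c'], p.1 ≠ i ∧ p.1 ≠ j ∧ p.1 ≠ k) →
    (∀ x y z, U.ok a.2 x y b'.2 → V.ok b.2 y z c'.2 → W.ok c.2 z x a'.2 →
      ∃ x' y' z', U.ok x' a'.2 b.2 y' ∧ V.ok y' b'.2 c.2 z' ∧ W.ok z' c'.2 a.2 x' ∧
        SlideEq δ U V W i j k a a' b b' c c' x y z x' y' z') ∧
    ∀ x' y' z', U.ok x' a'.2 b.2 y' → V.ok y' b'.2 c.2 z' → W.ok z' c'.2 a.2 x' →
      ∃ x y z, U.ok a.2 x y b'.2 ∧ V.ok b.2 y z c'.2 ∧ W.ok c.2 z x a'.2 ∧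
        SlideEq δ U V W i j k a a' b b' c c' x y z x' y' z'

/-- The pattern of the three strands is cyclically symmetric, so a result about the first crossing
holds for each of the three. -/
theorem SlideEq.rotate {i j k : ℕ} {a a' b b' c c' : ℕ × X} {x y z x' y' z' : X}
    (h : SlideEq δ U V W i j k a a' b b' c c' x y z x' y' z') :
    SlideEq δ V W U j k i b b' c c' a a' y z x y' z' x' := by
  have hp : List.Perm [j, k, i] [i, j, k] := (List.perm_append_comm (l₁ := [j, k]) (l₂ := [i]))
  simp only [SlideEq, integrals_perm hp] at h ⊢
  convert h using 2 <;> ring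

theorem Slides.rotate (h : Slides δ U V W) : Slides δ V W U := by
  intro j k i b b' c c' a a' hjk hji hki hp
  obtain ⟨h1, h2⟩ := h i j k a a' b b' c c' hji.symm hki.symm hjk fun p hp' => by
    have := hp p (by simp only [List.mem_cons, List.not_mem_nil, or_false] at hp' ⊢; tauto)
    exact ⟨this.2.2, this.1, this.2.1⟩
  refine ⟨fun y z x hV hW hU => ?_, fun y z x hV hW hU => ?_⟩
  · obtain ⟨x', y', z', k1, k2, k3, k4⟩ := h1 x y z hU hV hW
    exact ⟨y', z', x', k2, k3, k1, k4.rotate⟩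
  · obtain ⟨x', y', z', k1, k2, k3, k4⟩ := h2 x y z hU hV hW
    exact ⟨y', z', x', k2, k3, k1, k4.rotate⟩

end CrossingType

/-! ### The third Reidemeister move with other signs of the crossings. -/

namespace StateRing

variable {R : Type*} [CommRing R] {δ : R}

/-- Both sides arise from `edge m n * F m = edge m n * F n` by deleting both points, in different
orders. This is independence of the name of a deleted point. -/
theorem integral_rename {m n : ℕ} (hmn : m ≠ n) {F : ℕ → StateRing R} (hm : Free δ m (F n))
    (hn : Free δ n (F m)) (h : edge m n * F m = edge m n * F n) :
    integral δ m (F m) = integral δ n (F n) := by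
  rw [← hn.integral_edge_mul hmn, ← hm.integral_edge_mul hmn.symm, integral_comm, edge_comm n m, h]

theorem integral_pair_edge_mul {m n p q : ℕ} (hmn : m ≠ n) (hpm : p ≠ m) (hqm : q ≠ m)
    (hqn : q ≠ n) {g : StateRing R} (hm : Free δ m g) (hn : Free δ n g) :
    integrals δ [m, n] (edge m p * edge n q * g) = g := by
  by_cases hpn : p = n
  · subst hpn
    rw [integrals_cons, integrals_cons, integrals_nil, edge_comm, edge_mul_edge, edge_comm p m,
      mul_assoc, edge_comm m p, ((Free.edge hmn hqn).mul hn).integral_edge_mul hmn,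
      hm.integral_edge_mul hqm]
  · rw [integrals_cons, integrals_cons, integrals_nil, mul_assoc, Free.edge hmn hpn,
      hn.integral_edge_mul hqn, hm.integral_edge_mul hpm]

end StateRing

namespace CrossingType

open StateRing

variable {X R : Type*} [CommRing R] {δ : R} {T U V W : CrossingType X R}

/-- The first of three crossings can be replaced by the crossing that cancels it. -/
theorem SlideEq.toggle (hc : Cancels δ U T) {i j k f g u v : ℕ} {a a' b b' c c' : ℕ × X}
    {x y z x' y' z' : X} (hn : [i, j, k, f, g, u, v].Nodup)
    (hp : ∀ p ∈ [a, a', b, b', c, c'], p.1 ≠ i ∧ p.1 ≠ j ∧ p.1 ≠ k ∧ p.1 ≠ f ∧ p.1 ≠ g ∧ p.1 ≠ u ∧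
      p.1 ≠ v) (hok : U.ok a.2 x y b'.2) (hok' : U.ok x' a'.2 b.2 y')
    (h : SlideEq δ U V W u v k (f, x') (i, x) (j, y) (g, y') c c' a'.2 b.2 z a.2 b'.2 z') :
    SlideEq δ T V.revFst W.revSnd i j k a a' b b' c c' x y z x' y' z' := by
  simp only [List.nodup_cons, List.mem_cons, List.not_mem_nil, or_false, not_or, not_false_eq_true,
    List.nodup_nil, and_true, forall_eq_or_imp, forall_eq, ← ne_eq] at hn hp
  obtain ⟨⟨n1, n2, n3, n4, n5, n6⟩, ⟨n7, n8, n9, n10, n11⟩, ⟨n12, n13, n14, n15⟩,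
    ⟨n16, n17, n18⟩, ⟨n19, n20⟩, n21⟩ := hn
  obtain ⟨⟨a1, a2, a3, a4, a5, a6, a7⟩, ⟨d1, d2, d3, d4, d5, d6, d7⟩, ⟨b1, b2, b3, b4, b5, b6, b7⟩,
    ⟨e1, e2, e3, e4, e5, e6, e7⟩, ⟨c1, c2, c3, c4, c5, c6, c7⟩, g1, g2, g3, g4, g5, g6, g7⟩ := hp
  -- The known move concerns strands from `f` via `u` to `i` and from `j` via `v` to `g`. Two copies
  -- of `T` are attached, one between `a`, `b'` and `i`, `j`, the other between `f`, `g` and `a'`,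
  -- `b`. On the left the second copy cancels `U` over `f`, `g`; on the right the first copy cancels
  -- `U` over `i`, `j`. In the new move the first two strands run through the known one backwards,
  -- hence the reversals in `V` and `W`.
  have cancel₁ : integrals δ [f, g] (U.vertex (f, x') (u, a'.2) (v, b.2) (g, y') *
      T.vertex (f, x') a' b (g, y')) = edge u a'.1 * edge v b.1 := by
    have := hc.revSnd.integral_start_start (m := f) (n := g) (x := x') (y := y') (b := (u, a'.2))
      (b' := a') (d := (v, b.2)) (d' := b) n16 ⟨n17.symm, d4, n18.symm, b4⟩
      ⟨n19.symm, d5, n20.symm, b5⟩ rfl rfl hok'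
    rwa [vertex_revSnd, vertex_revSnd] at this
  have cancel₂ : integrals δ [i, j] (U.vertex (u, a.2) (i, x) (j, y) (v, b'.2) *
      T.vertex a (i, x) (j, y) b') = edge u a.1 * edge v b'.1 := by
    have := hc.revFst.integral_start_start (m := i) (n := j) (x := x) (y := y) (b := (u, a.2))
      (b' := a) (d := (v, b'.2)) (d' := b') n1 ⟨n5.symm, a1, n6.symm, e1⟩
      ⟨n10.symm, a2, n11.symm, e2⟩ rfl rfl hok
    rwa [vertex_revFst, vertex_revFst] at this
  let G₁ : StateRing R := T.vertex a (i, x) (j, y) b'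
  let G₂ : StateRing R := T.vertex (f, x') a' b (g, y')
  have lhs : ∀ V' W' : StateRing R, V' = V.vertex (j, y) b (k, z) c' →
      W' = W.vertex c (k, z) a' (i, x) →
      integrals δ [u, v] (integrals δ [f, g] ((U.vertex (f, x') (u, a'.2) (v, b.2) (g, y') *
        V.vertex (j, y) (v, b.2) (k, z) c' * W.vertex c (k, z) (u, a'.2) (i, x)) * (G₁ * G₂))) =
      G₁ * V' * W' := by
    rintro V' W' rfl rfl
    have h1 : ∀ m ∈ [f, g], Free δ m
        (V.vertex (j, y) (v, b.2) (k, z) c' * W.vertex c (k, z) (u, a'.2) (i, x) * G₁) := by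
      intro m hm
      simp only [List.mem_cons, List.not_mem_nil, or_false] at hm
      rcases hm with rfl | rfl
      · exact ((free_vertex n8 n18.symm n12 g4).mul (free_vertex c4 n12 n17.symm n3)).mul
          (free_vertex a4 n3 n8 e4)
      · exact ((free_vertex n9 n20.symm n13 g5).mul (free_vertex c5 n13 n19.symm n4)).mul
          (free_vertex a5 n4 n9 e5)
    have h2 : ∀ A B C D E : StateRing R, A * B * C * (D * E) = B * C * D * (A * E) := by
      intros; ring
    rw [h2, integrals_mul h1, cancel₁, show ∀ A B C D E : StateRing R,
      A * B * C * (D * E) = (E * A) * (D * B) * C by intros; ring, edge_mul_vertex₂,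
      edge_mul_vertex₃, show ∀ A B C D E : StateRing R,
      (A * B) * (C * D) * E = C * A * (E * B * D) by intros; ring]
    exact integral_pair_edge_mul n21 d6 b6 b7
      (((free_vertex a6 n5 n10 e6).mul (free_vertex n10 b6 n14 g6)).mul
        (free_vertex c6 n14 d6 n5))
      (((free_vertex a7 n6 n11 e7).mul (free_vertex n11 b7 n15 g7)).mul
        (free_vertex c7 n15 d7 n6))
  have rhs : integrals δ [u, v] (integrals δ [i, j] ((U.vertex (u, a.2) (i, x) (j, y) (v, b'.2) *
        V.vertex (v, b'.2) (g, y') c (k, z') * W.vertex (k, z') c' (f, x') (u, a.2)) *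
          (G₁ * G₂))) =
      G₂ * V.vertex b' (g, y') c (k, z') * W.vertex (k, z') c' (f, x') a := by
    have h1 : ∀ m ∈ [i, j], Free δ m
        (V.vertex (v, b'.2) (g, y') c (k, z') * W.vertex (k, z') c' (f, x') (u, a.2) * G₂) := by
      intro m hm
      simp only [List.mem_cons, List.not_mem_nil, or_false] at hm
      rcases hm with rfl | rfl
      · exact ((free_vertex n6.symm n4.symm c1 n2.symm).mul
          (free_vertex n2.symm g1 n3.symm n5.symm)).mul (free_vertex n3.symm d1 b1 n4.symm)
      · exact ((free_vertex n11.symm n9.symm c2 n7.symm).mul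
          (free_vertex n7.symm g2 n8.symm n10.symm)).mul (free_vertex n8.symm d2 b2 n9.symm)
    have h2 : ∀ A B C D E : StateRing R, A * B * C * (D * E) = B * C * E * (A * D) := by
      intros; ring
    rw [h2, integrals_mul h1, cancel₂, show ∀ A B C D E : StateRing R,
      A * B * C * (D * E) = (E * A) * (D * B) * C by intros; ring, edge_mul_vertex₁,
      edge_mul_vertex₄, show ∀ A B C D E : StateRing R,
      (A * B) * (C * D) * E = C * A * (E * B * D) by intros; ring]
    exact integral_pair_edge_mul n21 a6 e6 e7
      (((free_vertex n17 d6 b6 n19).mul (free_vertex e6 n19 c6 n14)).mul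
        (free_vertex n14 g6 n17 a6))
      (((free_vertex n18 d7 b7 n20).mul (free_vertex e7 n20 c7 n15)).mul
        (free_vertex n15 g7 n18 a7))
  have hG : ∀ m ∈ [u, v, k], Free δ m (G₁ * G₂) := by
    intro m hm
    simp only [List.mem_cons, List.not_mem_nil, or_false] at hm
    rcases hm with rfl | rfl | rfl
    · exact (free_vertex a6 n5 n10 e6).mul (free_vertex n17 d6 b6 n19)
    · exact (free_vertex a7 n6 n11 e7).mul (free_vertex n18 d7 b7 n20)
    · exact (free_vertex a3 n2 n7 e3).mul (free_vertex n12.symm d3 b3 n13.symm)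
  have key : integrals δ [i, j, k] (integrals δ [u, v] (integrals δ [f, g]
      ((U.vertex (f, x') (u, a'.2) (v, b.2) (g, y') * V.vertex (j, y) (v, b.2) (k, z) c' *
        W.vertex c (k, z) (u, a'.2) (i, x)) * (G₁ * G₂)))) =
      integrals δ [f, g, k] (integrals δ [u, v] (integrals δ [i, j]
        ((U.vertex (u, a.2) (i, x) (j, y) (v, b'.2) * V.vertex (v, b'.2) (g, y') c (k, z') *
          W.vertex (k, z') c' (f, x') (u, a.2)) * (G₁ * G₂)))) := by
    simp only [← integrals_append]
    have p1 : ([i, j, k] ++ ([u, v] ++ [f, g])).Perm ([f, g, i, j] ++ [u, v, k]) := by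
      rw [← Multiset.coe_eq_coe]
      simp only [List.cons_append, List.nil_append, ← Multiset.cons_coe]
      ext m; simp only [Multiset.count_cons]; omega
    have p2 : ([f, g, k] ++ ([u, v] ++ [i, j])).Perm ([f, g, i, j] ++ [u, v, k]) := by
      rw [← Multiset.coe_eq_coe]
      simp only [List.cons_append, List.nil_append, ← Multiset.cons_coe]
      ext m; simp only [Multiset.count_cons]; omega
    rw [integrals_perm p1, integrals_perm p2, integrals_append, integrals_append, mul_comm _ (G₁ * G₂),
      mul_comm _ (G₁ * G₂), integrals_mul hG, integrals_mul hG]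
    exact congrArg (fun q => integrals δ [f, g, i, j] (G₁ * G₂ * q)) h
  rw [lhs _ _ rfl rfl, rhs] at key
  simp only [SlideEq, vertex_revFst, vertex_revSnd]
  refine key.trans ?_
  -- The cancellation on the right leaves the other side of the new move with inner points `f`, `g`;
  -- they are renamed to `i`, `j`.
  let F : ℕ → ℕ → StateRing R := fun f g =>
    T.vertex (f, x') a' b (g, y') * V.vertex b' (g, y') c (k, z') * W.vertex (k, z') c' (f, x') a
  have r1 : integral δ f (F f g) = integral δ i (F i g) := by
    refine integral_rename (F := fun f => F f g) n3.symm ?_ ?_ ?_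
    · exact ((free_vertex n3 d4 b4 n16.symm).mul (free_vertex e4 n16.symm c4 n12)).mul
        (free_vertex n12 g4 n3 a4)
    · exact ((free_vertex n3.symm d1 b1 n4.symm).mul (free_vertex e1 n4.symm c1 n2.symm)).mul
        (free_vertex n2.symm g1 n3.symm a1)
    · have h1 := edge_mul_vertex₁ (U := T) f (i, x') a' b (g, y')
      have h2 := edge_mul_vertex₃ (U := W) f (i, x') (k, z') c' a
      linear_combination (V.vertex b' (g, y') c (k, z') * W.vertex (k, z') c' (f, x') a) * h1 +
        (T.vertex (i, x') a' b (g, y') * V.vertex b' (g, y') c (k, z')) * h2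
  have r2 : integral δ g (F i g) = integral δ j (F i j) := by
    refine integral_rename (F := fun g => F i g) n9.symm ?_ ?_ ?_
    · exact ((free_vertex n4 d5 b5 n9).mul (free_vertex e5 n9 c5 n13)).mul
        (free_vertex n13 g5 n4 a5)
    · exact ((free_vertex n1 d2 b2 n9.symm).mul (free_vertex e2 n9.symm c2 n7.symm)).mul
        (free_vertex n7.symm g2 n1 a2)
    · have h1 := edge_mul_vertex₄ (U := T) g (j, y') (i, x') a' b
      have h2 := edge_mul_vertex₂ (U := V) g (j, y') b' c (k, z')
      linear_combination (V.vertex b' (g, y') c (k, z') * W.vertex (k, z') c' (i, x') a) * h1 +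
        (T.vertex (i, x') a' b (j, y') * W.vertex (k, z') c' (i, x') a) * h2
  simp only [integrals_cons, integrals_nil]
  calc integral δ f (integral δ g (integral δ k (F f g)))
      = integral δ g (integral δ k (integral δ f (F f g))) := by
        rw [integral_comm f g, integral_comm f k]
    _ = integral δ i (integral δ k (integral δ g (F i g))) := by
        rw [r1, integral_comm k i, integral_comm g i, integral_comm g k]
    _ = integral δ i (integral δ j (integral δ k (F i j))) := by
        rw [r2, integral_comm k j]

/-- The first of three crossings can be replaced by the crossing that cancels it. -/
theorem Slides.toggle (hc : Cancels δ U T) (hU : U.Regular) (h : Slides δ U V W) :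
    Slides δ T V.revFst W.revSnd := by
  intro i j k a a' b b' c c' hij hik hjk hp
  obtain ⟨f, hf⟩ := Infinite.exists_notMem_finset
    ({i, j, k, a.1, a'.1, b.1, b'.1, c.1, c'.1} : Finset ℕ)
  obtain ⟨g, hg⟩ := Infinite.exists_notMem_finset
    ({i, j, k, f, a.1, a'.1, b.1, b'.1, c.1, c'.1} : Finset ℕ)
  obtain ⟨u, hu⟩ := Infinite.exists_notMem_finset
    ({i, j, k, f, g, a.1, a'.1, b.1, b'.1, c.1, c'.1} : Finset ℕ)
  obtain ⟨v, hv⟩ := Infinite.exists_notMem_finset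
    ({i, j, k, f, g, u, a.1, a'.1, b.1, b'.1, c.1, c'.1} : Finset ℕ)
  simp only [Finset.mem_insert, Finset.mem_singleton, not_or] at hf hg hu hv
  have hn : [i, j, k, f, g, u, v].Nodup := by
    simp only [List.nodup_cons, List.mem_cons, List.not_mem_nil, or_false, not_or,
      not_false_eq_true, List.nodup_nil, and_true]
    grind
  have hp' : ∀ p ∈ [a, a', b, b', c, c'], p.1 ≠ i ∧ p.1 ≠ j ∧ p.1 ≠ k ∧ p.1 ≠ f ∧ p.1 ≠ g ∧
      p.1 ≠ u ∧ p.1 ≠ v := by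
    simp only [List.mem_cons, List.not_mem_nil, or_false, forall_eq_or_imp, forall_eq] at hp ⊢
    grind
  have hq : ∀ x y x' y' : X, ∀ p ∈ [((f, x') : ℕ × X), (i, x), (j, y), (g, y'), c, c'],
      p.1 ≠ u ∧ p.1 ≠ v ∧ p.1 ≠ k := by
    intro x y x' y'
    simp only [List.mem_cons, List.not_mem_nil, or_false, forall_eq_or_imp, forall_eq] at hp ⊢
    grind
  have hs := fun x y x' y' => h u v k (f, x') (i, x) (j, y) (g, y') c c' (by grind) (by grind)
    (by grind) (hq x y x' y')
  refine ⟨fun x y z hT hV hW => ?_, fun x' y' z' hT hV hW => ?_⟩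
  · rw [← hc.ok_iff] at hT
    -- The colors of the auxiliary ends `f`, `g` are forced by the second added crossing. The known
    -- move then returns colors at the first one, which regularity identifies with those of `a` and
    -- `b'`.
    obtain ⟨⟨x', y'⟩, hok, -⟩ := hU.end_start a'.2 b.2
    obtain ⟨p, q, z', k1, k2, k3, k4⟩ := (hs x y x' y').1 _ _ z hok hV hW
    have := (hU.end_start x y).unique (y₁ := (a.2, b'.2)) (y₂ := (p, q)) hT k1
    obtain ⟨rfl, rfl⟩ : a.2 = p ∧ b'.2 = q := Prod.mk.inj this
    exact ⟨x', y', z', (hc.ok_iff ..).1 hok, k2, k3, k4.toggle hc hn hp' hT hok⟩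
  · rw [← hc.ok_iff] at hT
    obtain ⟨⟨x, y⟩, hok, -⟩ := hU.start_end a.2 b'.2
    obtain ⟨p, q, z, k1, k2, k3, k4⟩ := (hs x y x' y').2 _ _ z' hok hV hW
    have := (hU.start_end x' y').unique (y₁ := (a'.2, b.2)) (y₂ := (p, q)) hT k1
    obtain ⟨rfl, rfl⟩ : a'.2 = p ∧ b.2 = q := Prod.mk.inj this
    exact ⟨x, y, z, (hc.ok_iff ..).1 hok, k2, k3, k4.toggle hc hn hp' hok hT⟩

end CrossingType

/-! ### The crossings of a virtual bracket -/

namespace Biquandle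

variable {X : Type*} [Biquandle X]

/-- By the exchange laws, `h` and injectivity give `a ▷ᵤ b = a ▷ᵤ a` and `a ▷ᵤ b = b ▷ₒ b`. Then
`(a, a)` and `(a, b)` have the same image under the sideways map. This is the coloring argument for
kinks. -/
theorem eq_of_under_eq_over {a b : X} (h : a ▷ᵤ b = b ▷ₒ a) : a = b := by
  have h1 := exchange_uu a b a
  have h2 := exchange_oo b a b
  rw [← h] at h1 h2
  have ha : a ▷ᵤ b = a ▷ᵤ a := (under_bijective _).1 h1
  have hb : a ▷ᵤ b = b ▷ₒ b := (over_bijective _).1 h2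
  have : (a, a) = (a, b) := side_bijective.1 <| by
    change (a ▷ₒ a, a ▷ᵤ a) = (b ▷ₒ a, a ▷ᵤ b)
    rw [← under_self, ← h, ha]
  exact (Prod.mk.inj this).2

end Biquandle

namespace VirtualBracket

open StateRing CrossingType

variable {X R : Type*} [Biquandle X] [CommRing R] (β : VirtualBracket X R)

/-- The coefficient of a smoothing, normalized by the contribution of the crossing to the writhe. -/
def weight (pos : Bool) (s : Smoothing) (x y : X) : R :=
  ((if pos then β.ω⁻¹ else β.ω : Rˣ) : R) * β.coeff pos s x y

/-- A crossing of an under-strand and an over-strand, in this order; at a negative crossing both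
strands are reversed. -/
def crossingType (pos : Bool) : CrossingType X R where
  ok a b c d := c = d ▷ₒ a ∧ b = a ▷ᵤ d
  vert a _ _ d := β.weight pos Smoothing.vertical a d
  horiz a _ _ d := β.weight pos Smoothing.horizontal a d
  straight a _ _ d := β.weight pos Smoothing.virt a d

/-- The pair consisting of the start of the under-strand and the end of the over-strand determines
the rest by formula; the other three pairs of known ends correspond to the three bijectivity axioms.
-/
theorem regular_crossingType (pos : Bool) : (β.crossingType pos).Regular where
  start_start a c := by
    obtain ⟨d, rfl : d ▷ₒ a = c⟩ := (Biquandle.over_bijective a).2 c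
    refine ⟨(a ▷ᵤ d, d), ⟨rfl, rfl⟩, ?_⟩
    rintro ⟨b', d'⟩ ⟨h1, h2⟩
    obtain rfl : d = d' := (Biquandle.over_bijective a).1 h1
    exact Prod.ext h2 rfl
  start_end a d := ⟨(a ▷ᵤ d, d ▷ₒ a), ⟨rfl, rfl⟩, fun p h => Prod.ext h.2 h.1⟩
  end_start b c := by
    obtain ⟨⟨a, d⟩, h⟩ := Biquandle.side_bijective.2 (c, b)
    obtain ⟨rfl, rfl⟩ : d ▷ₒ a = c ∧ a ▷ᵤ d = b := Prod.mk.inj h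
    exact ⟨(a, d), ⟨rfl, rfl⟩, fun p hp => Biquandle.side_bijective.1 <|
      Prod.ext hp.1.symm hp.2.symm⟩
  end_end b d := by
    obtain ⟨a, rfl : a ▷ᵤ d = b⟩ := (Biquandle.under_bijective d).2 b
    refine ⟨(a, d ▷ₒ a), ⟨rfl, rfl⟩, ?_⟩
    rintro ⟨a', c'⟩ ⟨h1, h2⟩
    obtain rfl : a = a' := (Biquandle.under_bijective d).1 h2
    exact Prod.ext rfl h1

/-- Since a negative crossing is recorded with both strands reversed, the two signs have the same
admissible colors and the same arguments `a`, `d` of the coefficients. The conditions become the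
axioms `r2`, with the factors `ω` and `ω⁻¹` cancelling; the two loop conditions add one of `r2_BU`,
`r2_AU` to one of the `δ` axioms. -/
theorem cancels_crossingType (pos : Bool) :
    Cancels β.δ (β.crossingType pos) (β.crossingType !pos) := by
  have hω : ((β.ω⁻¹ : Rˣ) : R) * (β.ω : R) = 1 := β.ω.inv_mul
  cases pos <;> constructor <;> intro a b c d <;> try intro _
  all_goals
    have h1 := β.r2_AC a d
    have h2 := β.r2_BD a d
    have h3 := β.r2_AU a d
    have h4 := β.r2_BU a d
    have h5 := β.r2_δBD a d
    have h6 := β.r2_δAC a d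
    simp only [crossingType, weight, coeff, Bool.not_false, Bool.not_true, if_true, if_false,
      Bool.false_eq_true]
  · linear_combination hω - ((β.ω⁻¹ : Rˣ) : R) * (β.ω : R) * h1
  · linear_combination - ((β.ω⁻¹ : Rˣ) : R) * (β.ω : R) * h3
  · linear_combination - ((β.ω⁻¹ : Rˣ) : R) * (β.ω : R) * (h5 + h4)
  · linear_combination hω - ((β.ω⁻¹ : Rˣ) : R) * (β.ω : R) * h2
  · linear_combination - ((β.ω⁻¹ : Rˣ) : R) * (β.ω : R) * h4
  · linear_combination - ((β.ω⁻¹ : Rˣ) : R) * (β.ω : R) * (h6 + h3)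
  · linear_combination hω - ((β.ω⁻¹ : Rˣ) : R) * (β.ω : R) * h1
  · linear_combination - ((β.ω⁻¹ : Rˣ) : R) * (β.ω : R) * h3
  · linear_combination - ((β.ω⁻¹ : Rˣ) : R) * (β.ω : R) * (h5 + h4)
  · linear_combination hω - ((β.ω⁻¹ : Rˣ) : R) * (β.ω : R) * h2
  · linear_combination - ((β.ω⁻¹ : Rˣ) : R) * (β.ω : R) * h4
  · linear_combination - ((β.ω⁻¹ : Rˣ) : R) * (β.ω : R) * (h6 + h3)

/-- Here the strand `a` is below `b`, and both are below `c`; the middle strand is traversed against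
its orientation to fit the cyclic pattern. The colors `x`, `y`, `z` of the axioms `r3` are those of
`a`, of the inner part of the middle strand, and of `c'`; the common factor is `ω⁻¹` cubed. -/
theorem slides_positive : Slides β.δ (β.crossingType true).revSnd (β.crossingType true).revFst
    (β.crossingType true).swap := by
  intro i j k a a' b b' c c' hij hik hjk hp
  simp only [List.mem_cons, List.not_mem_nil, or_false, forall_eq_or_imp, forall_eq] at hp
  obtain ⟨⟨a1, a2, a3⟩, ⟨d1, d2, d3⟩, ⟨b1, b2, b3⟩, ⟨e1, e2, e3⟩, ⟨c1, c2, c3⟩, f1, f2, f3⟩ := hp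
  have key : ∀ y, b'.2 = y ▷ₒ a.2 → b.2 = y ▷ᵤ c'.2 → c.2 = (c'.2 ▷ₒ y) ▷ₒ (a.2 ▷ᵤ y) →
      a'.2 = (a.2 ▷ᵤ y) ▷ᵤ (c'.2 ▷ₒ y) →
      SlideEq β.δ (β.crossingType true).revSnd (β.crossingType true).revFst
        (β.crossingType true).swap i j k a a' b b' c c' (a.2 ▷ᵤ y) y (c'.2 ▷ₒ y)
        (a.2 ▷ᵤ c'.2) (b.2 ▷ₒ (a.2 ▷ᵤ c'.2)) (c'.2 ▷ₒ a.2) := by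
    intro y h1 h2 h3 h4
    simp only [SlideEq, vertex_revFst, vertex_revSnd, vertex_swap, integrals_cons, integrals_nil]
    have p1 : ∀ A B C : StateRing R, A * B * C = A * (B * C) := mul_assoc
    simp only [vertex, p1]
    rw [integral_joint_triangle _ _ _ _ _ _ _ _ _ hij hik hjk ⟨a1, d1, e1, b1, c1, f1⟩
      ⟨a2, d2, e2, b2, c2, f2⟩ ⟨a3, d3, e3, b3, c3, f3⟩]
    -- With all three strands reversed, the other side of the move meets its crossings in the order
    -- of the first side, so the same expansion applies with starts and ends exchanged.
    conv_rhs =>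
      rw [joint_flip i a'.1, joint_flip b'.1 j, joint_flip a.1 i]
      rw [integral_joint_triangle _ _ _ _ _ _ _ _ _ hij hik hjk ⟨d1, a1, b1, e1, f1, c1⟩
        ⟨d2, a2, b2, e2, f2, c2⟩ ⟨d3, a3, b3, e3, f3, c3⟩]
    have hs : ∀ s x z, β.weight true s x z = ((β.ω⁻¹ : Rˣ) : R) * β.coeff true s x z :=
      fun _ _ _ => rfl
    apply triangle_eq_triangle <;>
      simp only [crossingType, hs, coeff, h1, h2]
    · linear_combination ((β.ω⁻¹ : Rˣ) : R) ^ 3 * β.r3_01 a.2 y c'.2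
    · linear_combination ((β.ω⁻¹ : Rˣ) : R) ^ 3 * β.r3_02 a.2 y c'.2
    · linear_combination ((β.ω⁻¹ : Rˣ) : R) ^ 3 * β.r3_03 a.2 y c'.2
    · linear_combination ((β.ω⁻¹ : Rˣ) : R) ^ 3 * β.r3_04 a.2 y c'.2
    · linear_combination ((β.ω⁻¹ : Rˣ) : R) ^ 3 * β.r3_05 a.2 y c'.2
    · linear_combination ((β.ω⁻¹ : Rˣ) : R) ^ 3 * β.r3_06 a.2 y c'.2
    · linear_combination ((β.ω⁻¹ : Rˣ) : R) ^ 3 * β.r3_07 a.2 y c'.2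
    · linear_combination ((β.ω⁻¹ : Rˣ) : R) ^ 3 * β.r3_08 a.2 y c'.2
    · linear_combination ((β.ω⁻¹ : Rˣ) : R) ^ 3 * β.r3_09 a.2 y c'.2
    · linear_combination ((β.ω⁻¹ : Rˣ) : R) ^ 3 * β.r3_10 a.2 y c'.2
    · linear_combination ((β.ω⁻¹ : Rˣ) : R) ^ 3 * β.r3_11 a.2 y c'.2
    · linear_combination ((β.ω⁻¹ : Rˣ) : R) ^ 3 * β.r3_12 a.2 y c'.2
    · linear_combination ((β.ω⁻¹ : Rˣ) : R) ^ 3 * β.r3_13 a.2 y c'.2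
    · linear_combination ((β.ω⁻¹ : Rˣ) : R) ^ 3 * β.r3_14 a.2 y c'.2
    · linear_combination ((β.ω⁻¹ : Rˣ) : R) ^ 3 * β.r3_15 a.2 y c'.2
  constructor
  · rintro x y z ⟨h1, rfl⟩ ⟨rfl, h2⟩ ⟨h3, h4⟩
    refine ⟨_, _, _, ⟨rfl, ?_⟩, ⟨?_, ?_⟩, ⟨rfl, rfl⟩, key y h1 h2 h3 h4⟩
    · rw [h4, h2, Biquandle.exchange_uu]
    · rw [h3, h1, Biquandle.exchange_oo]
    · rw [h2, h1, Biquandle.exchange_uo]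
  · rintro x y z ⟨rfl, h1⟩ ⟨h2, h3⟩ ⟨rfl, rfl⟩
    -- The inner color of the middle strand before the move is found by undoing its crossing with
    -- `a`; that it also fits the crossing with `c` follows by cancelling an over-operation in
    -- `exchange_uo`.
    obtain ⟨w, hw : w ▷ₒ a.2 = b'.2⟩ := (Biquandle.over_bijective a.2).2 b'.2
    have hb : b.2 = w ▷ᵤ c'.2 := by
      apply (Biquandle.over_bijective (a.2 ▷ᵤ c'.2)).1
      change b.2 ▷ₒ _ = (w ▷ᵤ c'.2) ▷ₒ _
      rw [h3, ← hw, Biquandle.exchange_uo]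
    have hc : c.2 = (c'.2 ▷ₒ w) ▷ₒ (a.2 ▷ᵤ w) := by rw [h2, ← hw, Biquandle.exchange_oo]
    have ha : a'.2 = (a.2 ▷ᵤ w) ▷ᵤ (c'.2 ▷ₒ w) := by rw [h1, hb, Biquandle.exchange_uu]
    exact ⟨_, w, _, ⟨hw.symm, rfl⟩, ⟨rfl, hb⟩, ⟨hc, ha⟩, key w hw.symm hb hc ha⟩

/-- The three crossings of a third Reidemeister move with given signs. -/
theorem slides (p q r : Bool) : Slides β.δ
    (bif r then bif q then (β.crossingType p).revSnd else β.crossingType p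
      else bif q then (β.crossingType p).revSnd.revFst else (β.crossingType p).revFst)
    (bif p then bif r then (β.crossingType q).revFst else (β.crossingType q).revFst.revSnd
      else bif r then β.crossingType q else (β.crossingType q).revSnd)
    (bif q then bif p then (β.crossingType r).swap else (β.crossingType r).swap.revSnd
      else bif p then (β.crossingType r).swap.revFst
        else (β.crossingType r).swap.revFst.revSnd) := by
  have reg := β.regular_crossingType
  have can := β.cancels_crossingType
  have h₀ := β.slides_positive
  -- Changing the sign of one crossing reverses one strand in each of the other two. Starting from
  -- three positive signs, at most three such changes reach every pattern.
  have tU : ∀ {U T V W : CrossingType X R}, Slides β.δ U V W → Cancels β.δ U T → U.Regular →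
      Slides β.δ T V.revFst W.revSnd := fun h hc hU => h.toggle hc hU
  have tV : ∀ {U T V W : CrossingType X R}, Slides β.δ U V W → Cancels β.δ V T → V.Regular →
      Slides β.δ U.revSnd T W.revFst := fun h hc hU => (h.rotate.toggle hc hU).rotate.rotate
  have tW : ∀ {U T V W : CrossingType X R}, Slides β.δ U V W → Cancels β.δ W T → W.Regular →
      Slides β.δ U.revFst V.revSnd T := fun h hc hU => (h.rotate.rotate.toggle hc hU).rotate
  have hU := tU h₀ (can true).revSnd (reg true).revSnd
  have hV := tV h₀ (can true).revFst (reg true).revFst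
  have hW := tW h₀ (can true).swap (reg true).swap
  have hUV := tV hU (can true).revFst.revFst (reg true).revFst.revFst
  have hUW := tW hU (can true).swap.revSnd (reg true).swap.revSnd
  have hVW := tW hV (can true).swap.revFst (reg true).swap.revFst
  have hUVW := tW hUV (can true).swap.revSnd.revFst (reg true).swap.revSnd.revFst
  cases p <;> cases q <;> cases r
  exacts [hUVW, hUV, hUW, hU, hVW, hV, hW, h₀]

end VirtualBracket

/-! ### Crossings of legs -/

/-- A piece of a strand, with its colored start and end. -/
abbrev Leg (X : Type*) := (ℕ × X) × (ℕ × X)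

/-- A strand from `s₀` via `s₁` to `s₂` consists of two legs, of which this is the first or the
second one. -/
def leg {X : Type*} (first : Bool) (s₀ s₁ s₂ : ℕ × X) : Leg X :=
  bif first then (s₀, s₁) else (s₁, s₂)

namespace CrossingType

open StateRing

variable {X R : Type*}

def Ok (U : CrossingType X R) (e f : Leg X) : Prop := U.ok e.1.2 e.2.2 f.1.2 f.2.2

noncomputable def value [CommRing R] (U : CrossingType X R) (e f : Leg X) : StateRing R :=
  U.vertex e.1 e.2 f.1 f.2

end CrossingType

namespace VirtualBracket

open StateRing CrossingType

variable {X R : Type*} [Biquandle X] [CommRing R] (β : VirtualBracket X R)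

/-- A crossing of an under-strand and an over-strand, in this order. -/
def crossing (pos : Bool) : CrossingType X R :=
  bif pos then β.crossingType true else (β.crossingType false).revFst.revSnd

theorem regular_crossing (pos : Bool) : (β.crossing pos).Regular := by
  cases pos
  · exact (β.regular_crossingType false).revFst.revSnd
  · exact β.regular_crossingType true

/-- In `Slides` the directions of the strands are dictated by the signs, so the ends are named
according to `p`, `q`, `r`. For given signs the two parity conditions leave two opposite orders of
the crossings, namely the two sides of the move, and one of the two halves of `slides` applies. -/
theorem exists_third_move {p q r oB oM oT : Bool} (h₁ : (oB ^^ oM) = (q ^^ r))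
    (h₂ : (oM ^^ oT) = (p ^^ r)) {i j k : ℕ} {B₀ B₂ M₀ M₂ T₀ T₂ : ℕ × X} (hij : i ≠ j) (hik : i ≠ k)
    (hjk : j ≠ k)
    (hp : ∀ s ∈ [B₀, B₂, M₀, M₂, T₀, T₂], s.1 ≠ i ∧ s.1 ≠ j ∧ s.1 ≠ k) {x y z : X}
    (hp₁ : (β.crossing p).Ok (leg oB B₀ (i, x) B₂) (leg oM M₀ (j, y) M₂))
    (hq₁ : (β.crossing q).Ok (leg (!oM) M₀ (j, y) M₂) (leg (!oT) T₀ (k, z) T₂))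
    (hr₁ : (β.crossing r).Ok (leg (!oB) B₀ (i, x) B₂) (leg oT T₀ (k, z) T₂)) :
    ∃ x' y' z' : X,
      (β.crossing p).Ok (leg (!oB) B₀ (i, x') B₂) (leg (!oM) M₀ (j, y') M₂) ∧
      (β.crossing q).Ok (leg oM M₀ (j, y') M₂) (leg oT T₀ (k, z') T₂) ∧
      (β.crossing r).Ok (leg oB B₀ (i, x') B₂) (leg (!oT) T₀ (k, z') T₂) ∧
      integrals β.δ [i, j, k]
        ((β.crossing p).value (leg oB B₀ (i, x) B₂) (leg oM M₀ (j, y) M₂) *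
          (β.crossing q).value (leg (!oM) M₀ (j, y) M₂) (leg (!oT) T₀ (k, z) T₂) *
          (β.crossing r).value (leg (!oB) B₀ (i, x) B₂) (leg oT T₀ (k, z) T₂)) =
      integrals β.δ [i, j, k]
        ((β.crossing p).value (leg (!oB) B₀ (i, x') B₂) (leg (!oM) M₀ (j, y') M₂) *
          (β.crossing q).value (leg oM M₀ (j, y') M₂) (leg oT T₀ (k, z') T₂) *
          (β.crossing r).value (leg oB B₀ (i, x') B₂) (leg (!oT) T₀ (k, z') T₂)) := by
  obtain ⟨g₁, g₂⟩ := β.slides p q r i j k (bif p == r then B₀ else B₂) (bif p == r then B₂ else B₀)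
    (bif p == q then M₂ else M₀) (bif p == q then M₀ else M₂) (bif q == r then T₀ else T₂)
    (bif q == r then T₂ else T₀) hij hik hjk (by
      simp only [List.mem_cons, List.not_mem_nil, or_false, forall_eq_or_imp, forall_eq] at hp ⊢
      cases p <;> cases q <;> cases r <;>
        simp only [beq_self_eq_true, beq_true, beq_false, Bool.not_true, cond_true,
          cond_false] <;> tauto)
  cases p <;> cases q <;> cases r <;> cases oB <;> cases oM <;> cases oT <;>
    simp only [Bool.xor_true, Bool.xor_false, Bool.not_true, Bool.not_false, Bool.true_eq_false,
      Bool.false_eq_true] at h₁ h₂ <;>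
    first
    | (obtain ⟨x', y', z', k₁, k₂, k₃, k₄⟩ := g₁ x y z hp₁ hq₁ hr₁
       refine ⟨x', y', z', k₁, k₂, k₃, ?_⟩
       simp only [SlideEq, cond_true, cond_false, vertex_revFst, vertex_revSnd, vertex_swap,
         beq_self_eq_true, beq_true, beq_false, Bool.not_true] at k₄
       simpa only [CrossingType.value, crossing, leg, cond_true, cond_false, vertex_revFst,
         vertex_revSnd, Bool.not_true, Bool.not_false] using k₄)
    | (obtain ⟨x', y', z', k₁, k₂, k₃, k₄⟩ := g₂ x y z hp₁ hq₁ hr₁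
       refine ⟨x', y', z', k₁, k₂, k₃, ?_⟩
       simp only [SlideEq, cond_true, cond_false, vertex_revFst, vertex_revSnd, vertex_swap,
         beq_self_eq_true, beq_true, beq_false, Bool.not_true] at k₄
       simpa only [CrossingType.value, crossing, leg, cond_true, cond_false, vertex_revFst,
         vertex_revSnd, Bool.not_true, Bool.not_false] using k₄.symm)

/-- Two crossings of opposite signs in a bigon between a strand from `a` via `i` to `a'` and a strand
from `b` via `j` to `b'` cancel each other. -/
theorem integral_bigon {pos d : Bool} {i j : ℕ} {x y : X} {a a' b b' : ℕ × X} (hij : i ≠ j)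
    (hp : ∀ s ∈ [a, a', b, b'], s.1 ≠ i ∧ s.1 ≠ j) (ha : a'.2 = a.2) (hb : b'.2 = b.2)
    (hok : (β.crossing pos).Ok (leg true a (i, x) a') (leg d b (j, y) b')) :
    integrals β.δ [i, j] ((β.crossing pos).value (leg true a (i, x) a') (leg d b (j, y) b') *
      (β.crossing !pos).value (leg false a (i, x) a') (leg (!d) b (j, y) b')) =
      edge a.1 a'.1 * edge b.1 b'.1 := by
  simp only [List.mem_cons, List.not_mem_nil, or_false, forall_eq_or_imp, forall_eq] at hp
  obtain ⟨⟨a1, a2⟩, ⟨c1, c2⟩, ⟨b1, b2⟩, e1, e2⟩ := hp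
  simp only [integrals_cons, integrals_nil]
  cases pos <;> cases d <;>
    simp only [CrossingType.value, crossing, leg, cond_true, cond_false, vertex_revFst,
      vertex_revSnd, Bool.not_true, Bool.not_false]
  · have := (β.cancels_crossingType false).revSnd.integral_start_start (x := x) (y := y)
      hij ⟨a1, c1, e1, b1⟩ ⟨a2, c2, e2, b2⟩ ha hb.symm
      (show (β.crossingType false).ok x a.2 b'.2 y from hok)
    simpa only [vertex_revSnd, edge_comm b.1, Bool.not_false] using this
  · exact (β.cancels_crossingType false).integral_start_start (x := x) (y := y)
      hij ⟨a1, c1, b1, e1⟩ ⟨a2, c2, b2, e2⟩ ha hb hok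
  · have := (β.cancels_crossingType true).revFst.integral_start_start (x := x) (y := y)
      hij ⟨a1, c1, e1, b1⟩ ⟨a2, c2, e2, b2⟩ ha hb.symm
      (show (β.crossingType true).ok a.2 x y b'.2 from hok)
    simpa only [vertex_revFst, edge_comm b.1, Bool.not_true] using this
  · have := (β.cancels_crossingType true).revFst.revSnd.integral_start_start (x := x) (y := y)
      hij ⟨a1, c1, b1, e1⟩ ⟨a2, c2, b2, e2⟩ ha hb
      (show (β.crossingType true).ok a.2 x b.2 y from hok)
    simpa only [vertex_revFst, vertex_revSnd, Bool.not_true] using this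

theorem ok_bigon_iff {pos d : Bool} {a a' b b' m n : ℕ × X} (ha : a'.2 = a.2) (hb : b'.2 = b.2) :
    (β.crossing !pos).Ok (leg false a m a') (leg (!d) b n b') ↔
      (β.crossing pos).Ok (leg true a m a') (leg d b n b') := by
  cases pos <;> cases d <;>
    simp [CrossingType.Ok, crossing, leg, crossingType, revFst, revSnd, ha, hb]

/-- The outer colors at both crossings solve the same relation `ok` with the same inner colors, and
by regularity the solution is unique. -/
theorem colors_eq_of_bigon {pos d : Bool} {a a' b b' m n : ℕ × X}
    (h : (β.crossing pos).Ok (leg true a m a') (leg d b n b'))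
    (h' : (β.crossing !pos).Ok (leg false a m a') (leg (!d) b n b')) :
    a'.2 = a.2 ∧ b'.2 = b.2 := by
  have reg := β.regular_crossingType true
  cases pos <;> cases d
  · have := (reg.start_end _ _).unique (y₁ := (a.2, b'.2)) (y₂ := (a'.2, b.2)) h h'
    exact ⟨(Prod.mk.inj this).1.symm, (Prod.mk.inj this).2⟩
  · have := (reg.start_start _ _).unique (y₁ := (a.2, b.2)) (y₂ := (a'.2, b'.2)) h h'
    exact ⟨(Prod.mk.inj this).1.symm, (Prod.mk.inj this).2.symm⟩
  · have := (reg.end_start _ _).unique (y₁ := (a.2, b'.2)) (y₂ := (a'.2, b.2)) h h'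
    exact ⟨(Prod.mk.inj this).1.symm, (Prod.mk.inj this).2⟩
  · have := (reg.end_end _ _).unique (y₁ := (a.2, b.2)) (y₂ := (a'.2, b'.2)) h h'
    exact ⟨(Prod.mk.inj this).1.symm, (Prod.mk.inj this).2.symm⟩

theorem existsUnique_bigon (pos d : Bool) (a a' b b' : ℕ × X) (i j : ℕ) :
    ∃! q : X × X, (β.crossing pos).Ok (leg true a (i, q.1) a') (leg d b (j, q.2) b') := by
  cases d
  · exact (β.regular_crossing pos).start_end a.2 b'.2
  · exact (β.regular_crossing pos).start_start a.2 b.2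

/-- A kink contributes nothing. -/
theorem integral_kink {pos d : Bool} {i : ℕ} {x : X} {a a' : ℕ × X} (ha : a.1 ≠ i) (ha' : a'.1 ≠ i)
    (hc : a'.2 = a.2) (hok : (β.crossing pos).Ok (leg d a (i, x) a') (leg (!d) a (i, x) a')) :
    integral β.δ i ((β.crossing pos).value (leg d a (i, x) a') (leg (!d) a (i, x) a')) =
      edge a.1 a'.1 := by
  -- The axioms for the first move, divided by their left-hand sides: a normalized kink has weight
  -- one.
  have h1 : ∀ y, β.δ * β.weight true Smoothing.vertical y y
      + β.weight true Smoothing.horizontal y y + β.weight true Smoothing.virt y y = 1 := fun y => by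
    simp only [weight, coeff, if_true]
    linear_combination β.ω.inv_mul - ((β.ω⁻¹ : Rˣ) : R) * β.r1_pos y
  have h2 : ∀ y, β.δ * β.weight false Smoothing.vertical y y
      + β.weight false Smoothing.horizontal y y + β.weight false Smoothing.virt y y = 1 :=
    fun y => by
      simp only [weight, coeff, if_false, Bool.false_eq_true]
      linear_combination β.ω.inv_mul - (β.ω : R) * β.r1_neg y
  cases pos <;> cases d <;>
    simp only [CrossingType.value, crossing, leg, cond_true, cond_false, vertex_revFst,
      vertex_revSnd, Bool.not_true, Bool.not_false] <;>
    simp only [vertex, crossingType, hc] <;>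
    first
    | rw [integral_joint_loop _ _ _ ha ha', h1, map_one, one_mul]
    | rw [integral_joint_loop _ _ _ ha ha', h2, map_one, one_mul]
    | rw [integral_joint_loop _ _ _ ha' ha, h1, map_one, one_mul, edge_comm]
    | rw [joint_flip, integral_joint_loop _ _ _ ha ha', h1, map_one, one_mul]
    | rw [joint_flip, integral_joint_loop _ _ _ ha' ha, h2, map_one, one_mul, edge_comm]

/-- For two of the four kinks the loop carries both arguments of the crossing and `under_self`
suffices; for the other two the outer ends carry them and `eq_of_under_eq_over` is needed. -/
theorem colors_eq_of_kink {pos d : Bool} {m a a' : ℕ × X}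
    (h : (β.crossing pos).Ok (leg d a m a') (leg (!d) a m a')) : a'.2 = a.2 := by
  cases pos <;> cases d <;> obtain ⟨h₁, h₂⟩ := h
  · exact Biquandle.eq_of_under_eq_over (h₂.symm.trans h₁)
  · exact h₁.trans ((Biquandle.under_self _).symm.trans h₂.symm)
  · exact h₂.trans ((Biquandle.under_self _).trans h₁.symm)
  · exact (Biquandle.eq_of_under_eq_over (h₂.symm.trans h₁)).symm

/-- The color of the loop is either computed from the outer color, or it is the element `s` with `s
▷ᵤ s` equal to the outer color. The latter comes from surjectivity of the sideways map at `(a.2,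
a.2)`, whose preimage is diagonal by `eq_of_under_eq_over`. -/
theorem existsUnique_kink (pos d : Bool) {a a' : ℕ × X} (hc : a'.2 = a.2) (i : ℕ) :
    ∃! x : X, (β.crossing pos).Ok (leg d a (i, x) a') (leg (!d) a (i, x) a') := by
  obtain ⟨⟨s, t⟩, h⟩ := Biquandle.side_bijective.2 (a.2, a.2)
  obtain ⟨h₁, h₂⟩ : t ▷ₒ s = a.2 ∧ s ▷ᵤ t = a.2 := Prod.mk.inj h
  obtain rfl := Biquandle.eq_of_under_eq_over (h₂.trans h₁.symm)
  have hs : ∀ x, a.2 = x ▷ₒ x → a.2 = x ▷ᵤ x → x = s := fun x k₁ k₂ => by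
    have : (x, x) = (s, s) := Biquandle.side_bijective.1 <| by
      change (x ▷ₒ x, x ▷ᵤ x) = (s ▷ₒ s, s ▷ᵤ s)
      rw [← k₁, ← k₂, h₁, h₂]
    exact (Prod.mk.inj this).1
  have hu := Biquandle.under_self a.2
  cases pos <;> cases d
  · exact ⟨a.2 ▷ₒ a'.2, ⟨rfl, by simp [leg, hc, hu]⟩, fun x k => k.1⟩
  · exact ⟨s, ⟨by simp [leg, hc, h₁], h₂.symm⟩, fun x k => hs x (hc.symm.trans k.1) k.2⟩
  · exact ⟨s, ⟨h₁.symm, by simp [leg, hc, h₂]⟩, fun x k => hs x k.1 (hc.symm.trans k.2)⟩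
  · exact ⟨a'.2 ▷ₒ a.2, ⟨rfl, by simp [leg, hc, hu]⟩, fun x k => k.1⟩

end VirtualBracket

/-! ### The state sum as an integral -/

namespace Joins

/-- All points below `n` are cut off. -/
def cutBelow (n : ℕ) (E : Joins) : Joins where
  r x y := x = y ∨ (n ≤ x ∧ n ≤ y ∧ E.Rel x y)
  iseqv := by
    refine ⟨fun x => Or.inl rfl, ?_, ?_⟩
    · rintro x y (rfl | ⟨h1, h2, h3⟩)
      · exact Or.inl rfl
      · exact Or.inr ⟨h2, h1, h3.symm⟩
    · rintro x y z (rfl | ⟨h1, h2, h3⟩) (rfl | ⟨h4, h5, h6⟩)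
      · exact Or.inl rfl
      · exact Or.inr ⟨h4, h5, h6⟩
      · exact Or.inr ⟨h1, h2, h3⟩
      · exact Or.inr ⟨h1, h5, h3.trans h6⟩

theorem cutBelow_rel {n : ℕ} {E : Joins} {x y : ℕ} :
    (cutBelow n E).Rel x y ↔ x = y ∨ (n ≤ x ∧ n ≤ y ∧ E.Rel x y) := Iff.rfl

open Classical in
/-- The least points of the classes that consist of points below `n`. -/
noncomputable def leastPoints (n : ℕ) (E : Joins) : Finset ℕ :=
  (Finset.range n).filter fun m => ∀ y, E.Rel m y → m ≤ y ∧ y < n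

theorem mem_leastPoints {n m : ℕ} {E : Joins} :
    m ∈ leastPoints n E ↔ m < n ∧ ∀ y, E.Rel m y → m ≤ y ∧ y < n := by
  simp [leastPoints]

end Joins

namespace StateRing

variable {R : Type*} [CommRing R] {δ : R}

/-- The largest point is removed first, so a class of points below `n` vanishes together with its
least point, which is isolated by then and gives the factor `δ`. Classes reaching beyond `n` never
vanish. -/
theorem integrals_range_single (n : ℕ) (E : Joins) (r : R) :
    integrals δ (List.range n) (MonoidAlgebra.single E r) =
      MonoidAlgebra.single (E.cutBelow n) (r * δ ^ (E.leastPoints n).card) := by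
  classical
  induction n generalizing E r with
  | zero =>
    have h1 : E.cutBelow 0 = E := Joins.ext fun x y => by
      rw [Joins.cutBelow_rel]
      exact ⟨fun h => h.elim (fun h => h ▸ Joins.Rel.refl _ _) fun h => h.2.2,
        fun h => Or.inr ⟨Nat.zero_le _, Nat.zero_le _, h⟩⟩
    simp [h1, Joins.leastPoints]
  | succ n ih =>
    rw [List.range_succ, integrals_append, integrals_cons, integrals_nil, integral_single, ih]
    have h1 : (E.cut n).cutBelow n = E.cutBelow (n + 1) := Joins.ext fun x y => by
      simp only [Joins.cutBelow_rel, Joins.cut_rel]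
      constructor
      · rintro (h | ⟨h1, h2, h | ⟨h3, h4, h5⟩⟩)
        · exact Or.inl h
        · exact Or.inl h
        · exact Or.inr ⟨by omega, by omega, h5⟩
      · rintro (h | ⟨h1, h2, h3⟩)
        · exact Or.inl h
        · exact Or.inr ⟨by omega, by omega, Or.inr ⟨by omega, by omega, h3⟩⟩
    have h2 : (E.cut n).leastPoints n = (E.leastPoints (n + 1)).erase n := by
      ext m
      simp only [Joins.mem_leastPoints, Joins.cut_rel, Finset.mem_erase]
      constructor
      · rintro ⟨h1, h2⟩
        refine ⟨by omega, by omega, fun y hy => ?_⟩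
        by_cases hyn : y = n
        · omega
        · have := h2 y (Or.inr ⟨by omega, hyn, hy⟩); omega
      · rintro ⟨h1, h2, h3⟩
        refine ⟨by omega, ?_⟩
        rintro y (rfl | ⟨h4, h5, h6⟩)
        · omega
        · have := h3 y h6; omega
    have h3 : n ∈ E.leastPoints (n + 1) ↔ E.Isolated n := by
      rw [Joins.mem_leastPoints]
      constructor
      · rintro ⟨-, h⟩ y hy
        have := h y hy; omega
      · intro h
        refine ⟨by omega, fun y hy => ?_⟩
        have := h y hy; omega
    rw [h1, h2]
    by_cases hE : E.Isolated n
    · rw [if_pos hE, ← Finset.card_erase_add_one (h3.2 hE), pow_succ]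
      congr 1; ring
    · rw [if_neg hE, Finset.erase_eq_of_notMem fun h => hE (h3.1 h), mul_one]

end StateRing

/-! ### Located passes -/

/-- A passage together with the incoming and the outgoing semi-arc, with their colors. -/
abbrev LocatedPass (X : Type*) := Pass × Leg X

/-- The passages of a code, whose semi-arcs are numbered starting from `n`. -/
def locate {X : Type*} (F : ℕ → X) : ℕ → List Pass → List (LocatedPass X)
  | _, [] => []
  | n, p :: l => (p, ((n, F n), (n + 1, F (n + 1)))) :: locate F (n + 1) l

section locate

variable {X : Type*} (F : ℕ → X)

theorem locate_append (n : ℕ) (l l' : List Pass) :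
    locate F n (l ++ l') = locate F n l ++ locate F (n + l.length) l' := by
  induction l generalizing n with
  | nil => simp [locate]
  | cons p l ih => simp [locate, ih, add_assoc, add_comm 1]

theorem locate_eq_ofFn (n : ℕ) (l : List Pass) : locate F n l = List.ofFn fun i : Fin l.length =>
    (l[i], ((n + i, F (n + i)), (n + i + 1, F (n + i + 1)))) := by
  induction l generalizing n with
  | nil => simp [locate]
  | cons p l ih => simp [locate, ih, List.ofFn_succ, add_assoc, add_comm 1]

theorem mem_locate {w : List Pass} {a : LocatedPass X} : a ∈ locate F 0 w ↔
    ∃ i : Fin w.length, a = (w[i], (((i : ℕ), F i), ((i : ℕ) + 1, F (i + 1)))) := by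
  simp [locate_eq_ofFn, List.mem_ofFn, eq_comm]

end locate

/-- The first passage is over the second one at a common crossing. -/
def Over {X : Type*} (o u : LocatedPass X) : Prop :=
  o.1.level = Level.upper ∧ u.1.level = Level.lower ∧ o.1.label = u.1.label

instance {X : Type*} (o u : LocatedPass X) : Decidable (Over o u) :=
  inferInstanceAs (Decidable (_ ∧ _ ∧ _))

/-! ### Colored codes as products in the state ring, and their state sums. -/

namespace VirtualBracket

open StateRing CrossingType

variable {X R : Type*} [Biquandle X] [CommRing R] (β : VirtualBracket X R)

/-- The admissible colors of located passages. -/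
def Colored (L : List (LocatedPass X)) : Prop :=
  (∀ a ∈ L, a.1.level = Level.virt → a.2.2.2 = a.2.1.2) ∧
    ∀ o ∈ L, ∀ u ∈ L, Over o u → (β.crossing o.1.toLeft).Ok u.2 o.2

noncomputable def passValue (a : LocatedPass X) : StateRing R :=
  if a.1.level = Level.virt then edge a.2.1.1 a.2.2.1 else 1

noncomputable def pairValue (o u : LocatedPass X) : StateRing R :=
  if Over o u then (β.crossing o.1.toLeft).value u.2 o.2 else 1

/-- The product of the contributions of all crossings. -/
noncomputable def diagram (L : List (LocatedPass X)) : StateRing R :=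
  (L.map passValue).prod * (L.map fun o => (L.map fun u => β.pairValue o u).prod).prod

/-- The joins of the ends of a crossing in a smoothing. -/
def smoothJoins : Smoothing → Leg X → Leg X → Joins
  | Smoothing.vertical, u, o => Joins.pair o.1.1 u.2.1 * Joins.pair u.1.1 o.2.1
  | Smoothing.horizontal, u, o => Joins.pair o.1.1 u.1.1 * Joins.pair o.2.1 u.2.1
  | Smoothing.virt, u, o => Joins.pair o.1.1 o.2.1 * Joins.pair u.1.1 u.2.1

/-- At a negative crossing both strands are reversed twice, so vertical and horizontal smoothings
keep their meaning; only the semi-arcs that carry `x` and `y` change. -/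
theorem value_crossing (pos : Bool) (u o : Leg X) : (β.crossing pos).value u o =
    ∑ s : Smoothing, MonoidAlgebra.single (smoothJoins s u o)
      (β.weight pos s (if pos then u.1.2 else u.2.2) (if pos then o.2.2 else o.1.2)) := by
  have hsum : ∀ f : Smoothing → StateRing R, ∑ s : Smoothing, f s =
      f Smoothing.vertical + f Smoothing.horizontal + f Smoothing.virt := fun f => by
    change f Smoothing.vertical + (f Smoothing.horizontal + (f Smoothing.virt + 0)) = _
    ring
  have hsingle : ∀ (p q p' q' : ℕ) (r : R),
      MonoidAlgebra.single (Joins.pair p q * Joins.pair p' q') r =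
        algebraMap R (StateRing R) r * (edge p q * edge p' q') := fun p q p' q' r => by
    rw [edge, edge, MonoidAlgebra.single_mul_single, ← Algebra.smul_def]
    simp
  rw [hsum]
  simp only [smoothJoins, hsingle]
  cases pos <;>
    simp only [CrossingType.value, crossing, cond_true, cond_false, vertex_revFst, vertex_revSnd,
      if_true, if_false, Bool.false_eq_true] <;>
    simp only [vertex, crossingType, joint]
  · simp only [edge_comm u.2.1 o.1.1, edge_comm u.2.1 o.2.1, edge_comm u.1.1 o.1.1,
      edge_comm u.2.1 u.1.1, edge_comm o.2.1 o.1.1]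
    ring
  · simp only [edge_comm u.2.1 o.1.1, edge_comm u.2.1 o.2.1, edge_comm u.1.1 o.1.1]
    ring

section stateSum

variable (F : ℕ → X) (w : List Pass)

/-- The `i`-th passage of a code. -/
def located (i : Fin w.length) : LocatedPass X := (w[i], (((i : ℕ), F i), ((i : ℕ) + 1, F (i + 1))))

/-- In the product over all ordered pairs of passages, exactly the classical crossings give
non-trivial factors. Pairs are used in `diagram` so that it is insensitive to the order of the list.
-/
theorem diagram_locate : β.diagram (locate F 0 w) =
    (∏ i, passValue (located F w i)) *
      ∏ c : Crossing w, (β.crossing c.isPositive).value (located F w c.underPass).2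
        (located F w c.overPass).2 := by
  have h : locate F 0 w = List.ofFn (located F w) := by
    rw [locate_eq_ofFn]; simp only [zero_add]; rfl
  simp only [diagram, h, List.map_ofFn, List.prod_ofFn, Function.comp_apply]
  congr 1
  rw [← Fintype.prod_prod_type' fun i j => β.pairValue (located F w i) (located F w j)]
  refine Eq.trans ?_ (Finset.prod_coe_sort (classicalCrossings w) fun c =>
    (β.crossing w[c.1].toLeft).value (located F w c.2).2 (located F w c.1).2).symm
  rw [classicalCrossings, Finset.prod_filter]
  rfl

theorem colored_locate : IsColoring w (fun i : SemiArc w => F i) ↔ β.Colored (locate F 0 w) := by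
  have h : locate F 0 w = List.ofFn (located F w) := by
    rw [locate_eq_ofFn]; simp only [zero_add]; rfl
  rw [Colored, h, IsColoring, and_comm]
  simp only [List.forall_mem_ofFn_iff]
  refine and_congr Iff.rfl ?_
  have key : ∀ c : Crossing w, (β.crossing w[c.1.1].toLeft).Ok (located F w c.1.2).2
      (located F w c.1.1).2 ↔ (c.xNext (fun i : SemiArc w => F i) = c.x (fun i : SemiArc w => F i) ▷ᵤ
        c.y (fun i : SemiArc w => F i) ∧ c.yNext (fun i : SemiArc w => F i) =
        c.y (fun i : SemiArc w => F i) ▷ₒ c.x (fun i : SemiArc w => F i)) := by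
    intro c
    have hpos : c.isPositive = w[c.1.1].toLeft := rfl
    simp only [Crossing.xNext, Crossing.yNext, Crossing.x, Crossing.y, hpos]
    generalize w[c.1.1].toLeft = pos
    cases pos
    · exact and_comm
    · exact and_comm
  constructor
  · intro h i j hij
    exact (key ⟨(i, j), Finset.mem_filter.2 ⟨Finset.mem_univ _, hij⟩⟩).2 (h _)
  · intro h c
    exact (key c).1 (h c.1.1 c.1.2 (Finset.mem_filter.1 c.2).2)

/-- The joins of the semi-arcs in a state. -/
noncomputable def stateJoins (S : KnotoidState w) : Joins :=
  (∏ i : Fin w.length, if w[i].level = Level.virt then Joins.pair i (i + 1) else 1) *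
    ∏ c : Crossing w, smoothJoins (S c) (located F w c.underPass).2 (located F w c.overPass).2

variable {F w}

-- Both relations are generated by the same pairs of semi-arcs. The extra alternative `x = y`
-- accounts for the numbers that are not semi-arcs, each of which stays alone.
omit [Biquandle X] in
theorem stateJoins_rel (S : KnotoidState w) {x y : ℕ} : (stateJoins F w S).Rel x y ↔ x = y ∨
    ∃ (hx : x < w.length + 1) (hy : y < w.length + 1),
      Quot.mk S.Join (⟨x, hx⟩ : SemiArc w) = Quot.mk S.Join ⟨y, hy⟩ := by
  constructor
  · let G : Joins :=
      { r := fun x y => x = y ∨ ∃ (hx : x < w.length + 1) (hy : y < w.length + 1),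
          Quot.mk S.Join (⟨x, hx⟩ : SemiArc w) = Quot.mk S.Join ⟨y, hy⟩
        iseqv := by
          refine ⟨fun x => Or.inl rfl, ?_, ?_⟩
          · rintro x y (rfl | ⟨h1, h2, h3⟩)
            · exact Or.inl rfl
            · exact Or.inr ⟨h2, h1, h3.symm⟩
          · rintro x y z (rfl | ⟨h1, h2, h3⟩) (rfl | ⟨h4, h5, h6⟩)
            · exact Or.inl rfl
            · exact Or.inr ⟨h4, h5, h6⟩
            · exact Or.inr ⟨h1, h2, h3⟩
            · exact Or.inr ⟨h1, h5, h3.trans h6⟩ }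
    have hG : ∀ {a b : SemiArc w}, S.Join a b → G.Rel a b := fun {a b} h =>
      Or.inr ⟨a.2, b.2, Quot.sound h⟩
    suffices Joins.Within (stateJoins F w S) G from this x y
    rw [stateJoins, Joins.mul_within, Joins.prod_within, Joins.prod_within]
    constructor
    · intro i _
      split_ifs with hi
      · exact Joins.pair_within.2 (hG (.through i hi))
      · exact Joins.one_within
    · intro c _
      rcases hc : S c with _ | _ | _ <;>
        simp only [smoothJoins, Joins.mul_within, Joins.pair_within]
      · exact ⟨hG (.vertical_left c hc), hG (.vertical_right c hc)⟩
      · exact ⟨hG (.horizontal_in c hc), hG (.horizontal_out c hc)⟩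
      · exact ⟨hG (.virt_over c hc), hG (.virt_under c hc)⟩
  · rintro (rfl | ⟨hx, hy, h⟩)
    · exact Joins.Rel.refl _ _
    · have hle := Joins.within_refl (E := stateJoins F w S)
      rw [stateJoins, Joins.mul_within, Joins.prod_within, Joins.prod_within] at hle
      obtain ⟨h1, h2⟩ := hle
      have key : ∀ a b : SemiArc w, Relation.EqvGen S.Join a b → (stateJoins F w S).Rel a b := by
        intro a b hab
        induction hab with
        | refl a => exact Joins.Rel.refl _ _
        | symm a b _ ih => exact ih.symm
        | trans a b c _ _ ih ih' => exact ih.trans ih'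
        | rel a b hab =>
          have h3 := fun c => h2 c (Finset.mem_univ c)
          cases hab with
          | through i hi =>
            have := h1 i (Finset.mem_univ i)
            rw [if_pos hi, Joins.pair_within] at this
            exact this
          | vertical_left c hc | horizontal_in c hc | virt_over c hc =>
            have := h3 c
            simp only [hc, smoothJoins, Joins.mul_within, Joins.pair_within] at this
            exact this.1
          | vertical_right c hc | horizontal_out c hc | virt_under c hc =>
            have := h3 c
            simp only [hc, smoothJoins, Joins.mul_within, Joins.pair_within] at this
            exact this.2
      exact key _ _ (Quot.eqvGen_exact h)

-- Each component is counted by its least semi-arc.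
omit [Biquandle X] in
theorem card_leastPoints_stateJoins (S : KnotoidState w) :
    ((stateJoins F w S).leastPoints (w.length + 1)).card = S.componentCount := by
  classical
  rw [KnotoidState.componentCount, ← Fintype.card_coe, ← Nat.card_eq_fintype_card]
  let φ : {m // m ∈ (stateJoins F w S).leastPoints (w.length + 1)} → Quot S.Join := fun m =>
    Quot.mk _ ⟨m.1, (Joins.mem_leastPoints.1 m.2).1⟩
  refine Nat.card_eq_of_bijective φ ⟨?_, ?_⟩
  · rintro ⟨m, hm⟩ ⟨n, hn⟩ h
    have h1 : (stateJoins F w S).Rel m n := (stateJoins_rel S).2 (Or.inr ⟨_, _, h⟩)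
    have h2 := ((Joins.mem_leastPoints.1 hm).2 n h1).1
    have h3 := ((Joins.mem_leastPoints.1 hn).2 m h1.symm).1
    exact Subtype.ext (le_antisymm h2 h3)
  · intro q
    obtain ⟨⟨x, hx⟩, rfl⟩ := Quot.exists_rep q
    have hex : ∃ m, (stateJoins F w S).Rel x m := ⟨x, Joins.Rel.refl _ _⟩
    have hm := Nat.find_spec hex
    have hmin : ∀ y, (stateJoins F w S).Rel (Nat.find hex) y → Nat.find hex ≤ y := fun y hy =>
      Nat.find_min' hex (hm.trans hy)
    have hmem : Nat.find hex ∈ (stateJoins F w S).leastPoints (w.length + 1) := by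
      rw [Joins.mem_leastPoints]
      have hlt : ∀ y, (stateJoins F w S).Rel x y → y < w.length + 1 := fun y hy => by
        rcases (stateJoins_rel S).1 hy with h | ⟨-, h, -⟩
        · omega
        · exact h
      exact ⟨hlt _ hm, fun y hy => ⟨hmin y hy, hlt y (hm.trans hy)⟩⟩
    refine ⟨⟨_, hmem⟩, ?_⟩
    rcases (stateJoins_rel S).1 hm with h | ⟨_, _, h⟩
    · simp only [φ]; congr 2; exact h.symm
    · exact h.symm

variable (F w)

/-- The state sum of a code with colored semi-arcs. -/
noncomputable def stateSum : R := ∑ S : KnotoidState w, β.stateValue (fun i : SemiArc w => F i) S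

/-- The bridge between the local calculus and the state sum: a choice of one pairing at each
crossing is a state, deleting all `w.length + 1` semi-arcs counts its components, and the
normalizing units multiply to the writhe factor. -/
theorem integrals_diagram : integrals β.δ (List.range (w.length + 1)) (β.diagram (locate F 0 w)) =
    algebraMap R (StateRing R) (β.stateSum F w) := by
  classical
  have hω : ∏ c : Crossing w, (if c.isPositive then β.ω⁻¹ else β.ω) = β.ω ^ (-writhe w) := by
    rw [writhe]
    induction (Finset.univ : Finset (Crossing w)) using Finset.induction_on with
    | empty => simp
    | insert a s ha ih =>
      rw [Finset.prod_insert ha, Finset.sum_insert ha, neg_add, zpow_add, ih]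
      congr 1
      split_ifs <;> simp
  have hpass : ∀ i, (passValue (located F w i) : StateRing R) = MonoidAlgebra.single
      (if w[i].level = Level.virt then Joins.pair i (i + 1) else 1) 1 := fun i => by
    rw [passValue]
    change (if w[i].level = Level.virt then _ else _) = _
    split_ifs
    · rfl
    · rw [MonoidAlgebra.one_def]
  rw [diagram_locate]
  simp only [value_crossing, hpass, MonoidAlgebra.prod_single, Finset.prod_const_one]
  -- Distributing the product over crossings over the sums over smoothings gives a sum over states.
  rw [Finset.prod_univ_sum, Fintype.piFinset_univ, Finset.mul_sum]
  simp only [MonoidAlgebra.prod_single, MonoidAlgebra.single_mul_single, one_mul]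
  have hsum : ∀ (s : Finset (KnotoidState w)) (f : KnotoidState w → StateRing R) l,
      integrals β.δ l (∑ S ∈ s, f S) = ∑ S ∈ s, integrals β.δ l (f S) := fun s f l => by
    induction l with
    | nil => rfl
    | cons m l ih => simp only [integrals_cons, ih, map_sum]
  rw [hsum, stateSum, map_sum]
  refine Finset.sum_congr rfl fun S _ => ?_
  have hE : (∏ i : Fin w.length, if w[i].level = Level.virt then Joins.pair i (i + 1) else 1) *
    ∏ c : Crossing w, smoothJoins (S c) (located F w c.underPass).2 (located F w c.overPass).2 =
      stateJoins F w S := rfl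
  rw [hE, integrals_range_single, card_leastPoints_stateJoins]
  have hcut : (stateJoins F w S).cutBelow (w.length + 1) = 1 := Joins.ext fun x y => by
    rw [Joins.cutBelow_rel, Joins.one_rel]
    refine ⟨?_, Or.inl⟩
    rintro (h | ⟨h1, h2, h3⟩)
    · exact h
    · rcases (stateJoins_rel S).1 h3 with h | ⟨h, -, -⟩
      · exact h
      · omega
  rw [hcut]
  change MonoidAlgebra.single 1 _ = MonoidAlgebra.single 1 _
  congr 1
  rw [stateValue, ← hω, Units.coe_prod]
  simp only [weight, Finset.prod_mul_distrib]
  have hc : ∀ c : Crossing w, β.coeff c.isPositive (S c)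
      (if c.isPositive then (located F w c.underPass).2.1.2 else (located F w c.underPass).2.2.2)
      (if c.isPositive then (located F w c.overPass).2.2.2 else (located F w c.overPass).2.1.2) =
      β.coeff c.isPositive (S c) (c.x fun i : SemiArc w => F i) (c.y fun i : SemiArc w => F i) :=
    fun c => rfl
  simp only [hc, Algebra.algebraMap_self_apply]
  ring

end stateSum

end VirtualBracket

/-! ### Renaming of points and insertion of virtual passages -/

namespace Joins

/-- Renaming of points. -/
def rename (σ : Equiv.Perm ℕ) (E : Joins) : Joins := Setoid.comap σ.symm E

theorem rename_rel {σ : Equiv.Perm ℕ} {E : Joins} {x y : ℕ} :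
    (rename σ E).Rel x y ↔ E.Rel (σ.symm x) (σ.symm y) := Iff.rfl

theorem rename_within {σ : Equiv.Perm ℕ} {E G : Joins} :
    Within (rename σ E) G ↔ Within E (rename σ.symm G) := by
  constructor
  · intro h x y hxy
    exact h _ _ (by simpa [rename_rel] using hxy)
  · intro h x y hxy
    simpa [rename_rel] using h _ _ hxy

theorem rename_pair (σ : Equiv.Perm ℕ) (p q : ℕ) : rename σ (pair p q) = pair (σ p) (σ q) := by
  apply Within.antisymm
  · rw [rename_within, pair_within]
    exact pair_rel
  · rw [pair_within, rename_rel]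
    simpa using pair_rel

/-- Renaming of points as a homomorphism. -/
def renameHom (σ : Equiv.Perm ℕ) : Joins →* Joins where
  toFun := rename σ
  map_one' := ext fun x y => by simp [rename_rel, one_rel]
  map_mul' E F := by
    apply Within.antisymm
    · rw [rename_within, mul_within, ← rename_within, ← rename_within]
      exact ⟨within_mul_left, within_mul_right⟩
    · rw [mul_within, rename_within, rename_within]
      have h : ∀ {A B : Joins}, Within A B → Within A (rename σ.symm (rename σ B)) :=
        fun h x y hxy => by simpa [rename_rel] using h x y hxy
      exact ⟨h within_mul_left, h within_mul_right⟩

theorem cut_rename (σ : Equiv.Perm ℕ) (m : ℕ) (E : Joins) :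
    cut (σ m) (rename σ E) = rename σ (cut m E) := ext fun x y => by
  simp only [cut_rel, rename_rel, σ.symm.injective.eq_iff, ne_eq, Equiv.symm_apply_eq]

theorem isolated_rename (σ : Equiv.Perm ℕ) (m : ℕ) (E : Joins) :
    Isolated (σ m) (rename σ E) ↔ Isolated m E := by
  simp only [Isolated, rename_rel, Equiv.symm_apply_apply]
  constructor
  · intro h y hy
    exact σ.injective (h (σ y) (by simpa using hy))
  · intro h y hy
    rw [← h _ hy, Equiv.apply_symm_apply]

end Joins

namespace StateRing

variable {R : Type*} [CommRing R] {δ : R}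

/-- Renaming of points. -/
noncomputable def rename (σ : Equiv.Perm ℕ) : StateRing R →ₐ[R] StateRing R :=
  MonoidAlgebra.mapDomainAlgHom R R (Joins.renameHom σ)

theorem rename_single (σ : Equiv.Perm ℕ) (E : Joins) (r : R) :
    rename σ (MonoidAlgebra.single E r) = MonoidAlgebra.single (E.rename σ) r := by
  simp [rename, Joins.renameHom]

theorem rename_edge (σ : Equiv.Perm ℕ) (p q : ℕ) :
    rename σ (edge p q : StateRing R) = edge (σ p) (σ q) := by
  rw [edge, rename_single, Joins.rename_pair, edge]

theorem rename_integral (σ : Equiv.Perm ℕ) (m : ℕ) (x : StateRing R) :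
    rename σ (integral δ m x) = integral δ (σ m) (rename σ x) := by
  classical
  induction x using MonoidAlgebra.induction_linear with
  | zero => simp
  | add f g hf hg => simp [hf, hg]
  | single E r =>
    simp only [integral_single, rename_single, Joins.cut_rename]
    rw [if_congr (Joins.isolated_rename σ m E) rfl rfl]

theorem rename_integrals (σ : Equiv.Perm ℕ) (l : List ℕ) (x : StateRing R) :
    rename σ (integrals δ l x) = integrals δ (l.map σ) (rename σ x) := by
  induction l with
  | nil => rfl
  | cons m l ih => simp [rename_integral, ih]

theorem rename_joint (σ : Equiv.Perm ℕ) (kA kB kV : R) (a b c d : ℕ) :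
    rename σ (joint kA kB kV a b c d) = joint kA kB kV (σ a) (σ b) (σ c) (σ d) := by
  simp only [joint, map_add, map_mul, rename_edge, AlgHom.commutes]

theorem mul_list_prod_congr {ι : Type*} (e : StateRing R) (l : List ι) (f g : ι → StateRing R)
    (h : ∀ i ∈ l, e * f i = e * g i) : e * (l.map f).prod = e * (l.map g).prod := by
  induction l with
  | nil => rfl
  | cons i l ih =>
    rw [List.map_cons, List.prod_cons, List.map_cons, List.prod_cons, ← mul_assoc, h i (by simp),
      mul_right_comm, ih fun k hk => h k (by simp [hk]), mul_right_comm, mul_assoc]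

end StateRing

/-- Change of the points of a located pass. -/
def moveTo {X : Type*} (s : ℕ → ℕ) (a : LocatedPass X) : LocatedPass X :=
  (a.1, ((s a.2.1.1, a.2.1.2), (s a.2.2.1, a.2.2.2)))

theorem map_moveTo_locate {X : Type*} {F G : ℕ → X} {s t : ℕ → ℕ} (n k : ℕ) (l : List Pass)
    (h : ∀ i, n ≤ i → i ≤ n + l.length → s i = t (i + k) ∧ F i = G (i + k)) :
    (locate F n l).map (moveTo s) = (locate G (n + k) l).map (moveTo t) := by
  induction l generalizing n with
  | nil => rfl
  | cons p l ih =>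
    rw [List.length_cons] at h
    have h1 := h n le_rfl (by omega)
    have h2 := h (n + 1) (by omega) (by omega)
    rw [add_right_comm] at h2
    simp only [locate, List.map_cons, moveTo, h1.1, h1.2, h2.1, h2.2]
    congr 1
    have := ih (n + 1) fun i hi hi' => h i (by omega) (by omega)
    rwa [add_right_comm] at this

namespace VirtualBracket

open StateRing CrossingType

variable {X R : Type*} [Biquandle X] [CommRing R] (β : VirtualBracket X R)

theorem colored_perm {L L' : List (LocatedPass X)} (h : L.Perm L') :
    β.Colored L ↔ β.Colored L' := by
  simp only [Colored, h.mem_iff]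

theorem diagram_perm {L L' : List (LocatedPass X)} (h : L.Perm L') : β.diagram L = β.diagram L' := by
  rw [diagram, diagram, (h.map _).prod_eq, (h.map _).prod_eq]
  have : ∀ o, (L.map fun u => β.pairValue o u).prod = (L'.map fun u => β.pairValue o u).prod :=
    fun o => (h.map _).prod_eq
  simp only [this]

/-- There are no crossings of passages of one list with passages of the other list. -/
def Apart (L L' : List (LocatedPass X)) : Prop := ∀ a ∈ L, ∀ b ∈ L', ¬ Over a b ∧ ¬ Over b a

theorem colored_append {L L' : List (LocatedPass X)} (h : Apart L L') :
    β.Colored (L ++ L') ↔ β.Colored L ∧ β.Colored L' := by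
  simp only [Colored, List.mem_append]
  constructor
  · rintro ⟨h1, h2⟩
    exact ⟨⟨fun a ha => h1 a (Or.inl ha), fun o ho u hu => h2 o (Or.inl ho) u (Or.inl hu)⟩,
      fun a ha => h1 a (Or.inr ha), fun o ho u hu => h2 o (Or.inr ho) u (Or.inr hu)⟩
  · rintro ⟨⟨h1, h2⟩, h3, h4⟩
    refine ⟨fun a ha => ha.elim (h1 a) (h3 a), ?_⟩
    rintro o (ho | ho) u (hu | hu) hou
    · exact h2 o ho u hu hou
    · exact ((h o ho u hu).1 hou).elim
    · exact ((h u hu o ho).2 hou).elim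
    · exact h4 o ho u hu hou

/-- All mixed pairs contribute the factor one. This is what splits a diagram into the inside and the
outside of a disk. -/
theorem diagram_append {L L' : List (LocatedPass X)} (h : Apart L L') :
    β.diagram (L ++ L') = β.diagram L * β.diagram L' := by
  have h1 : ∀ o ∈ L, (L'.map fun u => β.pairValue o u).prod = 1 := fun o ho =>
    List.prod_eq_one fun x hx => by
      obtain ⟨u, hu, rfl⟩ := List.mem_map.1 hx
      exact if_neg (h o ho u hu).1
  have h2 : ∀ o ∈ L', (L.map fun u => β.pairValue o u).prod = 1 := fun o ho =>
    List.prod_eq_one fun x hx => by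
      obtain ⟨u, hu, rfl⟩ := List.mem_map.1 hx
      exact if_neg (h u hu o ho).2
  simp only [diagram, List.map_append, List.prod_append]
  have h3 : (L.map fun o => (L.map fun u => β.pairValue o u).prod *
      (L'.map fun u => β.pairValue o u).prod) = L.map fun o => (L.map fun u => β.pairValue o u).prod :=
    List.map_congr_left fun o ho => by rw [h1 o ho, mul_one]
  have h4 : (L'.map fun o => (L.map fun u => β.pairValue o u).prod *
      (L'.map fun u => β.pairValue o u).prod) =
      L'.map fun o => (L'.map fun u => β.pairValue o u).prod :=
    List.map_congr_left fun o ho => by rw [h2 o ho, one_mul]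
  rw [h3, h4]
  ring

theorem colored_map_moveTo (s : ℕ → ℕ) (L : List (LocatedPass X)) :
    β.Colored (L.map (moveTo s)) ↔ β.Colored L := by
  simp only [Colored, List.forall_mem_map]
  rfl

theorem rename_diagram (σ : Equiv.Perm ℕ) (L : List (LocatedPass X)) :
    rename σ (β.diagram L) = β.diagram (L.map (moveTo σ)) := by
  have h1 : ∀ a : LocatedPass X, rename σ (passValue a : StateRing R) = passValue (moveTo σ a) := by
    intro a
    rw [passValue, passValue, apply_ite (rename σ), rename_edge, map_one]; rfl
  have h2 : ∀ o u : LocatedPass X, rename σ (β.pairValue o u) =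
      β.pairValue (moveTo σ o) (moveTo σ u) := by
    intro o u
    rw [pairValue, pairValue, apply_ite (rename σ), map_one, CrossingType.value, vertex,
      rename_joint]; rfl
  simp only [diagram, map_mul, map_list_prod, List.map_map, Function.comp_def, h1, h2]

/-- In the presence of an edge from `m` to `p`, the point `m` can be replaced by `p`. -/
theorem edge_mul_diagram (m p : ℕ) (L : List (LocatedPass X)) :
    edge m p * β.diagram L = edge m p * β.diagram (L.map (moveTo (Function.update id m p))) := by
  have hs : ∀ n, n ≠ m → Function.update id m p n = n := fun n hn => Function.update_of_ne hn _ _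
  have hm : Function.update id m p m = p := Function.update_self ..
  have he : ∀ a b : ℕ, (edge m p * edge a b : StateRing R) =
      edge m p * edge (Function.update id m p a) (Function.update id m p b) := by
    have he' : ∀ a b : ℕ, (edge m p * edge a b : StateRing R) =
        edge m p * edge (Function.update id m p a) b := fun a b => by
      by_cases ha : a = m
      · rw [ha, hm, edge_mul_edge]
      · rw [hs a ha]
    intro a b
    rw [he' a b, edge_comm _ b, he' b, edge_comm (Function.update id m p b)]
  have hj : ∀ (kA kB kV : R) (a b c d : ℕ), edge m p * joint kA kB kV a b c d =
      edge m p * joint kA kB kV (Function.update id m p a) (Function.update id m p b)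
        (Function.update id m p c) (Function.update id m p d) := by
    have hj' : ∀ (kA kB kV : R) (a b c d : ℕ), edge m p * joint kA kB kV a b c d =
        edge m p * joint kA kB kV (Function.update id m p a) b c d := fun kA kB kV a b c d => by
      by_cases ha : a = m
      · rw [ha, hm, edge_mul_joint₁]
      · rw [hs a ha]
    intro kA kB kV a b c d
    rw [hj', joint_flip, hj', joint_flip, joint_swap, hj', joint_flip, hj', joint_flip, joint_swap]
  have h1 : ∀ a : LocatedPass X, edge m p * (passValue a : StateRing R) =
      edge m p * passValue (moveTo (Function.update id m p) a) := fun a => by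
    by_cases ha : a.1.level = Level.virt
    · rw [passValue, passValue, if_pos ha, if_pos (show (moveTo _ a).1.level = _ from ha), he]
      rfl
    · rw [passValue, passValue, if_neg ha, if_neg (show ¬ (moveTo _ a).1.level = _ from ha)]
  have h2 : ∀ o u : LocatedPass X, edge m p * β.pairValue o u =
      edge m p * β.pairValue (moveTo (Function.update id m p) o)
        (moveTo (Function.update id m p) u) := fun o u => by
    by_cases hou : Over o u
    · rw [pairValue, pairValue, if_pos hou, if_pos (show Over (moveTo _ o) (moveTo _ u) from hou),
        CrossingType.value, CrossingType.value, vertex, vertex, hj]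
      rfl
    · rw [pairValue, pairValue, if_neg hou, if_neg (show ¬ Over (moveTo _ o) (moveTo _ u) from hou)]
  simp only [diagram, List.map_map, Function.comp_def]
  rw [← mul_assoc, mul_list_prod_congr _ _ _ _ fun a _ => h1 a, mul_right_comm,
    mul_list_prod_congr _ _ _ _ fun o _ => mul_list_prod_congr _ _ _ _ fun u _ => h2 o u]
  ring

theorem free_diagram {m : ℕ} {L : List (LocatedPass X)}
    (h : ∀ a ∈ L, a.2.1.1 ≠ m ∧ a.2.2.1 ≠ m) : Free β.δ m (β.diagram L) := by
  refine (Free.list_prod fun g hg => ?_).mul (Free.list_prod fun g hg => ?_)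
  · obtain ⟨a, ha, rfl⟩ := List.mem_map.1 hg
    rw [passValue]
    split_ifs
    · exact Free.edge (h a ha).1 (h a ha).2
    · exact Free.one
  · obtain ⟨o, ho, rfl⟩ := List.mem_map.1 hg
    refine Free.list_prod fun g hg => ?_
    obtain ⟨u, hu, rfl⟩ := List.mem_map.1 hg
    rw [pairValue]
    split_ifs
    · exact free_vertex (h u hu).1 (h u hu).2 (h o ho).1 (h o ho).2
    · exact Free.one

/-- The code `W` arises from `w` by insertion of virtual passages, and the semi-arc `j` of `W` is a
part of the semi-arc `c j` of `w`. -/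
structure Expands (w W : List Pass) (c : ℕ → ℕ) : Prop where
  zero : c 0 = 0
  length : c W.length = w.length
  le : ∀ j ≤ W.length, c j ≤ w.length
  colored : ∀ F : ℕ → X, β.Colored (locate F 0 w) → β.Colored (locate (F ∘ c) 0 W)
  exists_colored : ∀ G : ℕ → X, β.Colored (locate G 0 W) →
    ∃ F : ℕ → X, β.Colored (locate F 0 w) ∧ G = F ∘ c
  stateSum_eq : ∀ F : ℕ → X, β.stateSum F w = β.stateSum (F ∘ c) W

theorem Expands.trans {w W W' : List Pass} {c c' : ℕ → ℕ} (h : β.Expands w W c)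
    (h' : β.Expands W W' c') : β.Expands w W' (c ∘ c') where
  zero := by rw [Function.comp, h'.zero, h.zero]
  length := by rw [Function.comp, h'.length, h.length]
  le j hj := h.le _ (h'.le j hj)
  colored F hF := h'.colored _ (h.colored F hF)
  exists_colored G hG := by
    obtain ⟨F', h1, rfl⟩ := h'.exists_colored G hG
    obtain ⟨F, h2, rfl⟩ := h.exists_colored F' h1
    exact ⟨F, h2, rfl⟩
  stateSum_eq F := (h.stateSum_eq F).trans (h'.stateSum_eq _)

theorem algebraMap_stateRing_injective : Function.Injective (algebraMap R (StateRing R)) :=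
  fun r s h => by
    have : (MonoidAlgebra.single 1 r : StateRing R) = MonoidAlgebra.single 1 s := h
    simpa using this

/-- The renaming of the points when a passage is inserted after `a` of `n` passages. -/
def insertPerm (a n : ℕ) (h : a ≤ n) : Equiv.Perm ℕ where
  toFun i := if i ≤ a then i else if i ≤ n then i + 1 else if i = n + 1 then a + 1 else i
  invFun i := if i ≤ a then i else if i = a + 1 then n + 1 else if i ≤ n + 1 then i - 1 else i
  left_inv i := by dsimp only; split_ifs <;> omega
  right_inv i := by dsimp only; split_ifs <;> omega

/-- A virtual passage only subdivides a semi-arc: it forces equal colors and contributes an edge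
from `a + 1` to `a`, which vanishes with the deletion of `a + 1`. The passage needs no partner, so
the longer list need not be a code. -/
theorem expands_insert (l₀ l₁ : List Pass) (d : Pass) (hd : d.level = Level.virt) :
    β.Expands (l₀ ++ l₁) (l₀ ++ [d] ++ l₁) fun j => if j ≤ l₀.length then j else j - 1 := by
  let c : ℕ → ℕ := fun j => if j ≤ l₀.length then j else j - 1
  set a := l₀.length with ha
  let D : ∀ G : ℕ → X, LocatedPass X := fun G => (d, ((a, G a), (a + 1, G (a + 1))))
  let L : ∀ G : ℕ → X, List (LocatedPass X) := fun G => locate G 0 l₀ ++ locate G (a + 1) l₁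
  have hperm : ∀ G : ℕ → X, (locate G 0 (l₀ ++ [d] ++ l₁)).Perm ([D G] ++ L G) := fun G => by
    rw [locate_append, locate_append, List.append_assoc, List.length_append, zero_add, ← ha]
    rw [← List.append_assoc]
    refine (List.perm_append_comm.append_right _).trans ?_
    rw [List.append_assoc]
    simp only [locate, List.length_singleton, D, L, zero_add]
    exact List.Perm.refl _
  have hapart : ∀ G : ℕ → X, Apart [D G] (L G) := by
    intro G x hx y hy
    obtain rfl := List.mem_singleton.1 hx
    simp [Over, D, hd]
  have hlen : (l₀ ++ [d] ++ l₁).length = (l₀ ++ l₁).length + 1 := by simp; omega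
  have hlen' : (l₀ ++ l₁).length = a + l₁.length := by simp [ha]
  let σ : Equiv.Perm ℕ := insertPerm a (l₀ ++ l₁).length (by omega)
  have hσ : ∀ i, i ≤ (l₀ ++ l₁).length → σ i = if i ≤ a then i else i + 1 := fun i hi => by
    change (if _ then _ else _) = _
    split_ifs <;> rfl
  have hc : ∀ i, c i = if i ≤ a then i else i - 1 := fun i => rfl
  -- The passages of the short list, renumbered to leave the number `a + 1` free, are those of the
  -- long list with `a + 1` identified with `a`.
  have hmove : ∀ F : ℕ → X, (locate F 0 (l₀ ++ l₁)).map (moveTo σ) =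
      (L (F ∘ c)).map (moveTo (Function.update id (a + 1) a)) := fun F => by
    rw [locate_append, List.map_append, List.map_append, zero_add, ← ha]
    congr 1
    · refine map_moveTo_locate 0 0 l₀ fun i _ hi => ?_
      rw [← ha] at hi
      rw [hσ i (by omega), if_pos (by omega), Function.comp, hc, if_pos (by omega),
        Function.update_of_ne (by omega)]
      exact ⟨rfl, rfl⟩
    · refine map_moveTo_locate a 1 l₁ fun i hi hi' => ?_
      have hci : c (i + 1) = i := by rw [hc, if_neg (by omega), Nat.add_sub_cancel]
      rw [hσ i (by omega), Function.comp, hci]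
      refine ⟨?_, rfl⟩
      by_cases h : i = a
      · rw [h, if_pos le_rfl, Function.update_self]
      · rw [if_neg (by omega), Function.update_of_ne (by omega)]; rfl
  have hcolor : ∀ F : ℕ → X, β.Colored (locate F 0 (l₀ ++ l₁)) ↔ β.Colored (L (F ∘ c)) := fun F => by
    rw [← β.colored_map_moveTo σ, hmove, colored_map_moveTo]
  have hD : ∀ G : ℕ → X, β.Colored [D G] ↔ G (a + 1) = G a := fun G => by
    simp [Colored, D, hd, Over]
  refine ⟨by simp, ?_, ?_, fun F hF => ?_, fun G hG => ?_, fun F => ?_⟩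
  · change c _ = _
    rw [hc, if_neg (by omega)]; omega
  · intro j hj
    change c j ≤ _
    rw [hc]; split_ifs <;> omega
  · rw [colored_perm β (hperm _), colored_append β (hapart _)]
    refine ⟨(hD _).2 ?_, (hcolor F).1 hF⟩
    change F (c (a + 1)) = F (c a)
    rw [hc, hc, if_neg (by omega), if_pos le_rfl, Nat.add_sub_cancel]
  · rw [colored_perm β (hperm _), colored_append β (hapart _), hD] at hG
    have hF : G = (fun i => G (if i ≤ a then i else i + 1)) ∘ c := by
      funext j
      simp only [Function.comp, hc]
      by_cases hj : j ≤ a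
      · rw [if_pos hj, if_pos hj]
      · rw [if_neg hj]
        by_cases hj' : j = a + 1
        · rw [hj', Nat.add_sub_cancel, if_pos le_rfl, hG.1]
        · rw [if_neg (by omega), Nat.sub_add_cancel (by omega)]
    refine ⟨_, (hcolor _).2 ?_, hF⟩
    rw [← hF]
    exact hG.2
  · apply algebraMap_stateRing_injective
    change _ = algebraMap R _ (β.stateSum (F ∘ c) _)
    rw [← integrals_diagram, ← integrals_diagram, diagram_perm β (hperm _),
      diagram_append β (hapart _), hlen]
    set n := (l₀ ++ l₁).length with hn
    have hrange : (List.range (n + 1 + 1)).Perm ((List.range (n + 1)).map σ ++ [a + 1]) := by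
      have hnodup : ((List.range (n + 1)).map σ ++ [a + 1]).Nodup := by
        rw [List.nodup_append]
        refine ⟨List.nodup_range.map σ.injective, List.nodup_singleton _, ?_⟩
        intro x hx y hy
        obtain ⟨i, hi, rfl⟩ := List.mem_map.1 hx
        rw [List.mem_range] at hi
        rw [List.mem_singleton.1 hy, hσ i (by omega)]
        split_ifs <;> omega
      rw [List.perm_ext_iff_of_nodup List.nodup_range hnodup]
      intro x
      simp only [List.mem_append, List.mem_map, List.mem_range, List.mem_singleton]
      constructor
      · intro hx
        by_cases h1 : x ≤ a
        · exact Or.inl ⟨x, by omega, by rw [hσ x (by omega), if_pos h1]⟩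
        · by_cases h2 : x = a + 1
          · exact Or.inr h2
          · exact Or.inl ⟨x - 1, by omega, by rw [hσ _ (by omega), if_neg (by omega)]; omega⟩
      · rintro (⟨i, hi, rfl⟩ | rfl)
        · rw [hσ i (by omega)]; split_ifs <;> omega
        · omega
    have hDval : (β.diagram [D (F ∘ c)] : StateRing R) = edge (a + 1) a := by
      simp [diagram, passValue, pairValue, D, hd, Over, edge_comm]
    have hfree : Free β.δ (a + 1)
        (β.diagram ((L (F ∘ c)).map (moveTo (Function.update id (a + 1) a)))) := by
      refine β.free_diagram fun x hx => ?_
      obtain ⟨y, -, rfl⟩ := List.mem_map.1 hx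
      have : ∀ k, Function.update id (a + 1) a k ≠ a + 1 := fun k => by
        by_cases hk : k = a + 1
        · rw [hk, Function.update_self]; omega
        · rw [Function.update_of_ne hk]; exact hk
      exact ⟨this _, this _⟩
    rw [integrals_perm hrange, integrals_append, integrals_cons, integrals_nil, hDval,
      edge_mul_diagram, hfree.integral_edge_mul (by omega), ← hmove, ← rename_diagram,
      ← rename_integrals, integrals_diagram, AlgHom.commutes]

end VirtualBracket

/-! ### Exchange of pairs of consecutive passages -/

theorem locate_congr {X : Type*} {F G : ℕ → X} {n : ℕ} {l : List Pass}
    (h : ∀ k, n ≤ k → k ≤ n + l.length → F k = G k) : locate F n l = locate G n l := by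
  induction l generalizing n with
  | nil => rfl
  | cons p l ih =>
    rw [List.length_cons] at h
    rw [locate, locate, h n le_rfl (by omega), h (n + 1) (by omega) (by omega),
      ih fun k hk hk' => h k (by omega) (by omega)]

theorem bounds_of_mem_locate {X : Type*} {F : ℕ → X} {n : ℕ} {l : List Pass} {a : LocatedPass X}
    (h : a ∈ locate F n l) :
    n ≤ a.2.1.1 ∧ a.2.2.1 = a.2.1.1 + 1 ∧ a.2.2.1 ≤ n + l.length := by
  induction l generalizing n with
  | nil => simp [locate] at h
  | cons p l ih =>
    rw [locate, List.mem_cons] at h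
    rw [List.length_cons]
    rcases h with rfl | h
    · exact ⟨le_rfl, rfl, by dsimp only; omega⟩
    · have := ih h; omega

theorem map_start_locate {X : Type*} (F : ℕ → X) (n : ℕ) (l : List Pass) :
    (locate F n l).map (fun a => a.2.1.1) = List.range' n l.length := by
  induction l generalizing n with
  | nil => rfl
  | cons p l ih => simp [locate, ih, List.range'_succ]

/-- The semi-arc before or after the inner point of a strand with two passages. -/
def strandLeg {X : Type*} (F : ℕ → X) (n : ℕ) (first : Bool) : Leg X :=
  leg first (n, F n) (n + 1, F (n + 1)) (n + 2, F (n + 2))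

/-- A code, into which pairs of passages are inserted at given places. -/
def fill {ι : Type*} (P : ι → Bool → Pass) (bs : List (List Pass × ι)) (t : List Pass) :
    List Pass :=
  bs.foldr (fun b r => b.1 ++ [P b.2 true, P b.2 false] ++ r) t

/-- The places of the inserted pairs. -/
def starts {ι : Type*} : ℕ → List (List Pass × ι) → List (ℕ × ι)
  | _, [] => []
  | n, b :: bs => (n + b.1.length, b.2) :: starts (n + b.1.length + 2) bs

/-- The semi-arcs between the passages of inserted pairs. -/
def middles {ι : Type*} (c : List (ℕ × ι)) : List ℕ := c.map fun s => s.1 + 1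

/-- The passages outside of the inserted pairs. -/
def keptPasses {X ι : Type*} (F : ℕ → X) : ℕ → List (List Pass × ι) → List Pass → List (LocatedPass X)
  | n, [], t => locate F n t
  | n, b :: bs, t => locate F n b.1 ++ keptPasses F (n + b.1.length + 2) bs t

/-- The passages of the inserted pairs. -/
def insertedPasses {X ι : Type*} (F : ℕ → X) (P : ι → Bool → Pass) (c : List (ℕ × ι)) :
    List (LocatedPass X) :=
  c.flatMap fun s => [(P s.2 true, strandLeg F s.1 true), (P s.2 false, strandLeg F s.1 false)]

section fill

variable {X ι : Type*} {P : ι → Bool → Pass} {F G : ℕ → X} {n : ℕ} {bs : List (List Pass × ι)}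
  {t : List Pass}

theorem fill_cons (b : List Pass × ι) :
    fill P (b :: bs) t = b.1 ++ [P b.2 true, P b.2 false] ++ fill P bs t := rfl

theorem length_fill (P P' : ι → Bool → Pass) : (fill P bs t).length = (fill P' bs t).length := by
  induction bs with
  | nil => rfl
  | cons b bs ih => simp [fill_cons, ih]

theorem locate_fill_perm (F : ℕ → X) (P : ι → Bool → Pass) (n : ℕ) :
    (locate F n (fill P bs t)).Perm (keptPasses F n bs t ++ insertedPasses F P (starts n bs)) := by
  induction bs generalizing n with
  | nil => simp [fill, keptPasses, insertedPasses, starts]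
  | cons b bs ih =>
    rw [fill_cons, locate_append, locate_append, keptPasses, starts, insertedPasses, List.flatMap_cons,
      List.append_assoc, List.append_assoc]
    refine List.Perm.append_left _ ?_
    rw [List.length_append, ← add_assoc]
    refine ((ih (n + b.1.length + 2)).append_left _).trans ?_
    rw [← List.append_assoc, ← List.append_assoc]
    exact List.perm_append_comm.append_right _

theorem bounds_of_mem_middles {k : ℕ} (h : k ∈ middles (starts n bs)) (P : ι → Bool → Pass)
    (t : List Pass) : n < k ∧ k < n + (fill P bs t).length := by
  induction bs generalizing n with
  | nil => simp [starts, middles] at h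
  | cons b bs ih =>
    rw [fill_cons]
    simp only [starts, middles, List.map_cons, List.mem_cons] at h
    simp only [List.length_append, List.length_cons, List.length_nil]
    rcases h with rfl | h
    · omega
    · have := ih h; omega

theorem nodup_middles : (middles (starts n bs)).Nodup := by
  induction bs generalizing n with
  | nil => simp [starts, middles]
  | cons b bs ih =>
    simp only [starts, middles, List.map_cons, List.nodup_cons]
    refine ⟨fun h => ?_, ih⟩
    have := bounds_of_mem_middles h (fun _ _ => ⟨0, Level.virt, true⟩) []
    omega

theorem notMem_middles_of_mem_keptPasses {a : LocatedPass X} (h : a ∈ keptPasses F n bs t) :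
    n ≤ a.2.1.1 ∧ a.2.1.1 ∉ middles (starts n bs) ∧ a.2.2.1 ∉ middles (starts n bs) := by
  induction bs generalizing n with
  | nil => exact ⟨(bounds_of_mem_locate h).1, by simp [starts, middles], by simp [starts, middles]⟩
  | cons b bs ih =>
    have hm : ∀ k ∈ middles (starts (n + b.1.length + 2) bs), n + b.1.length + 2 < k := fun k hk =>
      (bounds_of_mem_middles hk (fun _ _ => ⟨0, Level.virt, true⟩) []).1
    have hd : a.2.2.1 = a.2.1.1 + 1 := by
      have : a ∈ locate F n (fill (fun _ _ => ⟨0, Level.virt, true⟩) (b :: bs) t) :=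
        (locate_fill_perm F _ n).mem_iff.2 (List.mem_append_left _ h)
      exact (bounds_of_mem_locate this).2.1
    rw [keptPasses, List.mem_append] at h
    have hmid : middles (starts n (b :: bs)) =
      (n + b.1.length + 1) :: middles (starts (n + b.1.length + 2) bs) := rfl
    rw [hmid, List.mem_cons, List.mem_cons]
    rcases h with h | h
    · have := bounds_of_mem_locate h
      refine ⟨by omega, ?_, ?_⟩ <;> rintro (h' | h')
      · omega
      · have := hm _ h'; omega
      · omega
      · have := hm _ h'; omega
    · have := ih h
      refine ⟨by omega, ?_, ?_⟩ <;> rintro (h' | h')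
      · omega
      · exact this.2.1 h'
      · omega
      · exact this.2.2 h'

theorem keptPasses_congr (h : ∀ k, n ≤ k → k ∉ middles (starts n bs) → F k = G k) :
    keptPasses F n bs t = keptPasses G n bs t := by
  induction bs generalizing n with
  | nil => exact locate_congr fun k hk _ => h k hk (by simp [starts, middles])
  | cons b bs ih =>
    have hm : ∀ k ∈ middles (starts (n + b.1.length + 2) bs), n + b.1.length + 2 < k := fun k hk =>
      (bounds_of_mem_middles hk (fun _ _ => ⟨0, Level.virt, true⟩) []).1
    have hmid : middles (starts n (b :: bs)) =
      (n + b.1.length + 1) :: middles (starts (n + b.1.length + 2) bs) := rfl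
    rw [hmid] at h
    rw [keptPasses, keptPasses, locate_congr fun k hk hk' => h k hk fun h' => ?_, ih fun k hk hk' =>
      h k (by omega) fun h' => ?_]
    · rcases List.mem_cons.1 h' with h' | h'
      · omega
      · exact hk' h'
    · rcases List.mem_cons.1 h' with h' | h'
      · omega
      · have := hm k h'; omega

theorem fits_of_isCode {w : List Pass} (hw : IsCode w) {a b : LocatedPass X}
    (ha : a ∈ locate F 0 w) (hb : b ∈ locate F 0 w) (hl : b.1.label = a.1.label)
    (hs : b.2.1.1 ≠ a.2.1.1) : a.1.Fits b.1 := by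
  obtain ⟨i, rfl⟩ := (mem_locate F).1 ha
  obtain ⟨j, rfl⟩ := (mem_locate F).1 hb
  exact (hw i).2 j (fun h => hs (by rw [h])) hl

theorem start_eq_of_isCode {w : List Pass} (hw : IsCode w) {a b c : LocatedPass X}
    (ha : a ∈ locate F 0 w) (hb : b ∈ locate F 0 w) (hc : c ∈ locate F 0 w)
    (hab : b.1.label = a.1.label) (hac : c.1.label = a.1.label) (hs : b.2.1.1 ≠ a.2.1.1)
    (hs' : c.2.1.1 ≠ a.2.1.1) : b.2.1.1 = c.2.1.1 := by
  obtain ⟨i, rfl⟩ := (mem_locate F).1 ha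
  obtain ⟨j, rfl⟩ := (mem_locate F).1 hb
  obtain ⟨k, rfl⟩ := (mem_locate F).1 hc
  have := (hw i).1.unique (y₁ := j) (y₂ := k) ⟨fun h => hs (by rw [h]), hab⟩
    ⟨fun h => hs' (by rw [h]), hac⟩
  rw [this]

theorem mem_insertedPasses {c : List (ℕ × ι)} {a : LocatedPass X} : a ∈ insertedPasses F P c ↔
    ∃ s ∈ c, ∃ e : Bool, a = (P s.2 e, strandLeg F s.1 e) := by
  simp [insertedPasses, or_comm]

theorem strandLeg_start (n : ℕ) (e : Bool) : (strandLeg F n e).1.1 = bif e then n else n + 1 := by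
  cases e <;> rfl

variable (P) in
/-- Every classical crossing of the inserted pairs is passed twice by them. -/
def Saturated (c : List (ℕ × ι)) : Prop :=
  ∀ s ∈ c, ∀ e : Bool, (P s.2 e).level = Level.virt ∨ ∃ s' ∈ c, ∃ e' : Bool,
    (P s'.2 e').label = (P s.2 e).label ∧
      (bif e' then s'.1 else s'.1 + 1) ≠ bif e then s.1 else s.1 + 1

/-- If a kept passage shared a classical crossing with an inserted one, that crossing would be
passed three times. -/
theorem Saturated.apart (h : Saturated P (starts 0 bs)) (hw : IsCode (fill P bs t)) (F : ℕ → X) :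
    VirtualBracket.Apart (keptPasses F 0 bs t) (insertedPasses F P (starts 0 bs)) := by
  intro a ha b hb
  have hperm := locate_fill_perm (t := t) (bs := bs) F P 0
  have hnodup : ((keptPasses F 0 bs t ++ insertedPasses F P (starts 0 bs)).map
      fun a => a.2.1.1).Nodup := by
    rw [← (hperm.map _).nodup_iff, map_start_locate]
    exact List.nodup_range'
  rw [List.map_append, List.nodup_append] at hnodup
  have hne : ∀ b ∈ insertedPasses F P (starts 0 bs), b.2.1.1 ≠ a.2.1.1 := fun b hb h =>
    hnodup.2.2 _ (List.mem_map_of_mem ha) _ (List.mem_map_of_mem hb) h.symm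
  have hmem : ∀ b ∈ insertedPasses F P (starts 0 bs), b ∈ locate F 0 (fill P bs t) := fun b hb =>
    hperm.mem_iff.2 (List.mem_append_right _ hb)
  have ha' : a ∈ locate F 0 (fill P bs t) := hperm.mem_iff.2 (List.mem_append_left _ ha)
  obtain ⟨s, hs, e, rfl⟩ := mem_insertedPasses.1 hb
  rcases h s hs e with hv | ⟨s', hs', e', hl, hne'⟩
  · simp [Over, hv]
  · have hb' := (mem_insertedPasses (F := F) (P := P)).2 ⟨s', hs', e', rfl⟩
    have key : (P s.2 e).label ≠ a.1.label := fun hab => hne' <| by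
      have := start_eq_of_isCode hw ha' (hmem _ hb') (hmem _ hb) (hl.trans hab) hab (hne _ hb')
        (hne _ hb)
      simpa only [strandLeg_start] using this
    exact ⟨fun h => key h.2.2.symm, fun h => key h.2.2⟩

end fill

/-! ### Comparison of the colorings and state sums of two codes. -/

namespace VirtualBracket

open StateRing CrossingType

variable {X R ι : Type*} [Biquandle X] [CommRing R] (β : VirtualBracket X R)

/-- The locality principle: the points in `I` are deleted first, and the outside part `L`, which
does not touch them, passes through these deletions. -/
theorem stateSum_eq_of_integrals {w w' : List Pass} {F F' : ℕ → X} {L S S' : List (LocatedPass X)}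
    {I : List ℕ} (hlen : w'.length = w.length) (h : (locate F 0 w).Perm (L ++ S))
    (h' : (locate F' 0 w').Perm (L ++ S')) (hA : Apart L S) (hA' : Apart L S') (hI : I.Nodup)
    (hIw : ∀ k ∈ I, k ≤ w.length) (hL : ∀ a ∈ L, a.2.1.1 ∉ I ∧ a.2.2.1 ∉ I)
    (heq : integrals β.δ I (β.diagram S) = integrals β.δ I (β.diagram S')) :
    β.stateSum F w = β.stateSum F' w' := by
  have hrange : (List.range (w.length + 1)).Perm
      ((List.range (w.length + 1)).filter (· ∉ I) ++ I) := by
    rw [List.perm_ext_iff_of_nodup List.nodup_range]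
    · intro k
      simp only [List.mem_append, List.mem_filter, decide_eq_true_eq, List.mem_range]
      by_cases hk : k ∈ I
      · have := hIw k hk
        simp only [hk, or_true, iff_true]; omega
      · simp [hk]
    · rw [List.nodup_append]
      refine ⟨List.nodup_range.filter _, hI, fun x hx y hy hxy => ?_⟩
      rw [List.mem_filter] at hx
      subst hxy
      simp [hy] at hx
  have hfree : ∀ m ∈ I, Free β.δ m (β.diagram L) := fun m hm => β.free_diagram fun a ha =>
    ⟨fun h => (hL a ha).1 (h ▸ hm), fun h => (hL a ha).2 (h ▸ hm)⟩
  apply algebraMap_stateRing_injective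
  rw [← integrals_diagram, ← integrals_diagram, hlen, integrals_perm hrange, integrals_perm hrange,
    integrals_append, integrals_append, diagram_perm β h, diagram_perm β h', diagram_append β hA,
    diagram_append β hA', integrals_mul hfree, integrals_mul hfree, heq]

/-- Every coloring of the first pairs of passages corresponds to a coloring of the second ones. -/
def PairsCorrespond (c : List (ℕ × ι)) (P P' : ι → Bool → Pass) : Prop :=
  ∀ F : ℕ → X, β.Colored (insertedPasses F P c) → ∃ F' : ℕ → X,
    (∀ k, k ∉ middles c → F' k = F k) ∧ β.Colored (insertedPasses F' P' c) ∧
    integrals β.δ (middles c) (β.diagram (insertedPasses F P c)) =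
      integrals β.δ (middles c) (β.diagram (insertedPasses F' P' c))

/-- The colors inside of pairs of passages are determined by the colors outside. -/
def PairsDetermined (c : List (ℕ × ι)) (P : ι → Bool → Pass) : Prop :=
  ∀ F G : ℕ → X, (∀ k, k ∉ middles c → F k = G k) → β.Colored (insertedPasses F P c) →
    β.Colored (insertedPasses G P c) → ∀ k ∈ middles c, F k = G k

/-- Every coloring of `w` extends uniquely to a coloring of `w'` with the same state sum, with the
same colors except on the semi-arcs in `I`. -/
structure Extends (w w' : List Pass) (I : List ℕ) : Prop where
  exists_coloring : ∀ F : ℕ → X, β.Colored (locate F 0 w) → ∃ F' : ℕ → X,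
    (∀ k, k ∉ I → F' k = F k) ∧ β.Colored (locate F' 0 w') ∧ β.stateSum F w = β.stateSum F' w'
  unique : ∀ F G : ℕ → X, (∀ k ≤ w'.length, k ∉ I → F k = G k) → β.Colored (locate F 0 w') →
    β.Colored (locate G 0 w') → ∀ k ≤ w'.length, F k = G k

theorem extends_fill {P P' : ι → Bool → Pass} {bs : List (List Pass × ι)} {t : List Pass}
    (hP : ∀ F : ℕ → X, Apart (keptPasses F 0 bs t) (insertedPasses F P (starts 0 bs)))
    (hP' : ∀ F : ℕ → X, Apart (keptPasses F 0 bs t) (insertedPasses F P' (starts 0 bs))) (h : β.PairsCorrespond (starts 0 bs) P P')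
    (h' : β.PairsDetermined (starts 0 bs) P') :
    β.Extends (fill P bs t) (fill P' bs t) (middles (starts 0 bs)) where
  exists_coloring F hF := by
    have hperm := locate_fill_perm (t := t) (bs := bs) F P 0
    rw [colored_perm β hperm, colored_append β (hP F)] at hF
    obtain ⟨F', h1, h2, h3⟩ := h F hF.2
    have hperm' := locate_fill_perm (t := t) (bs := bs) F' P' 0
    have hkept : keptPasses F' 0 bs t = keptPasses F 0 bs t :=
      keptPasses_congr fun k _ hk => h1 k hk
    have hA' := hP' F'
    rw [hkept] at hperm' hA'
    refine ⟨F', h1, ?_, ?_⟩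
    · rw [colored_perm β hperm', colored_append β hA']
      exact ⟨hF.1, h2⟩
    · refine β.stateSum_eq_of_integrals (length_fill _ _) hperm hperm' (hP F) hA'
        nodup_middles (fun k hk => ?_) (fun a ha => (notMem_middles_of_mem_keptPasses ha).2) h3
      have := bounds_of_mem_middles hk P t
      omega
  unique F G hFG hF hG k hk := by
    by_cases hkm : k ∈ middles (starts 0 bs)
    swap
    · exact hFG k hk hkm
    -- `PairsDetermined` asks for agreement at all numbers outside of `middles`, including those
    -- beyond the code, so `G` is adjusted there.
    let H : ℕ → X := fun k => if k ≤ (fill P' bs t).length then G k else F k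
    have hH : ∀ k ≤ (fill P' bs t).length, H k = G k := fun k hk => if_pos hk
    rw [← locate_congr fun k _ hk => hH k (by omega)] at hG
    rw [colored_perm β (locate_fill_perm _ _ _), colored_append β (hP' _)] at hF hG
    rw [← hH k hk]
    refine h' F H (fun k hk => ?_) hF.2 hG.2 k hkm
    by_cases hk' : k ≤ (fill P' bs t).length
    · rw [hH k hk', hFG k hk' hk]
    · exact (if_neg hk').symm

/-- The colorings of two codes correspond to each other with equal state sums, where `ρ` says which
semi-arcs have the same colors. -/
structure TransfersTo (w w' : List Pass) (ρ : ℕ → ℕ → Prop) : Prop where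
  tail : ρ 0 0
  head : ρ w.length w'.length
  exists_coloring : ∀ F : ℕ → X, β.Colored (locate F 0 w) → ∃ F' : ℕ → X,
    β.Colored (locate F' 0 w') ∧ (∀ i ≤ w.length, ∀ j ≤ w'.length, ρ i j → F i = F' j) ∧
      β.stateSum F w = β.stateSum F' w'
  unique : ∀ F F' G' : ℕ → X, β.Colored (locate F 0 w) → β.Colored (locate F' 0 w') →
    β.Colored (locate G' 0 w') → (∀ i ≤ w.length, ∀ j ≤ w'.length, ρ i j → F i = F' j) →
    (∀ i ≤ w.length, ∀ j ≤ w'.length, ρ i j → F i = G' j) → ∀ j ≤ w'.length, F' j = G' j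

/-- Transfer of colorings in both directions. -/
def Transfers (w w' : List Pass) (ρ : ℕ → ℕ → Prop) : Prop :=
  β.TransfersTo w w' ρ ∧ β.TransfersTo w' w fun i j => ρ j i

theorem Expands.refl (w : List Pass) : β.Expands w w id :=
  ⟨rfl, rfl, fun _ h => h, fun _ h => h, fun G h => ⟨G, h, rfl⟩, fun _ => rfl⟩

/-- The comparison goes from `w` to its subdivision `W` and from there to `W'`, which has the same
numbering of semi-arcs. In the relation `ρ` only the subdivision map `c` is left, away from the
inner semi-arcs `I`. -/
theorem Expands.transfers {w W W' : List Pass} {c : ℕ → ℕ} {I : List ℕ} {ρ : ℕ → ℕ → Prop}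
    (h : β.Expands w W c) (hlen : W'.length = W.length) (h₁ : β.Extends W W' I)
    (h₂ : β.Extends W' W I) (hI : 0 ∉ I ∧ W.length ∉ I)
    (hρ : ∀ i ≤ w.length, ∀ k ≤ W.length, ρ i k ↔ i = c k ∧ k ∉ I)
    (hc : ∀ i ≤ w.length, ∃ k ≤ W.length, c k = i) : β.Transfers w W' ρ := by
  have tail : ρ 0 0 := (hρ 0 (Nat.zero_le _) 0 (Nat.zero_le _)).2 ⟨h.zero.symm, hI.1⟩
  have head : ρ w.length W'.length := by
    rw [hlen]
    exact (hρ _ le_rfl _ le_rfl).2 ⟨h.length.symm, hI.2⟩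
  refine ⟨⟨tail, head, fun F hF => ?_, ?_⟩, ⟨tail, head, fun G hG => ?_, ?_⟩⟩
  · obtain ⟨F', k1, k2, k3⟩ := h₁.exists_coloring (F ∘ c) (h.colored F hF)
    refine ⟨F', k2, fun i hi j hj hij => ?_, (h.stateSum_eq F).trans k3⟩
    obtain ⟨rfl, hj'⟩ := (hρ i hi j (hlen ▸ hj)).1 hij
    exact (k1 j hj').symm
  · intro F F' G' _ hF' hG' hFF hFG
    refine h₁.unique F' G' (fun k hk hkI => ?_) hF' hG'
    have hle := h.le k (hlen ▸ hk)
    have hr := (hρ (c k) hle k (hlen ▸ hk)).2 ⟨rfl, hkI⟩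
    rw [← hFF _ hle k hk hr, ← hFG _ hle k hk hr]
  · obtain ⟨G', k1, k2, k3⟩ := h₂.exists_coloring G hG
    obtain ⟨F, hF, rfl⟩ := h.exists_colored G' k2
    refine ⟨F, hF, fun i hi j hj hij => ?_, k3.trans (h.stateSum_eq F).symm⟩
    obtain ⟨rfl, hi'⟩ := (hρ j hj i (hlen ▸ hi)).1 hij
    exact (k1 i hi').symm
  · intro G F F' _ hF hF' hGF hGF' i hi
    obtain ⟨k, hk, rfl⟩ := hc i hi
    refine h₂.unique (F ∘ c) (F' ∘ c) (fun k hk hkI => ?_) (h.colored F hF) (h.colored F' hF') k hk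
    have hle := h.le k hk
    have hr := (hρ (c k) hle k hk).2 ⟨rfl, hkI⟩
    exact (hGF k (hlen ▸ hk) _ hle hr).symm.trans (hGF' k (hlen ▸ hk) _ hle hr)

end VirtualBracket

/-! ### Local invariance -/

/-- The first pass is over the second one at a common crossing. -/
def Pass.IsOver (o u : Pass) : Prop :=
  o.level = Level.upper ∧ u.level = Level.lower ∧ o.label = u.label

namespace VirtualBracket

open StateRing CrossingType

variable {X R ι : Type*} [Biquandle X] [CommRing R] (β : VirtualBracket X R)

theorem colored_crossing_pair {o u : LocatedPass X} (h : o.1.IsOver u.1) :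
    β.Colored [o, u] ↔ (β.crossing o.1.toLeft).Ok u.2 o.2 := by
  obtain ⟨h1, h2, h3⟩ := h
  simp [Colored, Over, h1, h2, h3]

theorem diagram_crossing_pair {o u : LocatedPass X} (h : o.1.IsOver u.1) :
    β.diagram [o, u] = (β.crossing o.1.toLeft).value u.2 o.2 := by
  obtain ⟨h1, h2, h3⟩ := h
  simp [diagram, pairValue, passValue, Over, h1, h2, h3]

theorem colored_of_virt {L : List (LocatedPass X)} (h : ∀ a ∈ L, a.1.level = Level.virt) :
    β.Colored L ↔ ∀ a ∈ L, a.2.2.2 = a.2.1.2 := by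
  refine ⟨fun hL a ha => hL.1 a ha (h a ha), fun hL => ⟨fun a ha _ => hL a ha, ?_⟩⟩
  intro o ho u _ hou
  rw [Over, h o ho] at hou
  cases hou.1

theorem diagram_of_virt {L : List (LocatedPass X)} (h : ∀ a ∈ L, a.1.level = Level.virt) :
    β.diagram L = (L.map fun a => (edge a.2.1.1 a.2.2.1 : StateRing R)).prod := by
  have h1 : (L.map fun o => (L.map fun u => β.pairValue o u).prod).prod = 1 :=
    List.prod_eq_one fun x hx => by
      obtain ⟨o, ho, rfl⟩ := List.mem_map.1 hx
      refine List.prod_eq_one fun y hy => ?_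
      obtain ⟨u, -, rfl⟩ := List.mem_map.1 hy
      rw [pairValue, if_neg]
      rintro ⟨h', -⟩
      rw [h o ho] at h'
      cases h'
  rw [diagram, h1, mul_one, List.map_congr_left fun a ha => ?_]
  rw [passValue, if_pos (h a ha)]

omit [Biquandle X] in
theorem apart_of_virt {L L' : List (LocatedPass X)} (h : ∀ a ∈ L, a.1.level = Level.virt) :
    Apart L L' := by
  intro a ha b _
  simp [Over, h a ha]

omit [Biquandle X] in
theorem Apart.symm {L L' : List (LocatedPass X)} (h : Apart L L') : Apart L' L :=
  fun a ha b hb => (h b hb a ha).symm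

omit [Biquandle X] in
theorem level_virt_of_mem_insertedPasses {c : List (ℕ × ι)} {P : ι → Bool → Pass} {F : ℕ → X}
    (h : ∀ s ∈ c, ∀ e, (P s.2 e).level = Level.virt) {a : LocatedPass X}
    (ha : a ∈ insertedPasses F P c) : a.1.level = Level.virt := by
  obtain ⟨s, hs, e, rfl⟩ := mem_insertedPasses.1 ha
  exact h s hs e

/-- A virtual passage contributes the edge between its two semi-arcs, whatever the name of the
crossing; so the same colors serve both sides and the products coincide. -/
theorem pairsCorrespond_of_virt {c : List (ℕ × ι)} {P P' : ι → Bool → Pass}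
    (h : ∀ s ∈ c, ∀ e, (P s.2 e).level = Level.virt)
    (h' : ∀ s ∈ c, ∀ e, (P' s.2 e).level = Level.virt) : β.PairsCorrespond c P P' := by
  intro F hF
  refine ⟨F, fun _ _ => rfl, ?_, ?_⟩
  · rw [colored_of_virt β fun a ha => level_virt_of_mem_insertedPasses h ha] at hF
    rw [colored_of_virt β fun a ha => level_virt_of_mem_insertedPasses h' ha]
    intro a ha
    obtain ⟨s, hs, e, rfl⟩ := mem_insertedPasses.1 ha
    exact hF (P s.2 e, _) (mem_insertedPasses.2 ⟨s, hs, e, rfl⟩)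
  · rw [diagram_of_virt β fun a ha => level_virt_of_mem_insertedPasses h ha,
      diagram_of_virt β fun a ha => level_virt_of_mem_insertedPasses h' ha]
    simp only [insertedPasses, List.map_flatMap, List.map_cons, List.map_nil]

/-- One virtual passage in each pair is enough: it copies the color of an outer semi-arc to the
inner one. -/
theorem pairsDetermined_of_virt {c : List (ℕ × ι)} {P : ι → Bool → Pass}
    (hc : ∀ s ∈ c, s.1 ∉ middles c ∧ s.1 + 2 ∉ middles c)
    (h : ∀ s ∈ c, ∃ e, (P s.2 e).level = Level.virt) : β.PairsDetermined c P := by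
  intro F G hFG hF hG k hk
  obtain ⟨s, hs, rfl⟩ := List.mem_map.1 hk
  obtain ⟨e, he⟩ := h s hs
  have h1 := hF.1 _ (mem_insertedPasses.2 ⟨s, hs, e, rfl⟩) he
  have h2 := hG.1 _ (mem_insertedPasses.2 ⟨s, hs, e, rfl⟩) he
  have h3 := hc s hs
  have h4 := hFG _ h3.1
  have h5 := hFG _ h3.2
  cases e
  · exact h1.symm.trans (h5.trans h2)
  · exact h1.trans (h4.trans h2.symm)

theorem PairsCorrespond.perm {c c' : List (ℕ × ι)} {P P' : ι → Bool → Pass} (hc : c.Perm c')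
    (h : β.PairsCorrespond c P P') : β.PairsCorrespond c' P P' := by
  have hP : ∀ (F : ℕ → X) (Q : ι → Bool → Pass),
      (insertedPasses F Q c).Perm (insertedPasses F Q c') := fun F Q => hc.flatMap_right _
  have hm : (middles c).Perm (middles c') := hc.map _
  intro F hF
  obtain ⟨F', h1, h2, h3⟩ := h F ((colored_perm β (hP F P)).2 hF)
  refine ⟨F', fun k hk => h1 k fun h => hk (hm.mem_iff.1 h), (colored_perm β (hP F' P')).1 h2, ?_⟩
  rw [← integrals_perm hm, ← integrals_perm hm, ← diagram_perm β (hP F P),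
    ← diagram_perm β (hP F' P'), h3]

theorem PairsDetermined.perm {c c' : List (ℕ × ι)} {P : ι → Bool → Pass} (hc : c.Perm c')
    (h : β.PairsDetermined c P) : β.PairsDetermined c' P := by
  have hP : ∀ (F : ℕ → X), (insertedPasses F P c).Perm (insertedPasses F P c') := fun F =>
    hc.flatMap_right _
  have hm : (middles c).Perm (middles c') := hc.map _
  intro F G hFG hF hG k hk
  exact h F G (fun k hk => hFG k fun h => hk (hm.mem_iff.2 h)) ((colored_perm β (hP F)).2 hF)
    ((colored_perm β (hP G)).2 hG) k (hm.mem_iff.2 hk)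

/-- Each leg has one outer end, and regularity covers all four positions of the two outer ends. -/
theorem colors_eq_of_leg {pos d e : Bool} {a a' b b' : ℕ × X} {i j : ℕ} {x y x' y' : X}
    (h : (β.crossing pos).Ok (leg d a (i, x) a') (leg e b (j, y) b'))
    (h' : (β.crossing pos).Ok (leg d a (i, x') a') (leg e b (j, y') b')) : x = x' ∧ y = y' := by
  have reg := β.regular_crossing pos
  cases d <;> cases e
  · exact Prod.mk.inj ((reg.end_end _ _).unique (y₁ := (x, y)) (y₂ := (x', y')) h h')
  · exact Prod.mk.inj ((reg.end_start _ _).unique (y₁ := (x, y)) (y₂ := (x', y')) h h')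
  · exact Prod.mk.inj ((reg.start_end _ _).unique (y₁ := (x, y)) (y₂ := (x', y')) h h')
  · exact Prod.mk.inj ((reg.start_start _ _).unique (y₁ := (x, y)) (y₂ := (x', y')) h h')

/-! #### First move -/

section kink

variable {P D : ι → Bool → Pass} {n : ℕ} {i : ι} {d : Bool}

omit [Biquandle X] in
theorem insertedPasses_kink_perm (F : ℕ → X) (d : Bool) :
    (insertedPasses F P [(n, i)]).Perm
      [(P i !d, strandLeg F n !d), (P i d, strandLeg F n d)] := by
  cases d
  · exact List.Perm.refl _
  · exact List.Perm.swap _ _ _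

theorem colored_kink (h : (P i !d).IsOver (P i d)) (F : ℕ → X) :
    β.Colored (insertedPasses F P [(n, i)]) ↔
      (β.crossing (P i !d).toLeft).Ok (strandLeg F n d) (strandLeg F n !d) := by
  rw [colored_perm β (insertedPasses_kink_perm F d)]
  exact β.colored_crossing_pair h

theorem diagram_kink (h : (P i !d).IsOver (P i d)) (F : ℕ → X) :
    β.diagram (insertedPasses F P [(n, i)]) =
      (β.crossing (P i !d).toLeft).value (strandLeg F n d) (strandLeg F n !d) := by
  rw [diagram_perm β (insertedPasses_kink_perm F d)]
  exact β.diagram_crossing_pair h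

theorem colored_straight (hD : ∀ e, (D i e).level = Level.virt) (F : ℕ → X) :
    β.Colored (insertedPasses F D [(n, i)]) ↔ F (n + 1) = F n ∧ F (n + 2) = F (n + 1) := by
  rw [colored_of_virt β fun a ha => level_virt_of_mem_insertedPasses (by simpa using hD) ha]
  simp [insertedPasses, strandLeg, leg]

theorem integral_straight (hD : ∀ e, (D i e).level = Level.virt) (F : ℕ → X) :
    integrals β.δ [n + 1] (β.diagram (insertedPasses F D [(n, i)])) = edge n (n + 2) := by
  rw [diagram_of_virt β fun a ha => level_virt_of_mem_insertedPasses (by simpa using hD) ha]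
  simp only [insertedPasses, strandLeg, leg, List.flatMap_cons, List.flatMap_nil, List.append_nil,
    List.map_cons, List.map_nil, List.prod_cons, List.prod_nil, mul_one, cond_true, cond_false,
    integrals_cons, integrals_nil]
  rw [edge_comm n (n + 1), edge_mul_edge, (Free.edge (by omega) (by omega)).integral_edge_mul
    (by omega)]

theorem integral_diagram_kink (h : (P i !d).IsOver (P i d)) {F : ℕ → X} (hF : F (n + 2) = F n)
    (hc : β.Colored (insertedPasses F P [(n, i)])) :
    integrals β.δ [n + 1] (β.diagram (insertedPasses F P [(n, i)])) = edge n (n + 2) := by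
  rw [colored_kink β h] at hc
  rw [diagram_kink β h]
  exact β.integral_kink (a := (n, F n)) (a' := (n + 2, F (n + 2))) (by simp) (by simp) hF hc

theorem pairsCorrespond_straight_kink (hD : ∀ e, (D i e).level = Level.virt)
    (h : (P i !d).IsOver (P i d)) : β.PairsCorrespond [(n, i)] D P := by
  intro F hF
  obtain ⟨h1, h2⟩ := (colored_straight β hD F).1 hF
  have hc : F (n + 2) = F n := h2.trans h1
  obtain ⟨x, hx, -⟩ := β.existsUnique_kink (P i !d).toLeft d (a := (n, F n))
    (a' := (n + 2, F (n + 2))) hc (n + 1)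
  have hcol : β.Colored (insertedPasses (Function.update F (n + 1) x) P [(n, i)]) := by
    rw [colored_kink β h]
    simpa [strandLeg] using hx
  refine ⟨Function.update F (n + 1) x, fun k hk => Function.update_of_ne (by
    simpa [middles] using hk) _ _, hcol, ?_⟩
  refine (integral_straight β hD F).trans (integral_diagram_kink β h ?_ hcol).symm
  simpa using hc

theorem pairsCorrespond_kink_straight (hD : ∀ e, (D i e).level = Level.virt)
    (h : (P i !d).IsOver (P i d)) : β.PairsCorrespond [(n, i)] P D := by
  intro F hF
  have hc : F (n + 2) = F n := β.colors_eq_of_kink ((colored_kink β h F).1 hF)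
  refine ⟨Function.update F (n + 1) (F n), fun k hk => Function.update_of_ne (by
    simpa [middles] using hk) _ _, ?_, ?_⟩
  · rw [colored_straight β hD]
    simpa using hc
  · exact (integral_diagram_kink β h hc hF).trans (integral_straight β hD _).symm

theorem pairsDetermined_kink (h : (P i !d).IsOver (P i d)) :
    β.PairsDetermined [(n, i)] P := by
  intro F G hFG hF hG k hk
  obtain rfl : k = n + 1 := by simpa [middles] using hk
  have h1 : F n = G n := hFG n (by simp [middles])
  have h2 : F (n + 2) = G (n + 2) := hFG _ (by simp [middles])
  rw [colored_kink β h] at hF hG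
  refine (β.existsUnique_kink (P i !d).toLeft d (a := (n, F n)) (a' := (n + 2, F (n + 2)))
    (β.colors_eq_of_kink hF) (n + 1)).unique hF ?_
  rw [h1, h2]
  exact hG

end kink

/-! #### Second move -/

section bigon

variable {P D : ι → Bool → Pass} {m n : ℕ} {i j : ι} {d : Bool}

/-- The crossings of the strand `i` with the strand `j` above it in a bigon. -/
structure IsBigon (P : ι → Bool → Pass) (i j : ι) (d : Bool) : Prop where
  fst_over : (P j d).IsOver (P i true)
  snd_over : (P j !d).IsOver (P i false)
  label_ne : (P i true).label ≠ (P i false).label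
  toLeft : (P j !d).toLeft = !(P j d).toLeft

omit [Biquandle X] in
theorem insertedPasses_bigon_perm (F : ℕ → X) (d : Bool) :
    (insertedPasses F P [(m, i), (n, j)]).Perm
      ([(P j d, strandLeg F n d), (P i true, strandLeg F m true)] ++
        [(P j !d, strandLeg F n !d), (P i false, strandLeg F m false)]) := by
  rw [← Multiset.coe_eq_coe]
  cases d <;>
    simp only [insertedPasses, List.flatMap_cons, List.flatMap_nil, List.append_nil,
      List.cons_append, List.nil_append, ← Multiset.cons_coe, ← Multiset.singleton_add,
      Bool.not_true, Bool.not_false, Multiset.coe_nil] <;> abel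

omit [Biquandle X] in
theorem IsBigon.apart (h : IsBigon P i j d) (F : ℕ → X) :
    Apart [(P j d, strandLeg F n d), (P i true, strandLeg F m true)]
      [(P j !d, strandLeg F n !d), (P i false, strandLeg F m false)] := by
  have h1 := h.label_ne
  have h2 := h.fst_over.2.2
  have h3 := h.snd_over.2.2
  intro a ha b hb
  simp only [List.mem_cons, List.not_mem_nil, or_false] at ha hb
  have hne : a.1.label ≠ b.1.label := by
    rcases ha with rfl | rfl <;> rcases hb with rfl | rfl <;> simp only [h2, h3] <;> exact h1
  exact ⟨fun h => hne h.2.2, fun h => hne h.2.2.symm⟩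

theorem IsBigon.colored_iff (h : IsBigon P i j d) (F : ℕ → X) :
    β.Colored (insertedPasses F P [(m, i), (n, j)]) ↔
      (β.crossing (P j d).toLeft).Ok (strandLeg F m true) (strandLeg F n d) ∧
        (β.crossing !(P j d).toLeft).Ok (strandLeg F m false) (strandLeg F n !d) := by
  rw [colored_perm β (insertedPasses_bigon_perm F d), colored_append β (h.apart F),
    colored_crossing_pair β h.fst_over, colored_crossing_pair β h.snd_over, ← h.toLeft]

theorem IsBigon.diagram_eq (h : IsBigon P i j d) (F : ℕ → X) :
    β.diagram (insertedPasses F P [(m, i), (n, j)]) =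
      (β.crossing (P j d).toLeft).value (strandLeg F m true) (strandLeg F n d) *
        (β.crossing !(P j d).toLeft).value (strandLeg F m false) (strandLeg F n !d) := by
  rw [diagram_perm β (insertedPasses_bigon_perm F d), diagram_append β (h.apart F),
    diagram_crossing_pair β h.fst_over, diagram_crossing_pair β h.snd_over, ← h.toLeft]

theorem IsBigon.colors_eq (h : IsBigon P i j d) {F : ℕ → X}
    (hF : β.Colored (insertedPasses F P [(m, i), (n, j)])) :
    F (m + 2) = F m ∧ F (n + 2) = F n := by
  rw [h.colored_iff] at hF
  exact β.colors_eq_of_bigon hF.1 hF.2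

theorem IsBigon.integral_eq (h : IsBigon P i j d) {F : ℕ → X} (hmn : m + 2 ≤ n ∨ n + 2 ≤ m)
    (hF : β.Colored (insertedPasses F P [(m, i), (n, j)])) :
    integrals β.δ [m + 1, n + 1] (β.diagram (insertedPasses F P [(m, i), (n, j)])) =
      edge m (m + 2) * edge n (n + 2) := by
  obtain ⟨h1, h2⟩ := h.colors_eq β hF
  rw [h.colored_iff] at hF
  rw [h.diagram_eq]
  refine β.integral_bigon (a := (m, F m)) (a' := (m + 2, F (m + 2))) (b := (n, F n))
    (b' := (n + 2, F (n + 2))) (by omega) ?_ h1 h2 hF.1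
  simp only [List.mem_cons, List.not_mem_nil, or_false, forall_eq_or_imp, forall_eq]
  omega

theorem colored_straight_pair (hD : ∀ k e, (D k e).level = Level.virt) (F : ℕ → X) :
    β.Colored (insertedPasses F D [(m, i), (n, j)]) ↔
      (F (m + 1) = F m ∧ F (m + 2) = F (m + 1)) ∧ F (n + 1) = F n ∧ F (n + 2) = F (n + 1) := by
  rw [colored_of_virt β fun a ha => level_virt_of_mem_insertedPasses (fun s _ => hD s.2) ha]
  simp [insertedPasses, strandLeg, leg, and_assoc]

theorem integral_straight_pair (hD : ∀ k e, (D k e).level = Level.virt) (F : ℕ → X)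
    (hmn : m + 2 ≤ n ∨ n + 2 ≤ m) :
    integrals β.δ [m + 1, n + 1] (β.diagram (insertedPasses F D [(m, i), (n, j)])) =
      edge m (m + 2) * edge n (n + 2) := by
  rw [diagram_of_virt β fun a ha => level_virt_of_mem_insertedPasses (fun s _ => hD s.2) ha]
  simp only [insertedPasses, strandLeg, leg, List.flatMap_cons, List.flatMap_nil, List.append_nil,
    List.cons_append, List.nil_append,
    List.map_cons, List.map_nil, List.prod_cons, List.prod_nil, mul_one, cond_true, cond_false,
    integrals_cons, integrals_nil]
  rw [edge_comm n (n + 1), edge_comm m (m + 1), ← mul_assoc,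
    ((Free.edge (by omega) (by omega)).mul (Free.edge (by omega) (by omega))), edge_mul_edge,
    edge_mul_edge, (Free.edge (by omega) (by omega)).integral_edge_mul (by omega), mul_assoc,
    ((Free.edge (by omega) (by omega)).mul (Free.edge (by omega) (by omega))).integral_edge_mul
      (by omega)]

theorem IsBigon.pairsCorrespond_straight (h : IsBigon P i j d) (hD : ∀ k e, (D k e).level = Level.virt)
    (hmn : m + 2 ≤ n ∨ n + 2 ≤ m) : β.PairsCorrespond [(m, i), (n, j)] D P := by
  intro F hF
  obtain ⟨⟨h1, h2⟩, h3, h4⟩ := (colored_straight_pair β hD F).1 hF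
  obtain ⟨⟨x, y⟩, hxy, -⟩ := β.existsUnique_bigon (P j d).toLeft d (m, F m) (m + 2, F (m + 2))
    (n, F n) (n + 2, F (n + 2)) (m + 1) (n + 1)
  let F' : ℕ → X := fun k => if k = m + 1 then x else if k = n + 1 then y else F k
  have hF' : ∀ k, k ≠ m + 1 → k ≠ n + 1 → F' k = F k := fun k h h' => by
    simp only [F', if_neg h, if_neg h']
  have hm : ∀ e, strandLeg F' m e = leg e (m, F m) (m + 1, x) (m + 2, F (m + 2)) := fun e => by
    rw [strandLeg, hF' m (by omega) (by omega), hF' (m + 2) (by omega) (by omega)]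
    simp only [F', if_true]
  have hn : ∀ e, strandLeg F' n e = leg e (n, F n) (n + 1, y) (n + 2, F (n + 2)) := fun e => by
    rw [strandLeg, hF' n (by omega) (by omega), hF' (n + 2) (by omega) (by omega)]
    simp only [F', if_true, if_neg (show n + 1 ≠ m + 1 by omega)]
  have hcol : β.Colored (insertedPasses F' P [(m, i), (n, j)]) := by
    rw [h.colored_iff]
    simp only [hm, hn]
    exact ⟨hxy, (β.ok_bigon_iff (h2.trans h1) (h4.trans h3)).2 hxy⟩
  refine ⟨F', fun k hk => ?_, hcol,
    (integral_straight_pair β hD F hmn).trans (h.integral_eq β hmn hcol).symm⟩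
  simp only [middles, List.map_cons, List.map_nil, List.mem_cons, List.not_mem_nil, or_false,
    not_or] at hk
  exact hF' k hk.1 hk.2

theorem IsBigon.pairsCorrespond (h : IsBigon P i j d) (hD : ∀ k e, (D k e).level = Level.virt)
    (hmn : m + 2 ≤ n ∨ n + 2 ≤ m) : β.PairsCorrespond [(m, i), (n, j)] P D := by
  intro F hF
  obtain ⟨h1, h2⟩ := h.colors_eq β hF
  let F' : ℕ → X := fun k => if k = m + 1 then F m else if k = n + 1 then F n else F k
  have hF' : ∀ k, k ≠ m + 1 → k ≠ n + 1 → F' k = F k := fun k h h' => by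
    simp only [F', if_neg h, if_neg h']
  refine ⟨F', fun k hk => ?_, (colored_straight_pair β hD F').2 ?_,
    (h.integral_eq β hmn hF).trans (integral_straight_pair β hD F' hmn).symm⟩
  · simp only [middles, List.map_cons, List.map_nil, List.mem_cons, List.not_mem_nil, or_false,
      not_or] at hk
    exact hF' k hk.1 hk.2
  · rw [hF' m (by omega) (by omega), hF' (m + 2) (by omega) (by omega), hF' n (by omega) (by omega),
      hF' (n + 2) (by omega) (by omega)]
    simp only [F', if_true, if_neg (show n + 1 ≠ m + 1 by omega)]
    exact ⟨⟨trivial, h1⟩, trivial, h2⟩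

theorem IsBigon.pairsDetermined (h : IsBigon P i j d) (hmn : m + 2 ≤ n ∨ n + 2 ≤ m) :
    β.PairsDetermined [(m, i), (n, j)] P := by
  intro F G hFG hF hG
  have hFG' : ∀ k, k ≠ m + 1 → k ≠ n + 1 → F k = G k := fun k h1 h2 => hFG k (by
    simp only [middles, List.map_cons, List.map_nil, List.mem_cons, List.not_mem_nil, or_false,
      not_or]
    exact ⟨h1, h2⟩)
  rw [h.colored_iff] at hF hG
  have := hG.1
  simp only [strandLeg, ← hFG' m (by omega) (by omega), ← hFG' (m + 2) (by omega) (by omega),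
    ← hFG' n (by omega) (by omega), ← hFG' (n + 2) (by omega) (by omega)] at this
  have key := β.colors_eq_of_leg hF.1 this
  simp only [middles, List.map_cons, List.map_nil, List.mem_cons, List.not_mem_nil, or_false,
    forall_eq_or_imp, forall_eq]
  exact key

end bigon

end VirtualBracket

/-! #### Third move -/

/-- The piece of a strand with two passages, disregarding the inner point. -/
def strandEnds {X : Type*} (F : ℕ → X) (n : ℕ) : Leg X := ((n, F n), (n + 2, F (n + 2)))

namespace CrossingType

open StateRing

variable {X R : Type*} [CommRing R] {δ : R} (U : CrossingType X R) {F : ℕ → X} {m n : ℕ}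

/-- The color does not change along the leg. -/
def _root_.Leg.Constant (f : Leg X) : Prop := f.2.2 = f.1.2

-- If the other passage of the strand is virtual, the inner semi-arc has the color of the adjacent
-- outer end, so the position of the crossing on the strand does not matter.
omit [CommRing R] in
theorem ok_strandEnds_left {d : Bool} (h : (strandLeg F m !d).Constant) (f : Leg X) :
    U.Ok (strandLeg F m d) f ↔ U.Ok (strandEnds F m) f := by
  cases d
  · change F (m + 1) = F m at h
    change U.ok (F (m + 1)) _ _ _ ↔ _
    rw [h]; rfl
  · change F (m + 2) = F (m + 1) at h
    change U.ok _ (F (m + 1)) _ _ ↔ _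
    rw [← h]; rfl

omit [CommRing R] in
theorem ok_strandEnds_right {d : Bool} (h : (strandLeg F m !d).Constant) (f : Leg X) :
    U.Ok f (strandLeg F m d) ↔ U.Ok f (strandEnds F m) := by
  cases d
  · change F (m + 1) = F m at h
    change U.ok _ _ (F (m + 1)) _ ↔ _
    rw [h]; rfl
  · change F (m + 2) = F (m + 1) at h
    change U.ok _ _ _ (F (m + 1)) ↔ _
    rw [← h]; rfl

/-- The virtual passage is an edge from the inner point to an outer end, and deleting the inner
point shifts the crossing to that end. -/
theorem integral_strandEnds_left {d : Bool} (h : (strandLeg F m !d).Constant) {f : Leg X}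
    (hf : f.1.1 ≠ m + 1 ∧ f.2.1 ≠ m + 1) :
    integral δ (m + 1) (edge (strandLeg F m !d).1.1 (strandLeg F m !d).2.1 *
      U.value (strandLeg F m d) f) = U.value (strandEnds F m) f := by
  cases d
  · change F (m + 1) = F m at h
    have e := edge_mul_vertex₁ (U := U) (m + 1) (m, F m) (m + 2, F (m + 2)) f.1 f.2
    simp only [strandLeg, leg, CrossingType.value, strandEnds, Bool.not_false, cond_true,
      cond_false, h] at e ⊢
    rw [edge_comm m, e, (free_vertex (by simp) (by simp) hf.1 hf.2).integral_edge_mul (by omega)]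
  · change F (m + 2) = F (m + 1) at h
    have e := edge_mul_vertex₂ (U := U) (m + 1) (m + 2, F (m + 2)) (m, F m) f.1 f.2
    simp only [strandLeg, leg, CrossingType.value, strandEnds, Bool.not_true, cond_true,
      cond_false, ← h] at e ⊢
    rw [e, (free_vertex (by simp) (by simp) hf.1 hf.2).integral_edge_mul (by omega)]

theorem integral_strandEnds_right {d : Bool} (h : (strandLeg F m !d).Constant) {f : Leg X}
    (hf : f.1.1 ≠ m + 1 ∧ f.2.1 ≠ m + 1) :
    integral δ (m + 1) (edge (strandLeg F m !d).1.1 (strandLeg F m !d).2.1 *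
      U.value f (strandLeg F m d)) = U.value f (strandEnds F m) := by
  cases d
  · change F (m + 1) = F m at h
    have e := edge_mul_vertex₃ (U := U) (m + 1) (m, F m) f.1 f.2 (m + 2, F (m + 2))
    simp only [strandLeg, leg, CrossingType.value, strandEnds, Bool.not_false, cond_true,
      cond_false, h] at e ⊢
    rw [edge_comm m, e, (free_vertex hf.1 hf.2 (by simp) (by simp)).integral_edge_mul (by omega)]
  · change F (m + 2) = F (m + 1) at h
    have e := edge_mul_vertex₄ (U := U) (m + 1) (m + 2, F (m + 2)) f.1 f.2 (m, F m)
    simp only [strandLeg, leg, CrossingType.value, strandEnds, Bool.not_true, cond_true,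
      cond_false, ← h] at e ⊢
    rw [e, (free_vertex hf.1 hf.2 (by simp) (by simp)).integral_edge_mul (by omega)]

end CrossingType

theorem insertedPasses_triple_perm {X ι : Type*} (F : ℕ → X) (P : ι → Bool → Pass) (l m n : ℕ)
    (i j k : ι) (d e f : Bool) :
    (insertedPasses F P [(l, i), (m, j), (n, k)]).Perm
      ([(P j e, strandLeg F m e), (P i d, strandLeg F l d)] ++
        ([(P k !f, strandLeg F n !f), (P j !e, strandLeg F m !e)] ++
          [(P k f, strandLeg F n f), (P i !d, strandLeg F l !d)])) := by
  rw [← Multiset.coe_eq_coe]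
  cases d <;> cases e <;> cases f <;>
    simp only [insertedPasses, List.flatMap_cons, List.flatMap_nil, List.append_nil,
      List.cons_append, List.nil_append, ← Multiset.cons_coe, ← Multiset.singleton_add,
      Bool.not_true, Bool.not_false, Multiset.coe_nil] <;> abel

namespace VirtualBracket

open StateRing CrossingType

variable {X R ι : Type*} [Biquandle X] [CommRing R] (β : VirtualBracket X R)

section triangle

variable {P : ι → Bool → Pass} {l m n : ℕ} {i j k : ι} {d e f : Bool}

/-- The strand `i` is below the strand `j`, and both are below the strand `k`. The crossing of the
strands `i` and `j` is the first one on the strand `i` if `d = true`, and the first one on the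
strand `j` if `e = true`; the crossing of the strands `i` and `k` is the first one on the
strand `k` if `f = true`. -/
structure IsStack (P : ι → Bool → Pass) (i j k : ι) (d e f : Bool) : Prop where
  over₁ : (P j e).IsOver (P i d)
  over₂ : (P k !f).IsOver (P j !e)
  over₃ : (P k f).IsOver (P i !d)
  label_ne₁ : (P i d).label ≠ (P i !d).label
  label_ne₂ : (P j e).label ≠ (P j !e).label
  label_ne₃ : (P k f).label ≠ (P k !f).label
  toLeft₁ : (d ^^ e) = ((P k !f).toLeft ^^ (P k f).toLeft)
  toLeft₂ : (e ^^ f) = ((P j e).toLeft ^^ (P k f).toLeft)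

theorem IsStack.flip (h : IsStack P i j k d e f) :
    IsStack (fun i d => P i !d) i j k (!d) (!e) !f := by
  obtain ⟨h1, h2, h3, h4, h5, h6, h7, h8⟩ := h
  constructor <;> simp only [Bool.not_not] <;> try assumption
  · rw [← h7]; cases d <;> cases e <;> rfl
  · rw [← h8]; cases f <;> cases e <;> rfl

omit [Biquandle X] in
theorem apart_of_label_ne {L L' : List (LocatedPass X)} {x : ℕ} (h : ∀ a ∈ L, a.1.label = x)
    (h' : ∀ b ∈ L', b.1.label ≠ x) : Apart L L' := fun a ha b hb =>
  ⟨fun k => h' b hb (k.2.2.symm.trans (h a ha)), fun k => h' b hb (k.2.2.trans (h a ha))⟩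

omit [Biquandle X] in
theorem IsStack.apart₁ (h : IsStack P i j k d e f) (F : ℕ → X) :
    Apart [(P j e, strandLeg F m e), (P i d, strandLeg F l d)]
      ([(P k !f, strandLeg F n !f), (P j !e, strandLeg F m !e)] ++
        [(P k f, strandLeg F n f), (P i !d, strandLeg F l !d)]) := by
  have h1 := h.over₁.2.2
  have h2 := h.over₂.2.2
  have h3 := h.over₃.2.2
  refine apart_of_label_ne (x := (P j e).label) ?_ ?_
  · simp [h1]
  · simp only [List.mem_append, List.mem_cons, List.not_mem_nil, or_false,
      or_imp, forall_and, forall_eq, h2, h3, and_self]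
    exact ⟨h.label_ne₂.symm, by rw [h1]; exact h.label_ne₁.symm⟩

omit [Biquandle X] in
theorem IsStack.apart₂ (h : IsStack P i j k d e f) (F : ℕ → X) :
    Apart [(P k !f, strandLeg F n !f), (P j !e, strandLeg F m !e)]
      [(P k f, strandLeg F n f), (P i !d, strandLeg F l !d)] := by
  have h2 := h.over₂.2.2
  have h3 := h.over₃.2.2
  refine apart_of_label_ne (x := (P k !f).label) ?_ ?_
  · simp [h2]
  · simp only [List.mem_cons, List.not_mem_nil, or_false, forall_eq_or_imp, forall_eq, ← h3,
      and_self]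
    exact h.label_ne₃

theorem IsStack.colored_iff (h : IsStack P i j k d e f) (F : ℕ → X) :
    β.Colored (insertedPasses F P [(l, i), (m, j), (n, k)]) ↔
      (β.crossing (P j e).toLeft).Ok (strandLeg F l d) (strandLeg F m e) ∧
      (β.crossing (P k !f).toLeft).Ok (strandLeg F m !e) (strandLeg F n !f) ∧
      (β.crossing (P k f).toLeft).Ok (strandLeg F l !d) (strandLeg F n f) := by
  rw [colored_perm β (insertedPasses_triple_perm F P l m n i j k d e f),
    colored_append β (h.apart₁ F), colored_append β (h.apart₂ F), colored_crossing_pair β h.over₁,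
    colored_crossing_pair β h.over₂, colored_crossing_pair β h.over₃]

theorem IsStack.diagram_eq (h : IsStack P i j k d e f) (F : ℕ → X) :
    β.diagram (insertedPasses F P [(l, i), (m, j), (n, k)]) =
      (β.crossing (P j e).toLeft).value (strandLeg F l d) (strandLeg F m e) *
      (β.crossing (P k !f).toLeft).value (strandLeg F m !e) (strandLeg F n !f) *
      (β.crossing (P k f).toLeft).value (strandLeg F l !d) (strandLeg F n f) := by
  rw [diagram_perm β (insertedPasses_triple_perm F P l m n i j k d e f),
    diagram_append β (h.apart₁ F), diagram_append β (h.apart₂ F), diagram_crossing_pair β h.over₁,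
    diagram_crossing_pair β h.over₂, diagram_crossing_pair β h.over₃, mul_assoc]

/-- Three places for pairs of passages. -/
def Separate (l m n : ℕ) : Prop :=
  (l + 2 ≤ m ∨ m + 2 ≤ l) ∧ (l + 2 ≤ n ∨ n + 2 ≤ l) ∧ (m + 2 ≤ n ∨ n + 2 ≤ m)

omit [Biquandle X] in
theorem Separate.exists_update (h : Separate l m n) (F : ℕ → X) (x y z : X) : ∃ F' : ℕ → X,
    (∀ q, q ∉ middles [(l, i), (m, j), (n, k)] → F' q = F q) ∧
    (∀ d, strandLeg F' l d = leg d (l, F l) (l + 1, x) (l + 2, F (l + 2))) ∧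
    (∀ d, strandLeg F' m d = leg d (m, F m) (m + 1, y) (m + 2, F (m + 2))) ∧
    ∀ d, strandLeg F' n d = leg d (n, F n) (n + 1, z) (n + 2, F (n + 2)) := by
  let F' : ℕ → X := fun k => if k = l + 1 then x else if k = m + 1 then y else
    if k = n + 1 then z else F k
  have hF' : ∀ k, k ≠ l + 1 → k ≠ m + 1 → k ≠ n + 1 → F' k = F k := fun k h h' h'' => by
    simp only [F', if_neg h, if_neg h', if_neg h'']
  obtain ⟨h1, h2, h3⟩ := h
  refine ⟨F', fun k hk => ?_, fun d => ?_, fun d => ?_, fun d => ?_⟩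
  · simp only [middles, List.map_cons, List.map_nil, List.mem_cons, List.not_mem_nil, or_false,
      not_or] at hk
    exact hF' k hk.1 hk.2.1 hk.2.2
  · rw [strandLeg, hF' l (by omega) (by omega) (by omega),
      hF' (l + 2) (by omega) (by omega) (by omega)]
    simp only [F', if_true]
  · rw [strandLeg, hF' m (by omega) (by omega) (by omega),
      hF' (m + 2) (by omega) (by omega) (by omega)]
    simp only [F', if_true, if_neg (show m + 1 ≠ l + 1 by omega)]
  · rw [strandLeg, hF' n (by omega) (by omega) (by omega),
      hF' (n + 2) (by omega) (by omega) (by omega)]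
    simp only [F', if_true, if_neg (show n + 1 ≠ l + 1 by omega),
      if_neg (show n + 1 ≠ m + 1 by omega)]

theorem IsStack.pairsCorrespond (h : IsStack P i j k d e f) (hs : Separate l m n) :
    β.PairsCorrespond [(l, i), (m, j), (n, k)] P fun i d => P i !d := by
  intro F hF
  rw [h.colored_iff] at hF
  obtain ⟨x, y, z, h1, h2, h3, h4⟩ := β.exists_third_move h.toLeft₁ h.toLeft₂
    (by have := hs.1; omega) (by have := hs.2.1; omega) (by have := hs.2.2; omega)
    (by
      obtain ⟨s1, s2, s3⟩ := hs
      simp only [List.mem_cons, List.not_mem_nil, or_false, forall_eq_or_imp, forall_eq]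
      omega) hF.1 hF.2.1 hF.2.2
  obtain ⟨F', k1, k2, k3, k4⟩ := hs.exists_update (i := i) (j := j) (k := k) F x y z
  refine ⟨F', k1, (h.flip.colored_iff β F').2 ?_, ?_⟩
  · simp only [Bool.not_not, k2, k3, k4]
    exact ⟨h1, h2, h3⟩
  · rw [h.diagram_eq, h.flip.diagram_eq]
    simp only [Bool.not_not, k2, k3, k4]
    exact h4

/-- Two crossings suffice: that of `i` and `j` determines two inner colors, that of `j` and `k` the
third one. -/
theorem IsStack.pairsDetermined (h : IsStack P i j k d e f) (hs : Separate l m n) :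
    β.PairsDetermined [(l, i), (m, j), (n, k)] P := by
  intro F G hFG hF hG
  obtain ⟨s1, s2, s3⟩ := hs
  have hFG' : ∀ k, k ≠ l + 1 → k ≠ m + 1 → k ≠ n + 1 → F k = G k := fun k h1 h2 h3 => hFG k (by
    simp only [middles, List.map_cons, List.map_nil, List.mem_cons, List.not_mem_nil, or_false,
      not_or]
    exact ⟨h1, h2, h3⟩)
  rw [h.colored_iff] at hF hG
  simp only [strandLeg, ← hFG' m (by omega) (by omega) (by omega),
    ← hFG' (m + 2) (by omega) (by omega) (by omega), ← hFG' l (by omega) (by omega) (by omega),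
    ← hFG' (l + 2) (by omega) (by omega) (by omega), ← hFG' n (by omega) (by omega) (by omega),
    ← hFG' (n + 2) (by omega) (by omega) (by omega)] at hG
  have k1 := β.colors_eq_of_leg hF.1 hG.1
  have k2 := β.colors_eq_of_leg hF.2.1 hG.2.1
  simp only [middles, List.map_cons, List.map_nil, List.mem_cons, List.not_mem_nil, or_false,
    forall_eq_or_imp, forall_eq]
  exact ⟨k1.1, k1.2, k2.2⟩

/-- The crossings of the strand `k` are virtual, and the strand `j` is over the strand `i`, where
the crossing is the first one on the strand `i` if `d = true`, and the first one on the strand `j`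
if `e = true`. -/
structure IsDetour (P : ι → Bool → Pass) (i j k : ι) (d e : Bool) : Prop where
  is_over : (P j e).IsOver (P i d)
  virt₁ : (P i !d).level = Level.virt
  virt₂ : (P j !e).level = Level.virt
  virt₃ : ∀ f, (P k f).level = Level.virt

theorem IsDetour.flip (h : IsDetour P i j k d e) : IsDetour (fun i d => P i !d) i j k (!d) !e := by
  obtain ⟨h1, h2, h3, h4⟩ := h
  exact ⟨by simpa only [Bool.not_not], by simpa only [Bool.not_not], by simpa only [Bool.not_not],
    fun f => h4 _⟩

omit [Biquandle X] in
theorem insertedPasses_detour_perm (F : ℕ → X) (P : ι → Bool → Pass) (l m n : ℕ)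
    (i j k : ι) (d e : Bool) :
    (insertedPasses F P [(l, i), (m, j), (n, k)]).Perm
      ([(P k true, strandLeg F n true), (P k false, strandLeg F n false),
        (P j !e, strandLeg F m !e), (P i !d, strandLeg F l !d)] ++
          [(P j e, strandLeg F m e), (P i d, strandLeg F l d)]) := by
  rw [← Multiset.coe_eq_coe]
  cases d <;> cases e <;>
    simp only [insertedPasses, List.flatMap_cons, List.flatMap_nil, List.append_nil,
      List.cons_append, List.nil_append, ← Multiset.cons_coe, ← Multiset.singleton_add,
      Bool.not_true, Bool.not_false, Multiset.coe_nil] <;> abel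

omit [Biquandle X] in
theorem IsDetour.forall_virt (h : IsDetour P i j k d e) (F : ℕ → X) :
    ∀ a ∈ [(P k true, strandLeg F n true), (P k false, strandLeg F n false),
      (P j !e, strandLeg F m !e), (P i !d, strandLeg F l !d)], a.1.level = Level.virt := by
  simp [h.virt₁, h.virt₂, h.virt₃]

theorem IsDetour.colored_iff (h : IsDetour P i j k d e) (F : ℕ → X) :
    β.Colored (insertedPasses F P [(l, i), (m, j), (n, k)]) ↔
      ((strandLeg F n true).Constant ∧ (strandLeg F n false).Constant) ∧
        (strandLeg F m !e).Constant ∧ (strandLeg F l !d).Constant ∧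
        (β.crossing (P j e).toLeft).Ok (strandEnds F l) (strandEnds F m) := by
  rw [colored_perm β (insertedPasses_detour_perm F P l m n i j k d e),
    colored_append β (apart_of_virt (h.forall_virt F)), colored_of_virt β (h.forall_virt F),
    colored_crossing_pair β h.is_over]
  simp only [List.mem_cons, List.not_mem_nil, or_false, forall_eq_or_imp, forall_eq, and_assoc]
  refine and_congr Iff.rfl (and_congr Iff.rfl (and_congr_right fun h1 => and_congr_right fun h2 => ?_))
  rw [ok_strandEnds_left _ h2, ok_strandEnds_right _ h1]

/-- The result involves neither the inner points nor the order of the passages. It is therefore the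
same on both sides of the move, and the mixed move needs no bracket axiom. -/
theorem IsDetour.integral_eq (h : IsDetour P i j k d e) (hs : Separate l m n) {F : ℕ → X}
    (hF : β.Colored (insertedPasses F P [(l, i), (m, j), (n, k)])) :
    integrals β.δ [l + 1, m + 1, n + 1] (β.diagram (insertedPasses F P [(l, i), (m, j), (n, k)])) =
      edge n (n + 2) * (β.crossing (P j e).toLeft).value (strandEnds F l) (strandEnds F m) := by
  obtain ⟨-, h1, h2, -⟩ := (h.colored_iff β F).1 hF
  obtain ⟨s1, s2, s3⟩ := hs
  rw [diagram_perm β (insertedPasses_detour_perm F P l m n i j k d e),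
    diagram_append β (apart_of_virt (h.forall_virt F)), diagram_of_virt β (h.forall_virt F),
    diagram_crossing_pair β h.is_over]
  have hfree : ∀ (q r : ℕ) (g : Bool), q ≠ r + 1 → q ≠ r → q ≠ r + 2 →
      Free β.δ q (edge (strandLeg F r g).1.1 (strandLeg F r g).2.1) := fun q r g h1 h2 h3 => by
    cases g <;> exact Free.edge (by simp [strandLeg, leg]; omega) (by simp [strandLeg, leg]; omega)
  have hp : List.Perm [l + 1, m + 1, n + 1] [n + 1, m + 1, l + 1] :=
    List.reverse_perm [n + 1, m + 1, l + 1]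
  have hn : ∀ q, q ≠ n + 1 → q ≠ n → q ≠ n + 2 → Free β.δ q
      (edge (strandLeg F n true).1.1 (strandLeg F n true).2.1 *
        edge (strandLeg F n false).1.1 (strandLeg F n false).2.1) := fun q g1 g2 g3 =>
    (hfree q n true g1 g2 g3).mul (hfree q n false g1 g2 g3)
  simp only [List.map_cons, List.map_nil, List.prod_cons, List.prod_nil, mul_one]
  have hassoc : ∀ a b c e v : StateRing R, a * (b * (c * e)) * v = a * b * (c * (e * v)) :=
    fun a b c e v => by ring
  rw [integrals_perm hp, hassoc]
  simp only [integrals_cons, integrals_nil]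
  have hleg : ∀ (q r : ℕ) (g : Bool), q ≠ r + 1 → q ≠ r → q ≠ r + 2 →
      (strandLeg F r g).1.1 ≠ q ∧ (strandLeg F r g).2.1 ≠ q := fun q r g h1 h2 h3 => by
    cases g <;> simp only [strandLeg, leg, cond_true, cond_false] <;> omega
  rw [hn (l + 1) (by omega) (by omega) (by omega),
    hfree (l + 1) m (!e) (by omega) (by omega) (by omega),
    integral_strandEnds_left _ h2 (hleg (l + 1) m e (by omega) (by omega) (by omega)),
    hn (m + 1) (by omega) (by omega) (by omega), integral_strandEnds_right _ h1 (by
      simp only [strandEnds]; omega)]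
  simp only [strandLeg, leg, cond_true, cond_false]
  rw [edge_comm n (n + 1), edge_mul_edge, mul_assoc, Free.integral_edge_mul _ (by omega)]
  refine (Free.edge (by omega) (by omega)).mul ?_
  exact free_vertex (by simp only [strandEnds]; omega) (by simp only [strandEnds]; omega)
    (by simp only [strandEnds]; omega) (by simp only [strandEnds]; omega)

theorem IsDetour.pairsCorrespond (h : IsDetour P i j k d e) (hs : Separate l m n) :
    β.PairsCorrespond [(l, i), (m, j), (n, k)] P fun i d => P i !d := by
  intro F hF
  have hk := ((h.colored_iff β F).1 hF).1
  obtain ⟨F', k1, k2, k3, k4⟩ := hs.exists_update (i := i) (j := j) (k := k) F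
    (bif d then F l else F (l + 2)) (bif e then F m else F (m + 2)) (F (n + 1))
  have hends : ∀ q, q ∉ middles [(l, i), (m, j), (n, k)] →
      q + 2 ∉ middles [(l, i), (m, j), (n, k)] → strandEnds F' q = strandEnds F q := fun q h1 h2 => by
    rw [strandEnds, strandEnds, k1 q h1, k1 _ h2]
  have hmid : ∀ q, q ∉ middles [(l, i), (m, j), (n, k)] ↔ q ≠ l + 1 ∧ q ≠ m + 1 ∧ q ≠ n + 1 :=
    fun q => by simp [middles]
  obtain ⟨s1, s2, s3⟩ := id hs
  have hl : strandEnds F' l = strandEnds F l := hends l ((hmid _).2 (by omega)) ((hmid _).2 (by omega))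
  have hm : strandEnds F' m = strandEnds F m := hends m ((hmid _).2 (by omega)) ((hmid _).2 (by omega))
  have hcol : β.Colored (insertedPasses F' (fun i d => P i !d) [(l, i), (m, j), (n, k)]) := by
    rw [h.flip.colored_iff, k2, k3, k4, k4, hl, hm]
    simp only [Bool.not_not]
    refine ⟨hk, ?_, ?_, ((h.colored_iff β F).1 hF).2.2.2⟩
    · cases e <;> rfl
    · cases d <;> rfl
  refine ⟨F', k1, hcol, (h.integral_eq β hs hF).trans (Eq.symm ?_)⟩
  refine (h.flip.integral_eq β hs hcol).trans ?_
  rw [hl, hm]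
  simp only [Bool.not_not]

end triangle

end VirtualBracket

/-! ### Invariance under the moves -/

namespace VirtualBracket

open StateRing CrossingType

variable {X R ι : Type*} [Biquandle X] [CommRing R] (β : VirtualBracket X R)

/-! #### Triangles -/

/-- The pairs of passages of a third move in a code. -/
structure IsTriangular (P : Fin 3 → Bool → Pass) : Prop where
  crosses : ∀ i j, i ≠ j → ∃ e f, (P i e).label = (P j f).label
  side : ∀ i, ∃ s : Bool, ∀ j, j ≠ i → ∀ e f, (P i e).label = (P j f).label →
    (P i e).toLeft = (f == s)
  fits : ∀ i j e f, (i, e) ≠ (j, f) → (P i e).label = (P j f).label → (P i e).Fits (P j f)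
  twice : ∀ x y z : Fin 3 × Bool, x ≠ y → x ≠ z → y ≠ z → (P x.1 x.2).label = (P y.1 y.2).label →
    (P x.1 x.2).label ≠ (P z.1 z.2).label

namespace IsTriangular

variable {P : Fin 3 → Bool → Pass} {i j k : Fin 3}

/-- Each pair of strands has a common crossing, and no crossing is passed three times. Hence the
crossings with the two other strands are the two different passages of each strand, and three
Booleans describe the triangle. -/
theorem exists_order (h : IsTriangular P) (hij : i ≠ j) (hik : i ≠ k) (hjk : j ≠ k) :
    ∃ d e f, (P i d).label = (P j e).label ∧ (P j !e).label = (P k !f).label ∧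
      (P i !d).label = (P k f).label := by
  obtain ⟨d, e, h1⟩ := h.crosses i j hij
  obtain ⟨e', f', h2⟩ := h.crosses j k hjk
  obtain ⟨d', f, h3⟩ := h.crosses i k hik
  have he : e' = !e := by
    refine Bool.eq_not.2 fun he => ?_
    subst he
    exact h.twice (j, e') (i, d) (k, f') (by simp [hij.symm]) (by simp [hjk]) (by simp [hik]) h1.symm h2
  have hd : d' = !d := by
    refine Bool.eq_not.2 fun hd => ?_
    subst hd
    exact h.twice (i, d') (j, e) (k, f) (by simp [hij]) (by simp [hik]) (by simp [hjk]) h1 h3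
  have hf : f' = !f := by
    refine Bool.eq_not.2 fun hf => ?_
    subst hf
    exact h.twice (k, f') (j, e') (i, d') (by simp [hjk.symm]) (by simp [hik.symm])
      (by simp [hij.symm]) h2.symm h3.symm
  subst he hd hf
  exact ⟨d, e, f, h1, h2, h3⟩

/-- One of the two passages is shared with another strand; equal labels would make a triple passage.
-/
theorem label_ne (h : IsTriangular P) (i : Fin 3) (d : Bool) : (P i d).label ≠ (P i !d).label := by
  obtain ⟨j, hj⟩ : ∃ j, i ≠ j := ⟨i + 1, by fin_cases i <;> decide⟩
  obtain ⟨e, f, h1⟩ := h.crosses i j hj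
  intro h2
  have h3 : (P i e).label = (P i !e).label := by
    cases d <;> cases e <;> first | exact h2 | exact h2.symm
  exact h.twice (i, e) (j, f) (i, !e) (by simp [hj]) (by simp) (by simp [hj.symm]) h1 h3

theorem flip (h : IsTriangular P) : IsTriangular fun i e => P i !e where
  crosses i j hij := by
    obtain ⟨e, f, h1⟩ := h.crosses i j hij
    exact ⟨!e, !f, by simpa only [Bool.not_not] using h1⟩
  side i := by
    obtain ⟨s, hs⟩ := h.side i
    refine ⟨!s, fun j hj e f hl => (hs j hj _ _ hl).trans ?_⟩
    cases f <;> cases s <;> rfl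
  fits i j e f hne := h.fits i j _ _ (by simpa using hne)
  twice x y z hxy hxz hyz := h.twice (x.1, !x.2) (y.1, !y.2) (z.1, !z.2)
    (by simpa [Prod.ext_iff] using hxy) (by simpa [Prod.ext_iff] using hxz)
    (by simpa [Prod.ext_iff] using hyz)

theorem saturated (h : IsTriangular P) {n : Fin 3 → ℕ}
    (hn : ∀ i j, i ≠ j → n i + 2 ≤ n j ∨ n j + 2 ≤ n i) :
    Saturated P ([0, 1, 2].map fun i => (n i, i)) := by
  intro s hs e
  obtain ⟨i, -, rfl⟩ := List.mem_map.1 hs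
  refine Or.inr ?_
  have hmem : ∀ j : Fin 3, (n j, j) ∈ [0, 1, 2].map fun i : Fin 3 => (n i, i) := fun j =>
    List.mem_map_of_mem (by fin_cases j <;> simp)
  have hsrc : ∀ j, i ≠ j → ∀ e f : Bool,
      (bif f then n j else n j + 1) ≠ bif e then n i else n i + 1 := fun j hij e f => by
    have := hn i j hij
    cases e <;> cases f <;> simp only [cond_true, cond_false] <;> omega
  obtain ⟨j, k, hij, hik, hjk⟩ : ∃ j k, i ≠ j ∧ i ≠ k ∧ j ≠ k :=
    (by decide : ∀ i : Fin 3, ∃ j k, i ≠ j ∧ i ≠ k ∧ j ≠ k) i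
  obtain ⟨d, e', f, h1, -, h3⟩ := h.exists_order hij hik hjk
  by_cases hed : e = d
  · subst hed
    exact ⟨_, hmem j, e', h1.symm, hsrc j hij _ _⟩
  · obtain rfl : e = !d := Bool.eq_not.2 hed
    exact ⟨_, hmem k, f, h3.symm, hsrc k hik _ _⟩

/-- The levels of the middle strand follow from those of its partners. The two parity relations
express that the triangular region lies on one side of the top strand `k` and on one side of the
bottom strand `i`. -/
theorem isStack (h : IsTriangular P) (hij : i ≠ j) (hik : i ≠ k) (hjk : j ≠ k)
    (hi : ∀ e, (P i e).level = Level.lower) (hk : ∀ e, (P k e).level = Level.upper) :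
    ∃ d e f, IsStack P i j k d e f := by
  obtain ⟨d, e, f, h1, h2, h3⟩ := h.exists_order hij hik hjk
  have f1 := h.fits i j d e (by simp [hij]) h1
  have f2 := h.fits j k (!e) (!f) (by simp [hjk]) h2
  have f3 := h.fits i k (!d) f (by simp [hik]) h3
  have l1 : (P j e).level = Level.upper := by
    rcases f1.2 with g | g | g
    · rw [hi] at g; cases g.1
    · exact g.2
    · rw [hi] at g; cases g.1
  have l2 : (P j !e).level = Level.lower := by
    rcases f2.2 with g | g | g
    · rw [hk] at g; cases g.2
    · exact g.1
    · rw [hk] at g; cases g.2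
  obtain ⟨s, hs⟩ := h.side k
  obtain ⟨t, ht⟩ := h.side i
  refine ⟨d, e, f, ⟨l1, hi d, h1.symm⟩, ⟨hk _, l2, h2.symm⟩, ⟨hk _, hi _, h3.symm⟩, h.label_ne _ _,
    h.label_ne _ _, h.label_ne _ _, ?_, ?_⟩
  · rw [hs j hjk _ _ h2.symm, hs i hik _ _ h3.symm]
    cases d <;> cases e <;> cases s <;> rfl
  · rw [f1.1, f3.1, ht j hij.symm _ _ h1, ht k hik.symm _ _ h3]
    cases e <;> cases f <;> cases t <;> rfl

/-- The strand `k` makes two of the crossings virtual; the three cases are those of the remaining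
crossing. -/
theorem isDetour (h : IsTriangular P) (hij : i ≠ j) (hik : i ≠ k) (hjk : j ≠ k)
    (hk : ∀ e, (P k e).level = Level.virt) :
    (∃ d e, IsDetour P i j k d e) ∨ (∃ d e, IsDetour P j i k d e) ∨
      ∀ s, ∀ e, (P s e).level = Level.virt := by
  obtain ⟨d, e, f, h1, h2, h3⟩ := h.exists_order hij hik hjk
  have hv : ∀ l d g, l ≠ k → (P l d).label = (P k g).label → (P l d).level = Level.virt := by
    intro l d g hl hlab
    rcases (h.fits l k d g (by simp [hl]) hlab).2 with g | g | g
    · rw [hk] at g; cases g.2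
    · rw [hk] at g; cases g.2
    · exact g.1
  have v1 := hv i (!d) f hik h3
  have v2 := hv j (!e) (!f) hjk h2
  rcases (h.fits i j d e (by simp [hij]) h1).2 with g | g | g
  · exact Or.inr (Or.inl ⟨e, d, ⟨g.1, g.2, h1⟩, v2, v1, hk⟩)
  · exact Or.inl ⟨d, e, ⟨g.2, g.1, h1.symm⟩, v1, v2, hk⟩
  · refine Or.inr (Or.inr fun s a => ?_)
    have hs : s = i ∨ s = j ∨ s = k := (by decide : ∀ i j k : Fin 3, i ≠ j → i ≠ k → j ≠ k →
      ∀ s, s = i ∨ s = j ∨ s = k) i j k hij hik hjk s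
    have hb : ∀ a b : Bool, a = b ∨ a = !b := by decide
    rcases hs with rfl | rfl | rfl
    · rcases hb a d with rfl | rfl
      · exact g.1
      · exact v1
    · rcases hb a e with rfl | rfl
      · exact g.2
      · exact v2
    · exact hk a

theorem pairs (h : IsTriangular P) {n : Fin 3 → ℕ}
    (hn : ∀ i j, i ≠ j → n i + 2 ≤ n j ∨ n j + 2 ≤ n i)
    (hl : ((∃ i, ∀ e, (P i e).level = Level.upper) ∧ ∃ j, ∀ e, (P j e).level = Level.lower) ∨
      ∃ i, ∀ e, (P i e).level = Level.virt) :
    β.PairsCorrespond ([0, 1, 2].map fun i => (n i, i)) P (fun i e => P i !e) ∧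
      β.PairsDetermined ([0, 1, 2].map fun i => (n i, i)) P := by
  have hperm : ∀ i j k : Fin 3, i ≠ j → i ≠ k → j ≠ k → [i, j, k].Perm [0, 1, 2] := by decide
  have hperm' : ∀ {i j k : Fin 3}, i ≠ j → i ≠ k → j ≠ k →
      [(n i, i), (n j, j), (n k, k)].Perm ([0, 1, 2].map fun i => (n i, i)) :=
    fun {i j k} h1 h2 h3 => (hperm i j k h1 h2 h3).map fun i => (n i, i)
  have hsep : ∀ {i j k : Fin 3}, i ≠ j → i ≠ k → j ≠ k → Separate (n i) (n j) (n k) :=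
    fun h1 h2 h3 => ⟨hn _ _ h1, hn _ _ h2, hn _ _ h3⟩
  have hvirt : (∀ s, ∃ e, (P s e).level = Level.virt) →
      β.PairsDetermined ([0, 1, 2].map fun i => (n i, i)) P := fun hv => by
    refine β.pairsDetermined_of_virt (fun s hs => ?_) fun s _ => hv s.2
    obtain ⟨i, -, rfl⟩ := List.mem_map.1 hs
    have key : ∀ j, n i ≠ n j + 1 ∧ n i + 2 ≠ n j + 1 := fun j => by
      by_cases hij : i = j
      · rw [hij]; omega
      · have := hn i j hij; omega
    have k0 := key 0
    have k1 := key 1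
    have k2 := key 2
    simp only [middles, List.map_cons, List.map_nil, List.mem_cons, List.not_mem_nil, or_false]
    omega
  rcases hl with ⟨⟨k, hk⟩, i, hi⟩ | ⟨k, hk⟩
  · have hik : i ≠ k := fun hik => by
      have := hk true
      rw [← hik, hi] at this
      cases this
    obtain ⟨j, hij, hjk⟩ : ∃ j, i ≠ j ∧ j ≠ k :=
      (by decide : ∀ i k : Fin 3, i ≠ k → ∃ j, i ≠ j ∧ j ≠ k) i k hik
    obtain ⟨d, e, f, hs⟩ := h.isStack hij hik hjk hi hk
    exact ⟨PairsCorrespond.perm β (hperm' hij hik hjk) (hs.pairsCorrespond β (hsep hij hik hjk)),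
      PairsDetermined.perm β (hperm' hij hik hjk) (hs.pairsDetermined β (hsep hij hik hjk))⟩
  · obtain ⟨i, j, hij, hik, hjk⟩ : ∃ i j, i ≠ j ∧ i ≠ k ∧ j ≠ k :=
      (by decide : ∀ k : Fin 3, ∃ i j, i ≠ j ∧ i ≠ k ∧ j ≠ k) k
    have hall : ∀ s, s = i ∨ s = j ∨ s = k := (by decide : ∀ i j k : Fin 3, i ≠ j → i ≠ k →
      j ≠ k → ∀ s, s = i ∨ s = j ∨ s = k) i j k hij hik hjk
    rcases h.isDetour hij hik hjk hk with ⟨d, e, hd⟩ | ⟨d, e, hd⟩ | hv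
    · refine ⟨PairsCorrespond.perm β (hperm' hij hik hjk)
        (hd.pairsCorrespond β (hsep hij hik hjk)), hvirt fun s => ?_⟩
      rcases hall s with rfl | rfl | rfl
      · exact ⟨_, hd.virt₁⟩
      · exact ⟨_, hd.virt₂⟩
      · exact ⟨true, hk true⟩
    · refine ⟨PairsCorrespond.perm β (hperm' hij.symm hjk hik)
        (hd.pairsCorrespond β (hsep hij.symm hjk hik)), hvirt fun s => ?_⟩
      rcases hall s with rfl | rfl | rfl
      · exact ⟨_, hd.virt₂⟩
      · exact ⟨_, hd.virt₁⟩
      · exact ⟨true, hk true⟩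
    · exact ⟨β.pairsCorrespond_of_virt (fun s _ => hv s.2) fun s _ e => hv s.2 _,
        hvirt fun s => ⟨true, hv s true⟩⟩

end IsTriangular

end VirtualBracket

/-! #### Codes -/

section fill

variable {ι : Type*} {P : ι → Bool → Pass} {bs : List (List Pass × ι)} {t : List Pass}

theorem mem_locate_fill {X : Type*} (F : ℕ → X) {s : ℕ × ι} (hs : s ∈ starts 0 bs) (e : Bool) :
    (P s.2 e, strandLeg F s.1 e) ∈ locate F 0 (fill P bs t) :=
  (locate_fill_perm F P 0).mem_iff.2 (List.mem_append_right _ (mem_insertedPasses.2 ⟨s, hs, e, rfl⟩))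

theorem fits_of_isCode_fill (hw : IsCode (fill P bs t)) {s s' : ℕ × ι} (hs : s ∈ starts 0 bs)
    (hs' : s' ∈ starts 0 bs) {e e' : Bool} (hl : (P s.2 e).label = (P s'.2 e').label)
    (hne : (bif e' then s'.1 else s'.1 + 1) ≠ bif e then s.1 else s.1 + 1) :
    (P s.2 e).Fits (P s'.2 e') :=
  fits_of_isCode hw (mem_locate_fill (fun _ => ()) hs e) (mem_locate_fill (fun _ => ()) hs' e')
    hl.symm (by simpa only [strandLeg_start] using hne)

theorem label_ne_of_isCode_fill (hw : IsCode (fill P bs t)) {s s' s'' : ℕ × ι}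
    (hs : s ∈ starts 0 bs) (hs' : s' ∈ starts 0 bs) (hs'' : s'' ∈ starts 0 bs) {e e' e'' : Bool}
    (hne : (bif e' then s'.1 else s'.1 + 1) ≠ bif e then s.1 else s.1 + 1)
    (hne' : (bif e'' then s''.1 else s''.1 + 1) ≠ bif e then s.1 else s.1 + 1)
    (hne'' : (bif e' then s'.1 else s'.1 + 1) ≠ bif e'' then s''.1 else s''.1 + 1)
    (hl : (P s.2 e).label = (P s'.2 e').label) : (P s.2 e).label ≠ (P s''.2 e'').label :=
  fun hl' => hne'' <| by
    have := start_eq_of_isCode hw (mem_locate_fill (fun _ => ()) hs e)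
      (mem_locate_fill (fun _ => ()) hs' e') (mem_locate_fill (fun _ => ()) hs'' e'')
      hl.symm hl'.symm (by simpa only [strandLeg_start] using hne)
      (by simpa only [strandLeg_start] using hne')
    simpa only [strandLeg_start] using this

end fill

/-! ### The three kinds of Reidemeister moves on codes. -/

namespace VirtualBracket

variable {X R ι : Type*} [Biquandle X] [CommRing R] (β : VirtualBracket X R)

omit [Biquandle X] in
theorem apart_insertedPasses_of_virt {P : ι → Bool → Pass} {bs : List (List Pass × ι)}
    {t : List Pass} (h : ∀ i e, (P i e).level = Level.virt) (F : ℕ → X) :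
    Apart (keptPasses F 0 bs t) (insertedPasses F P (starts 0 bs)) :=
  (apart_of_virt fun _ ha => level_virt_of_mem_insertedPasses (fun s _ => h s.2) ha).symm

theorem Transfers.symm {w w' : List Pass} {ρ : ℕ → ℕ → Prop} (h : β.Transfers w w' ρ) :
    β.Transfers w' w fun i j => ρ j i := And.symm h

theorem transfers_third (l₀ l₁ l₂ l₃ : List Pass) (p q : Fin 3 → Pass) (h : IsTriangle p q)
    (hl : TriangleLevels p q)
    (hw : IsCode (l₀ ++ [p 0, q 0] ++ l₁ ++ [p 1, q 1] ++ l₂ ++ [p 2, q 2] ++ l₃))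
    (hw' : IsCode (l₀ ++ [q 0, p 0] ++ l₁ ++ [q 1, p 1] ++ l₂ ++ [q 2, p 2] ++ l₃)) :
    β.Transfers (l₀ ++ [p 0, q 0] ++ l₁ ++ [p 1, q 1] ++ l₂ ++ [p 2, q 2] ++ l₃)
      (l₀ ++ [q 0, p 0] ++ l₁ ++ [q 1, p 1] ++ l₂ ++ [q 2, p 2] ++ l₃)
      (fun i j => j = i ∧ i ≠ l₀.length + 1 ∧ i ≠ l₀.length + l₁.length + 3 ∧
        i ≠ l₀.length + l₁.length + l₂.length + 5) := by
  let P : Fin 3 → Bool → Pass := fun i e => bif e then p i else q i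
  let bs : List (List Pass × Fin 3) := [(l₀, 0), (l₁, 1), (l₂, 2)]
  -- Each earlier pair adds two passages to the position of the next one.
  let n : Fin 3 → ℕ := ![l₀.length, l₀.length + 2 + l₁.length,
    l₀.length + 2 + l₁.length + 2 + l₂.length]
  have hW : l₀ ++ [p 0, q 0] ++ l₁ ++ [p 1, q 1] ++ l₂ ++ [p 2, q 2] ++ l₃ = fill P bs l₃ := by
    simp [fill, bs, P]
  have hW' : l₀ ++ [q 0, p 0] ++ l₁ ++ [q 1, p 1] ++ l₂ ++ [q 2, p 2] ++ l₃ =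
      fill (fun i e => P i !e) bs l₃ := by
    simp [fill, bs, P]
  have hstarts : starts 0 bs = [0, 1, 2].map fun i => (n i, i) := by
    simp [starts, bs, n]
  have hmem : ∀ i, (n i, i) ∈ starts 0 bs := fun i => by
    rw [hstarts]; exact List.mem_map_of_mem (by fin_cases i <;> simp)
  have hn : ∀ i j, i ≠ j → n i + 2 ≤ n j ∨ n j + 2 ≤ n i := by
    have n0 : n 0 = l₀.length := rfl
    have n1 : n 1 = l₀.length + 2 + l₁.length := rfl
    have n2 : n 2 = l₀.length + 2 + l₁.length + 2 + l₂.length := rfl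
    have h3 : ∀ i : Fin 3, i = 0 ∨ i = 1 ∨ i = 2 := by decide
    intro i j hij
    rcases h3 i with rfl | rfl | rfl <;> rcases h3 j with rfl | rfl | rfl <;>
      first | exact absurd rfl hij | (rw [n0, n1]; omega) | (rw [n0, n2]; omega) | (rw [n1, n2]; omega)
  have hsrc : ∀ x y : Fin 3 × Bool, x ≠ y →
      (bif y.2 then n y.1 else n y.1 + 1) ≠ bif x.2 then n x.1 else n x.1 + 1 := by
    rintro ⟨i, e⟩ ⟨j, f⟩ hne
    by_cases hij : i = j
    · subst hij
      cases e <;> cases f <;> first | exact absurd rfl hne | (simp only [cond_true, cond_false]; omega)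
    · have := hn i j hij
      cases e <;> cases f <;> simp only [cond_true, cond_false] <;> omega
  rw [hW] at hw ⊢
  rw [hW'] at hw' ⊢
  have hP : ∀ i (t : Pass), (t = p i ∨ t = q i) ↔ ∃ e, t = P i e := fun i t => by
    simp [P, or_comm]
  have htri : IsTriangular P := by
    refine ⟨fun i j hij => ?_, fun i => ?_, fun i j e f hne hlab => ?_, fun x y z hxy hxz hyz => ?_⟩
    · obtain ⟨t, s, ht, hs, hts⟩ := h.1 i j hij
      obtain ⟨e, rfl⟩ := (hP i t).1 ht
      obtain ⟨f, rfl⟩ := (hP j s).1 hs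
      exact ⟨e, f, hts⟩
    · obtain ⟨s, hs⟩ := h.2 i
      refine ⟨s, fun j hj e f hlab => ?_⟩
      have := hs j hj _ ((hP i _).2 ⟨e, rfl⟩)
      cases f
      · rw [this.2 hlab]; cases s <;> rfl
      · rw [this.1 hlab]; cases s <;> rfl
    · exact fits_of_isCode_fill hw (hmem i) (hmem j) hlab (hsrc (i, e) (j, f) hne)
    · exact label_ne_of_isCode_fill hw (hmem x.1) (hmem y.1) (hmem z.1) (hsrc _ _ hxy) (hsrc _ _ hxz)
        (hsrc _ _ hyz.symm)
  have hlev : ((∃ i, ∀ e, (P i e).level = Level.upper) ∧ ∃ j, ∀ e, (P j e).level = Level.lower) ∨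
      ∃ i, ∀ e, (P i e).level = Level.virt := by
    have key : ∀ i v, ((p i).level = v ∧ (q i).level = v) ↔ ∀ e, (P i e).level = v := fun i v => by
      simp [P, and_comm]
    simp only [← key]
    exact hl
  have hlev' : ((∃ i, ∀ e, (P i !e).level = Level.upper) ∧ ∃ j, ∀ e, (P j !e).level = Level.lower) ∨
      ∃ i, ∀ e, (P i !e).level = Level.virt :=
    hlev.imp (fun h => ⟨h.1.imp fun _ h e => h _, h.2.imp fun _ h e => h _⟩) fun h =>
      h.imp fun _ h e => h _
  have hpairs := htri.pairs β hn hlev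
  have hpairs' := htri.flip.pairs β hn hlev'
  simp only [Bool.not_not] at hpairs'
  have hsat := (htri.saturated hn)
  have hsat' := (htri.flip.saturated hn)
  rw [← hstarts] at hpairs hpairs' hsat hsat'
  have hlen : (fill P bs l₃).length = l₀.length + l₁.length + l₂.length + l₃.length + 6 := by
    simp [fill, bs]; omega
  have hmid : ∀ k, k ∈ middles (starts 0 bs) ↔ (k = l₀.length + 1 ∨ k = l₀.length + l₁.length + 3 ∨
      k = l₀.length + l₁.length + l₂.length + 5) := fun k => by
    simp only [middles, starts, bs, List.map_cons, List.map_nil, List.mem_cons, List.not_mem_nil,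
      or_false]
    omega
  refine (Expands.refl β _).transfers β (length_fill _ _)
    (β.extends_fill (hsat.apart hw) (hsat'.apart hw') hpairs.1 hpairs'.2)
    (β.extends_fill (hsat'.apart hw') (hsat.apart hw) hpairs'.1 hpairs.2) ?_ ?_ ?_
  · simp only [hmid, hlen]; omega
  · intro i _ k _
    simp only [hmid, id]
    omega
  · exact fun i hi => ⟨i, hi, rfl⟩

theorem expands_insert_two (l₀ l₁ : List Pass) (d : Pass) (hd : d.level = Level.virt) :
    β.Expands (l₀ ++ l₁) (l₀ ++ [d, d] ++ l₁) fun j =>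
      if j ≤ l₀.length then j else if j ≤ l₀.length + 2 then l₀.length else j - 2 := by
  have h1 := β.expands_insert l₀ l₁ d hd
  have h2 := β.expands_insert l₀ ([d] ++ l₁) d hd
  rw [← List.append_assoc] at h2
  have h3 := h1.trans β h2
  rw [← List.append_assoc, List.append_assoc l₀ [d] [d]] at h3
  convert h3 using 1
  · rfl
  funext j
  simp only [Function.comp]
  split_ifs <;> omega

/-- The kink is compared with two dummy virtual passages at the same place, so that both lists have
the same semi-arcs and differ in one inner color only. -/
theorem transfers_first (l₀ l₁ : List Pass) (p q : Pass) (hpq : p.label = q.label)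
    (hl : StrandLevels p.level q.level) (hw : IsCode (l₀ ++ [p, q] ++ l₁)) :
    β.Transfers (l₀ ++ l₁) (l₀ ++ [p, q] ++ l₁)
      (fun i j => (i ≤ l₀.length ∧ j = i) ∨ (l₀.length ≤ i ∧ j = i + 2)) := by
  let P : Unit → Bool → Pass := fun _ e => bif e then p else q
  -- The label may coincide with another one: a virtual passage enters colorings and products only
  -- through its level.
  let d : Pass := ⟨0, Level.virt, true⟩
  let D : Unit → Bool → Pass := fun _ _ => d
  let bs : List (List Pass × Unit) := [(l₀, ())]
  have hW : l₀ ++ [p, q] ++ l₁ = fill P bs l₁ := by simp [fill, bs, P]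
  have hW' : l₀ ++ [d, d] ++ l₁ = fill D bs l₁ := by simp [fill, bs, D]
  have hstarts : starts 0 bs = [(l₀.length, ())] := by simp [starts, bs]
  have hsat : Saturated P (starts 0 bs) := by
    intro s hs e
    refine Or.inr ⟨s, hs, !e, ?_, ?_⟩
    · cases e
      · exact hpq
      · exact hpq.symm
    · cases e <;> simp
  have hD : ∀ i e, (D i e).level = Level.virt := fun _ _ => rfl
  have hpairs : β.PairsCorrespond (starts 0 bs) D P ∧ β.PairsCorrespond (starts 0 bs) P D ∧
      β.PairsDetermined (starts 0 bs) P := by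
    rw [hstarts]
    have key : ∀ f, (P () !f).IsOver (P () f) → β.PairsCorrespond [(l₀.length, ())] D P ∧
        β.PairsCorrespond [(l₀.length, ())] P D ∧ β.PairsDetermined [(l₀.length, ())] P := fun f hf =>
      ⟨β.pairsCorrespond_straight_kink (hD ()) hf, β.pairsCorrespond_kink_straight (hD ()) hf,
        β.pairsDetermined_kink hf⟩
    generalize hp : p.level = v at hl
    generalize hq : q.level = v' at hl
    cases hl with
    | over_under => exact key false ⟨hp, hq, hpq⟩
    | under_over => exact key true ⟨hq, hp, hpq.symm⟩
    | virt_virt =>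
      have hv : ∀ i e, (P i e).level = Level.virt := fun i e => by
        cases e
        · exact hq
        · exact hp
      refine ⟨β.pairsCorrespond_of_virt (fun s _ => hD s.2) fun s _ => hv s.2,
        β.pairsCorrespond_of_virt (fun s _ => hv s.2) fun s _ => hD s.2,
        β.pairsDetermined_of_virt ?_ fun s _ => ⟨true, hv s.2 true⟩⟩
      simp [middles]
  have hdet : β.PairsDetermined (starts 0 bs) D := by
    refine β.pairsDetermined_of_virt ?_ fun s _ => ⟨true, hD s.2 true⟩
    rw [hstarts]
    simp [middles]
  have hlen : (fill D bs l₁).length = l₀.length + l₁.length + 2 := by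
    simp [fill, bs]; omega
  have hmid : ∀ k, k ∈ middles (starts 0 bs) ↔ k = l₀.length + 1 := fun k => by
    simp [middles, starts, bs]
  have hexp := β.expands_insert_two l₀ l₁ d rfl
  rw [hW] at hw ⊢
  rw [hW'] at hexp
  refine hexp.transfers β (length_fill _ _)
    (β.extends_fill (apart_insertedPasses_of_virt hD) (hsat.apart hw) hpairs.1 hpairs.2.2)
    (β.extends_fill (hsat.apart hw) (apart_insertedPasses_of_virt hD) hpairs.2.1 hdet) ?_ ?_ ?_
  · simp only [hmid, hlen]; omega
  · intro i _ k _
    simp only [hmid]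
    split_ifs <;> omega
  · intro i hi
    rw [List.length_append] at hi
    simp only [hlen]
    by_cases h : i ≤ l₀.length
    · exact ⟨i, by omega, by rw [if_pos h]⟩
    · exact ⟨i + 2, by omega, by rw [if_neg (by omega), if_neg (by omega)]; omega⟩

theorem transfers_second (l₀ l₁ l₂ : List Pass) (p q p' q' : Pass)
    (hlab : (p'.label = p.label ∧ q'.label = q.label) ∨ (p'.label = q.label ∧ q'.label = p.label))
    (hpq : q.level = p.level) (hpq' : q'.level = p'.level) (hl : StrandLevels p.level p'.level)
    (ht : q.toLeft = !p.toLeft) (hw : IsCode (l₀ ++ [p, q] ++ l₁ ++ [p', q'] ++ l₂)) :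
    β.Transfers (l₀ ++ l₁ ++ l₂) (l₀ ++ [p, q] ++ l₁ ++ [p', q'] ++ l₂)
      (fun i j => (i ≤ l₀.length ∧ j = i) ∨
        (l₀.length ≤ i ∧ i ≤ l₀.length + l₁.length ∧ j = i + 2) ∨
        (l₀.length + l₁.length ≤ i ∧ j = i + 4)) := by
  let P : Bool → Bool → Pass := fun i e => bif i then bif e then p else q else bif e then p' else q'
  let d : Pass := ⟨0, Level.virt, true⟩
  let D : Bool → Bool → Pass := fun _ _ => d
  let bs : List (List Pass × Bool) := [(l₀, true), (l₁, false)]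
  have hW : l₀ ++ [p, q] ++ l₁ ++ [p', q'] ++ l₂ = fill P bs l₂ := by simp [fill, bs, P]
  have hW' : l₀ ++ [d, d] ++ l₁ ++ [d, d] ++ l₂ = fill D bs l₂ := by simp [fill, bs, D]
  set m := l₀.length with hm
  obtain ⟨n, hn⟩ : ∃ n, n = m + 2 + l₁.length := ⟨_, rfl⟩
  have hstarts : starts 0 bs = [(m, true), (n, false)] := by simp [starts, bs, hn, hm]
  have hmn : m + 2 ≤ n ∨ n + 2 ≤ m := by omega
  have hD : ∀ i e, (D i e).level = Level.virt := fun _ _ => rfl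
  rw [hW] at hw ⊢
  have hm₁ : (m, true) ∈ starts 0 bs := by simp [hstarts]
  have hm₂ : (n, false) ∈ starts 0 bs := by simp [hstarts]
  have hsat : Saturated P (starts 0 bs) := by
    rw [hstarts]
    intro s hs e
    right
    simp only [List.mem_cons, List.not_mem_nil, or_false] at hs
    rcases hlab with ⟨h1, h2⟩ | ⟨h1, h2⟩
    · rcases hs with rfl | rfl
      · refine ⟨(n, false), by simp, e, ?_, by cases e <;> simp <;> omega⟩
        cases e
        · exact h2
        · exact h1
      · refine ⟨(m, true), by simp, e, ?_, by cases e <;> simp <;> omega⟩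
        cases e
        · exact h2.symm
        · exact h1.symm
    · rcases hs with rfl | rfl
      · refine ⟨(n, false), by simp, !e, ?_, by cases e <;> simp <;> omega⟩
        cases e
        · exact h1
        · exact h2
      · refine ⟨(m, true), by simp, !e, ?_, by cases e <;> simp <;> omega⟩
        cases e
        · exact h2.symm
        · exact h1.symm
  have hne : p.label ≠ q.label := by
    rcases hlab with ⟨h1, -⟩ | ⟨-, h2⟩
    · exact label_ne_of_isCode_fill hw hm₁ hm₂ hm₁ (e := true) (e' := true) (e'' := false)
        (by simp; omega) (by simp) (by simp; omega) h1.symm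
    · exact label_ne_of_isCode_fill hw hm₁ hm₂ hm₁ (e := true) (e' := false) (e'' := false)
        (by simp; omega) (by simp) (by simp; omega) h2.symm
  have hne' : p'.label ≠ q'.label := by
    rcases hlab with ⟨h1, h2⟩ | ⟨h1, h2⟩ <;> rw [h1, h2]
    · exact hne
    · exact hne.symm
  -- The opposite signs of the two crossings, given on the first strand, carry over to the second
  -- one since the directions at each crossing are compatible.
  have ht' : q'.toLeft = !p'.toLeft := by
    have hfit : ∀ e f, (P true e).label = (P false f).label → (P true e).Fits (P false f) :=
      fun e f h => fits_of_isCode_fill hw hm₁ hm₂ h (by cases e <;> cases f <;> simp <;> omega)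
    rcases hlab with ⟨h1, h2⟩ | ⟨h1, h2⟩
    · have f1 : p'.toLeft = !p.toLeft := (hfit true true h1.symm).1
      have f2 : q'.toLeft = !q.toLeft := (hfit false false h2.symm).1
      rw [f1, f2, ht]
    · have f1 : p'.toLeft = !q.toLeft := (hfit false true h1.symm).1
      have f2 : q'.toLeft = !p.toLeft := (hfit true false h2.symm).1
      rw [f1, f2, ht, Bool.not_not]
  have hpairs : β.PairsCorrespond (starts 0 bs) D P ∧ β.PairsCorrespond (starts 0 bs) P D ∧
      β.PairsDetermined (starts 0 bs) P := by
    rw [hstarts]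
    have key : ∀ f, IsBigon P true false f → β.PairsCorrespond [(m, true), (n, false)] D P ∧
        β.PairsCorrespond [(m, true), (n, false)] P D ∧
          β.PairsDetermined [(m, true), (n, false)] P := fun f hf =>
      ⟨hf.pairsCorrespond_straight β hD hmn, hf.pairsCorrespond β hD hmn, hf.pairsDetermined β hmn⟩
    have hperm : [(n, false), (m, true)].Perm [(m, true), (n, false)] := List.Perm.swap _ _ _
    have key' : ∀ f, IsBigon P false true f → β.PairsCorrespond [(m, true), (n, false)] D P ∧
        β.PairsCorrespond [(m, true), (n, false)] P D ∧
          β.PairsDetermined [(m, true), (n, false)] P := fun f hf =>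
      ⟨PairsCorrespond.perm β hperm (hf.pairsCorrespond_straight β hD hmn.symm),
        PairsCorrespond.perm β hperm (hf.pairsCorrespond β hD hmn.symm),
        PairsDetermined.perm β hperm (hf.pairsDetermined β hmn.symm)⟩
    generalize hp : p.level = v at hl hpq
    generalize hp' : p'.level = v' at hl hpq'
    cases hl with
    | over_under =>
      rcases hlab with ⟨h1, h2⟩ | ⟨h1, h2⟩
      · exact key' true ⟨⟨hp, hp', h1.symm⟩, ⟨hpq, hpq', h2.symm⟩, hne', ht⟩
      · exact key' false ⟨⟨hpq, hp', h1.symm⟩, ⟨hp, hpq', h2.symm⟩, hne', by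
          change p.toLeft = !q.toLeft
          rw [ht, Bool.not_not]⟩
    | under_over =>
      rcases hlab with ⟨h1, h2⟩ | ⟨h1, h2⟩
      · exact key true ⟨⟨hp', hp, h1⟩, ⟨hpq', hpq, h2⟩, hne, ht'⟩
      · exact key false ⟨⟨hpq', hp, h2⟩, ⟨hp', hpq, h1⟩, hne, by
          change p'.toLeft = !q'.toLeft
          rw [ht', Bool.not_not]⟩
    | virt_virt =>
      have hv : ∀ i e, (P i e).level = Level.virt := fun i e => by
        cases e <;> cases i
        · exact hpq'
        · exact hpq
        · exact hp'
        · exact hp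
      refine ⟨β.pairsCorrespond_of_virt (fun s _ => hD s.2) fun s _ => hv s.2,
        β.pairsCorrespond_of_virt (fun s _ => hv s.2) fun s _ => hD s.2,
        β.pairsDetermined_of_virt ?_ fun s _ => ⟨true, hv s.2 true⟩⟩
      simp [middles]
      omega
  have hdet : β.PairsDetermined (starts 0 bs) D := by
    refine β.pairsDetermined_of_virt ?_ fun s _ => ⟨true, hD s.2 true⟩
    rw [hstarts]
    simp [middles]
    omega
  have hlen : (fill D bs l₂).length = l₀.length + l₁.length + l₂.length + 4 := by
    simp [fill, bs]; omega
  have hmid : ∀ k, k ∈ middles (starts 0 bs) ↔ k = m + 1 ∨ k = n + 1 := fun k => by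
    simp [hstarts, middles]
  have hexp := (β.expands_insert_two l₀ (l₁ ++ l₂) d rfl)
  rw [← List.append_assoc, ← List.append_assoc] at hexp
  have hexp' := hexp.trans β (β.expands_insert_two (l₀ ++ [d, d] ++ l₁) l₂ d rfl)
  rw [hW'] at hexp'
  refine hexp'.transfers β (length_fill _ _)
    (β.extends_fill (apart_insertedPasses_of_virt hD) (hsat.apart hw) hpairs.1 hpairs.2.2)
    (β.extends_fill (hsat.apart hw) (apart_insertedPasses_of_virt hD) hpairs.2.1 hdet) ?_ ?_ ?_
  · simp only [hmid, hlen]; omega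
  · intro i _ k _
    simp only [hmid, Function.comp, List.length_append, List.length_cons, List.length_nil, ← hm]
    split_ifs <;> omega
  · intro i hi
    simp only [List.length_append] at hi
    simp only [hlen, Function.comp, List.length_append, List.length_cons, List.length_nil, ← hm]
    by_cases h : i ≤ m
    · exact ⟨i, by omega, by split_ifs <;> omega⟩
    · by_cases h' : i ≤ m + l₁.length
      · exact ⟨i + 2, by omega, by split_ifs <;> omega⟩
      · exact ⟨i + 4, by omega, by split_ifs <;> omega⟩

end VirtualBracket

namespace VirtualBracket

open StateRing CrossingType

variable {X R : Type*} [Biquandle X] [CommRing R] (β : VirtualBracket X R)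

/-! #### Renaming of crossings -/

omit [Biquandle X] in
theorem locate_relabel (e : Equiv.Perm ℕ) (F : ℕ → X) (n : ℕ) (w : List Pass) :
    locate F n (w.map (Pass.relabel e)) = (locate F n w).map fun a => (a.1.relabel e, a.2) := by
  induction w generalizing n with
  | nil => rfl
  | cons p w ih => simp [locate, ih]

omit [Biquandle X] in
theorem over_relabel (e : Equiv.Perm ℕ) (o u : LocatedPass X) :
    Over (o.1.relabel e, o.2) (u.1.relabel e, u.2) ↔ Over o u := by
  simp [Over, Pass.relabel]

theorem colored_relabel (e : Equiv.Perm ℕ) (F : ℕ → X) (w : List Pass) :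
    β.Colored (locate F 0 (w.map (Pass.relabel e))) ↔ β.Colored (locate F 0 w) := by
  simp only [locate_relabel, Colored, List.forall_mem_map, over_relabel]
  rfl

theorem stateSum_relabel (e : Equiv.Perm ℕ) (F : ℕ → X) (w : List Pass) :
    β.stateSum F (w.map (Pass.relabel e)) = β.stateSum F w := by
  apply algebraMap_stateRing_injective
  rw [← integrals_diagram, ← integrals_diagram, List.length_map, locate_relabel]
  congr 1
  simp only [diagram, List.map_map, Function.comp_def, pairValue, over_relabel]
  rfl

theorem transfers_relabel (e : Equiv.Perm ℕ) (w : List Pass) :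
    β.Transfers w (w.map (Pass.relabel e)) fun i j => j = i := by
  refine ⟨⟨rfl, List.length_map .., fun F hF => ⟨F, (β.colored_relabel e F w).2 hF,
    fun i _ j _ h => h ▸ rfl, (β.stateSum_relabel e F w).symm⟩, fun F F' G' _ _ _ h h' j hj => ?_⟩,
    ⟨rfl, List.length_map .., fun F hF => ⟨F, (β.colored_relabel e F w).1 hF,
    fun i _ j _ h => h ▸ rfl, β.stateSum_relabel e F w⟩, fun F F' G' _ _ _ h h' j hj => ?_⟩⟩
  · rw [List.length_map] at h h' hj
    exact (h j hj j hj rfl).symm.trans (h' j hj j hj rfl)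
  · rw [List.length_map] at h h'
    exact (h j hj j hj rfl).symm.trans (h' j hj j hj rfl)

theorem transfers_of_move {w w' : List Pass} {ρ : ℕ → ℕ → Prop} (h : Move w w' ρ) :
    IsCode w → IsCode w' → β.Transfers w w' ρ := by
  induction h with
  | rename w e => exact fun _ _ => β.transfers_relabel e w
  | r1 l₀ l₁ p q hpq hl => exact fun _ hw' => β.transfers_first l₀ l₁ p q hpq hl hw'
  | r2 l₀ l₁ l₂ p q p' q' hlab hpq hpq' hl ht =>
    exact fun _ hw' => β.transfers_second l₀ l₁ l₂ p q p' q' hlab hpq hpq' hl ht hw'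
  | r3 l₀ l₁ l₂ l₃ p q h hl => exact β.transfers_third l₀ l₁ l₂ l₃ p q h hl
  | symm w w' ρ _ ih => exact fun hw hw' => (ih hw' hw).symm

/-! #### Colorings of diagrams -/

section coloring

variable {K K' : VirtualKnotoidDiagram} {ρ : ℕ → ℕ → Prop}

/-- The colors of a coloring, extended to all natural numbers. -/
def _root_.Coloring.color (f : Coloring K X) (i : ℕ) : X := f.1 (Fin.ofNat _ i)

theorem color_coe (f : Coloring K X) : (fun i : SemiArc K.code => f.color i) = f.1 := by
  funext i
  rw [Coloring.color]
  exact congrArg f.1 (Fin.ext (Nat.mod_eq_of_lt i.2))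

theorem color_apply (f : Coloring K X) (i : SemiArc K.code) : f.color i = f.1 i :=
  congrFun (color_coe f) i

theorem colored_color (f : Coloring K X) : β.Colored (locate f.color 0 K.code) := by
  rw [← colored_locate, color_coe]
  exact f.2

theorem value_eq_stateSum (f : Coloring K X) : β.value f = β.stateSum f.color K.code := by
  rw [value, stateSum, color_coe]

theorem agree_iff (f : Coloring K X) (f' : Coloring K' X) : f.Agree ρ f' ↔
    ∀ i ≤ K.code.length, ∀ j ≤ K'.code.length, ρ i j → f.color i = f'.color j := by
  constructor
  · intro h i hi j hj hij
    exact (color_apply f ⟨i, by omega⟩).trans ((h ⟨i, by omega⟩ ⟨j, by omega⟩ hij).trans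
      (color_apply f' ⟨j, by omega⟩).symm)
  · intro h i j hij
    rw [← color_apply, ← color_apply]
    exact h i (by omega) j (by omega) hij

theorem TransfersTo.exists_coloring' (h : β.TransfersTo K.code K'.code ρ) (f : Coloring K X) :
    ∃ f' : Coloring K' X, f.Agree ρ f' ∧ β.value f = β.value f' ∧
      ∀ g' : Coloring K' X, f.Agree ρ g' → g' = f' := by
  obtain ⟨F', h1, h2, h3⟩ := h.exists_coloring f.color (β.colored_color f)
  let f' : Coloring K' X := ⟨fun i => F' i, (β.colored_locate F' _).2 h1⟩
  have hf' : ∀ j ≤ K'.code.length, f'.color j = F' j := fun j hj =>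
    color_apply f' ⟨j, by omega⟩
  have hagree : f.Agree ρ f' := (agree_iff f f').2 fun i hi j hj hij => by
    rw [hf' j hj]; exact h2 i hi j hj hij
  refine ⟨f', hagree, ?_, fun g' hg' => ?_⟩
  · rw [value_eq_stateSum, h3]; rfl
  · apply Subtype.ext
    funext j
    rw [← color_apply, ← color_apply]
    exact h.unique f.color g'.color f'.color (β.colored_color f) (β.colored_color g')
      (β.colored_color f') ((agree_iff f g').1 hg') ((agree_iff f f').1 hagree) j (by omega)

theorem existsUnique_agree (h : Move K.code K'.code ρ) (f : Coloring K X) :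
    (∃! f' : Coloring K' X, f.Agree ρ f') ∧
      ∀ f' : Coloring K' X, f.Agree ρ f' → β.value f = β.value f' := by
  obtain ⟨f', h1, h2, h3⟩ :=
    (β.transfers_of_move h K.isCode K'.isCode).1.exists_coloring' β f
  exact ⟨⟨f', h1, h3⟩, fun g' hg' => h3 g' hg' ▸ h2⟩

theorem agree_swap {f : Coloring K X} {f' : Coloring K' X} :
    f'.Agree (fun i j => ρ j i) f ↔ f.Agree ρ f' :=
  ⟨fun h i j hij => (h j i hij).symm, fun h i j hij => (h j i hij).symm⟩

/-- Transfers in both directions are mutually inverse by uniqueness. They keep the end colors, since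
`ρ` relates the two tails and the two heads. -/
theorem valueMultiset_eq_of_move [Fintype X] (h : Move K.code K'.code ρ) (a b : X) :
    β.valueMultiset K a b = β.valueMultiset K' a b := by
  obtain ⟨h₁, h₂⟩ := β.transfers_of_move h K.isCode K'.isCode
  choose φ φ₁ φ₂ φ₃ using fun f => h₁.exists_coloring' β f
  choose ψ ψ₁ _ ψ₃ using fun f => h₂.exists_coloring' β f
  have hψφ : ∀ f, ψ (φ f) = f := fun f => (ψ₃ _ _ (agree_swap.2 (φ₁ f))).symm
  have hφψ : ∀ f, φ (ψ f) = f := fun f => (φ₃ _ _ (agree_swap.1 (ψ₁ f))).symm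
  have htail : ∀ f, (φ f).tailColor = f.tailColor := fun f => (φ₁ f _ _ h₁.tail).symm
  have hhead : ∀ f, (φ f).headColor = f.headColor := fun f => (φ₁ f _ _ h₁.head).symm
  let e : Coloring K X ≃ Coloring K' X := ⟨φ, ψ, hψφ, hφψ⟩
  have hmap : coloringsFromTo K' a b = (coloringsFromTo K a b).map e.toEmbedding := by
    ext f'
    obtain ⟨f, rfl⟩ := e.surjective f'
    simp only [coloringsFromTo, Finset.mem_filter, Finset.mem_univ, true_and, Finset.mem_map_equiv,
      Equiv.symm_apply_apply]
    exact and_congr (by rw [← htail f]; rfl) (by rw [← hhead f]; rfl)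
  rw [valueMultiset, valueMultiset, hmap, Finset.map_val, Multiset.map_map]
  exact Multiset.map_congr rfl fun f _ => φ₂ f

theorem valueMultiset_eq [Fintype X] (h : SameVirtualKnotoid K K') (a b : X) :
    β.valueMultiset K a b = β.valueMultiset K' a b := by
  induction h with
  | rel K K' h => exact β.valueMultiset_eq_of_move h.choose_spec a b
  | refl => rfl
  | symm _ _ _ ih => exact ih.symm
  | trans _ _ _ _ _ ih ih' => exact ih.trans ih'

/-- An entry of the matrix is the sum of `u ^ r` over the members `r` of the corresponding multiset.
-/
theorem bracketMatrix_eq_of_valueMultiset_eq [Fintype X]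
    (h : ∀ a b : X, β.valueMultiset K a b = β.valueMultiset K' a b) :
    β.bracketMatrix K = β.bracketMatrix K' := by
  have key : ∀ (K : VirtualKnotoidDiagram) (a b : X), β.bracketMatrix K a b =
      ((β.valueMultiset K a b).map fun r => AddMonoidAlgebra.single r (1 : ℤ)).sum := fun K a b => by
    rw [valueMultiset, Multiset.map_map]; rfl
  ext1 a b
  rw [key, key, h]

end coloring

end VirtualBracket

theorem mainTheorem5 {X R : Type*} [Biquandle X] [CommRing R] (β : VirtualBracket X R) :
    (∀ (K K' : VirtualKnotoidDiagram) (ρ : ℕ → ℕ → Prop), Move K.code K'.code ρ →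
      ∀ f : Coloring K X,
        (∃! f' : Coloring K' X, f.Agree ρ f') ∧
        ∀ f' : Coloring K' X, f.Agree ρ f' → β.value f = β.value f') ∧
    (∀ [Fintype X] (K K' : VirtualKnotoidDiagram), SameVirtualKnotoid K K' →
      (∀ a b : X, β.valueMultiset K a b = β.valueMultiset K' a b) ∧
      β.bracketMatrix K = β.bracketMatrix K') := by
  refine ⟨fun K K' ρ h f => β.existsUnique_agree h f, fun K K' h => ?_⟩
  have hval := fun a b => β.valueMultiset_eq h a b
  exact ⟨hval, β.bracketMatrix_eq_of_valueMultiset_eq hval⟩
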